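/- Let $n,N\ge 1$ be integers, $\lambda\vdash n$ a partition with parts $\lambda_1\ge\dots\ge\lambda_\ell>0$, $\theta$ a permutation of $\langle n\rangle=\{1,\dots,n\}$ whose cycle type (fixed points counted as parts $1$) is $\lambda$, and $\Theta$ the partition of $\langle n\rangle$ into $\theta$-orbits. Let $\Xi_N$ be a standard $N\times N$ GUE matrix, i.e. a random Hermitian matrix whose diagonal entries and whose real and imaginary parts of entries above the diagonal are independent centered Gaussians, of variance $1$ on the diagonal and variance $\frac12$ for the real and imaginary parts. Put $$\mathfrak M_{\lambda,N}=\kappa\left(\operatorname{tr}\Xi_N^{\lambda_1},\dots,\operatorname{tr}\Xi_N^{\lambda_\ell}\right),$$ where $\kappa(X_1,\dots,X_\ell)=\sum_{\Pi}(-1)^{|\Pi|-1}(|\Pi|-1)!\prod_{A\in\Pi}\mathbf E\prod_{i\in A}X_i$ (sum over the set partitions $\Pi$ of $\{1,\dots,\ell\}$) is the joint cumulant. Notation. (a) A bond is a two-element subset of $\langle n\rangle$. For a set $\Gamma$ of bonds, $\Gamma\vee\Theta$ is the finest partition coarser than or equal to $\Theta$ such that every $e\in\Gamma$ lies in one block;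 $\mathrm{Tree}_n(\Theta)$ is the set of all $\Gamma$ such that $\Gamma\vee\Theta$ has only one block and $|\Gamma|+1=|\Theta|$. (b) For a partition $\Pi$ of $\langle n\rangle$ let $[\Pi]$ be the $n\times n$ matrix with $(i,j)$ entry $1$ if $i,j$ are in the same block and $0$ otherwise. For $\Gamma\in\mathrm{Tree}_n(\Theta)$ with $m=|\Gamma|$, $\mathbb P^\Theta_\Gamma$ is the probability measure on the set of positive semidefinite $n\times n$ matrices with entries in $[0,1]$ and unit diagonal given by $$\int F\,d\mathbb P_\Gamma^\Theta=\sum_{(e_1,\dots,e_m)}\ \int_{1>t_1>\dots>t_m>0}F\left([\Theta]+\sum_{\alpha=1}^{m}t_\alpha\big([\{e_1,\dots,e_\alpha\}\vee\Theta]-[\{e_1,\dots,e_{\alpha-1}\}\vee\Theta]\big)\right)dt_1\cdots dt_m,$$ the sum being over all orderings $(e_1,\dots,e_m)$ of $\Gamma$. (c) On $\mathbb R[z]$, $z=\{z_{ij}\}_{1\le i\le n,\,0\le j\le 2N}$, put $D_{\{i,i'\}}=\sum_{j=0}^{2N}\frac{\partial^2}{\partial z_{ij}\partial z_{i'j}}$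 and $D^\Gamma=\prod_{e\in\Gamma}D_e$. (d) $\mathrm{Motz}_n^N(\theta)$ is the set of $h:\langle n\rangle\to\{1,\dots,N\}$ with $|h(\theta(i))-h(i)|\le1$ for all $i$ (families of closed Motzkin paths indexed by the $\theta$-orbits). Put $J_h(\epsilon)=\{i\mid h(\theta(i))=h(i)+\epsilon\}$ and $$f^h=\prod_{i\in J_h(0)}z_{i0}\cdot\prod_{i\in J_h(1)}\ \sum_{j=1}^{2h(i)}\frac{z_{ij}^2}{2}.$$ (e) Let $\{\xi_{kj}\}_{k\ge 1,\,j\ge 0}$ be i.i.d. standard normal and $\zeta^h_{ij}=\xi_{h(i),j}$ for $1\le i\le n$, $0\le j\le 2N$. For a positive semidefinite $Q$ with entries in $[0,1]$ and unit diagonal, $\zeta^h\star Q$ is a centered Gaussian family with $\mathbf E(\zeta^h\star Q)_{ij}(\zeta^h\star Q)_{i'j'}=Q(i,i')\,\mathbf E\zeta^h_{ij}\zeta^h_{i'j'}$. Then $$\mathfrak M_{\lambda,N}=\sum_{(\Gamma,h)\in \mathrm{Tree}_n(\Theta)\times\mathrm{Motz}_n^N(\theta)}\left(\prod_{\{i_1,i_2\}\in\Gamma}\delta_{h(i_1),h(i_2)}\right)\int\mathbf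 E\left[(D^\Gamma f^h)(\zeta^h\star Q)\right]\,\mathbb P^\Theta_\Gamma(dQ).$$ Furthermore, the summand indexed by $(\Gamma,h)$ vanishes unless all four of the following conditions hold: 1. $h$ is constant on each $e\in\Gamma$; 2. for each $e\in\Gamma$, $e\subset J_h(0)$ or $e\subset J_h(1)$; 3. for each $i\in J_h(0)$ there is at most one $e\in\Gamma$ with $i\in e$; 4. for each $i\in\langle n\rangle$ there are at most two $e\in\Gamma$ with $i\in e$. -/

import Mathlib

namespace GUECumulant

open MeasureTheory ProbabilityTheory
open scoped Nat

noncomputable section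

/-! ### Joint cumulants and standard GUE matrices -/

/-- The joint cumulant of a nonempty finite family of real random variables, as a sum over the set
partitions `π` of the index set with weights `(-1)^(|π|-1) (|π|-1)!`. -/
def jointCumulant {Ω : Type*} [MeasurableSpace Ω] (P : Measure Ω)
    {ι : Type*} [Fintype ι] [DecidableEq ι] (X : ι → Ω → ℝ) : ℝ :=
  ∑ π : Finpartition (Finset.univ : Finset ι),
    (-1 : ℝ) ^ (π.parts.card - 1) * ((π.parts.card - 1)! : ℝ) *
      ∏ A ∈ π.parts, ∫ ω, ∏ i ∈ A, X i ω ∂P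

/-- The real coordinates of a Hermitian matrix: for `i ≤ j` the real part of the entry `(i, j)` is
stored at `(i, j)`, and for `i < j` the imaginary part of the entry `(i, j)` is stored
at `(j, i)`. -/
def hermitianCoord {N : ℕ} (H : Matrix (Fin N) (Fin N) ℂ) (p : Fin N × Fin N) : ℝ :=
  if p.1 ≤ p.2 then (H p.1 p.2).re else (H p.2 p.1).im

/-- A standard GUE matrix: a random Hermitian matrix whose diagonal entries and whose real and
imaginary parts of entries above the diagonal are independent centered Gaussians, the former of
variance `1` and the latter of variance `1 / 2`. -/
structure IsStandardGUE {Ω : Type*} [MeasurableSpace Ω] {N : ℕ}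
    (Ξ : Ω → Matrix (Fin N) (Fin N) ℂ) (P : Measure Ω) : Prop where
  isHermitian : ∀ᵐ ω ∂P, (Ξ ω).IsHermitian
  indep : iIndepFun (fun (p : Fin N × Fin N) (ω : Ω) => hermitianCoord (Ξ ω) p) P
  hasLaw : ∀ p : Fin N × Fin N, HasLaw (fun ω => hermitianCoord (Ξ ω) p)
    (gaussianReal 0 (if p.1 = p.2 then 1 else 1 / 2)) P

/-- The joint cumulant of `tr Ξ ^ lam_1, …, tr Ξ ^ lam_ℓ`, where `lam_1 ≥ … ≥ lam_ℓ` are the parts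
of `lam`. (Traces of powers of Hermitian matrices are real.) -/
def traceCumulant {Ω : Type*} [MeasurableSpace Ω] (P : Measure Ω) {N : ℕ}
    (Ξ : Ω → Matrix (Fin N) (Fin N) ℂ) {n : ℕ} (lam : n.Partition) : ℝ :=
  jointCumulant P fun (i : Fin (lam.parts.sort (· ≥ ·)).length) ω =>
    (Matrix.trace (Ξ ω ^ (lam.parts.sort (· ≥ ·)).get i)).re

/-! ### Bonds, trees and interpolation measures

Set partitions of `{1, …, n}` are represented by equivalence relations on `Fin n`, ordered by
refinement; bonds are the non-diagonal elements of `Sym2 (Fin n)`. -/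

/-- The partition `Γ ∨ Θ`: the finest coarsening of `Θ` such that every bond in `Γ` lies in
a single block. -/
def bondJoin {n : ℕ} (Γ : Finset (Sym2 (Fin n))) (Θ : Setoid (Fin n)) : Setoid (Fin n) :=
  sInf {Ψ | Θ ≤ Ψ ∧ ∀ e ∈ Γ, ∀ i ∈ e, ∀ j ∈ e, Ψ i j}

open Classical in
/-- The sets `Γ` of bonds which make the blocks of `Θ` into the vertices of a tree: `Γ ∨ Θ` has
just one block and `|Γ| + 1 = |Θ|`. -/
def trees {n : ℕ} (Θ : Setoid (Fin n)) : Finset (Finset (Sym2 (Fin n))) :=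
  {Γ | (∀ e ∈ Γ, ¬ e.IsDiag) ∧ bondJoin Γ Θ = ⊤ ∧ Γ.card + 1 = Nat.card (Quotient Θ)}

open Classical in
/-- The zero-one matrix `[Ψ]` representing a set partition `Ψ`. -/
def partitionMatrix {n : ℕ} (Ψ : Setoid (Fin n)) : Fin n → Fin n → ℝ :=
  fun i j => if Ψ i j then 1 else 0

/-- For an enumeration `e_1, …, e_m` of `Γ`, the matrix
`[Θ] + ∑ α, t_α ([{e_1, …, e_α} ∨ Θ] - [{e_1, …, e_{α-1}} ∨ Θ])`. -/
def interpolationMatrix {n : ℕ} (Θ : Setoid (Fin n)) (Γ : Finset (Sym2 (Fin n)))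
    (e : Fin Γ.card ≃ Γ) (t : Fin Γ.card → ℝ) : Fin n → Fin n → ℝ :=
  partitionMatrix Θ + ∑ α, t α •
    (partitionMatrix (bondJoin ((Finset.Iic α).image fun β => (e β : Sym2 (Fin n))) Θ) -
      partitionMatrix (bondJoin ((Finset.Iio α).image fun β => (e β : Sym2 (Fin n))) Θ))

/-- The simplex `1 > t_1 > ⋯ > t_m > 0`. -/
def orderedSimplex (m : ℕ) : Set (Fin m → ℝ) :=
  {t | StrictAnti t ∧ ∀ α, 0 < t α ∧ t α < 1}

/-- The probability measure attached to a partition `Θ` and a tree `Γ`: the sum over all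
enumerations of `Γ` of the image of Lebesgue measure on the simplex `1 > t_1 > ⋯ > t_m > 0` under
`interpolationMatrix`. It is carried by convex combinations of the matrices `[Ψ]`, hence by positive
semidefinite matrices with entries in `[0, 1]` and unit diagonal. -/
def treeMeasure {n : ℕ} (Θ : Setoid (Fin n)) (Γ : Finset (Sym2 (Fin n))) :
    Measure (Fin n → Fin n → ℝ) :=
  ∑ e : Fin Γ.card ≃ Γ,
    (volume.restrict (orderedSimplex Γ.card)).map (interpolationMatrix Θ Γ e)

/-! ### Differential operators on polynomials in the variables `z_{ij}`, `0 ≤ j ≤ 2 N` -/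

/-- The indices of the variables `z_{ij}`. -/
abbrev Var (n N : ℕ) : Type := Fin n × Fin (2 * N + 1)

/-- `∂² / ∂z_a ∂z_b`. -/
def secondDeriv {n N : ℕ} (a b : Var n N) : Module.End ℝ (MvPolynomial (Var n N) ℝ) :=
  (MvPolynomial.pderiv a).toLinearMap * (MvPolynomial.pderiv b).toLinearMap

theorem pderiv_commute {σ : Type*} (a b : σ) :
    Commute ((MvPolynomial.pderiv (R := ℝ) a).toLinearMap : Module.End ℝ (MvPolynomial σ ℝ))
      ((MvPolynomial.pderiv (R := ℝ) b).toLinearMap : Module.End ℝ (MvPolynomial σ ℝ)) := by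
  classical
  have h : ⁅MvPolynomial.pderiv (R := ℝ) a, MvPolynomial.pderiv (R := ℝ) b⁆ = 0 := by
    apply MvPolynomial.derivation_ext
    intro i
    rw [Derivation.commutator_apply]
    simp [MvPolynomial.pderiv_X, Pi.single_apply, apply_ite]
  apply LinearMap.ext
  intro p
  have h2 := congrArg (fun D : Derivation ℝ (MvPolynomial σ ℝ) (MvPolynomial σ ℝ) => D p) h
  simp only [Derivation.commutator_apply, Derivation.zero_apply] at h2
  exact sub_eq_zero.mp h2

theorem secondDeriv_commute {n N : ℕ} (a b c d : Var n N) :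
    Commute (secondDeriv a b) (secondDeriv c d) :=
  ((pderiv_commute a c).mul_right (pderiv_commute a d)).mul_left
    ((pderiv_commute b c).mul_right (pderiv_commute b d))

/-- For a bond `e = {i, i'}`, the operator `D_e = ∑ j, ∂² / ∂z_{ij} ∂z_{i'j}`. -/
def bondOperator {n : ℕ} (N : ℕ) (e : Sym2 (Fin n)) :
    Module.End ℝ (MvPolynomial (Var n N) ℝ) :=
  Sym2.lift ⟨fun i i' => ∑ j : Fin (2 * N + 1), secondDeriv (i, j) (i', j), fun _ _ =>
    Finset.sum_congr rfl fun _ _ => pderiv_commute _ _⟩ e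

theorem bondOperator_commute {n : ℕ} (N : ℕ) (e e' : Sym2 (Fin n)) :
    Commute (bondOperator N e) (bondOperator N e') := by
  induction e using Sym2.ind
  induction e' using Sym2.ind
  simp only [bondOperator, Sym2.lift_mk]
  exact Commute.sum_right _ _ _ fun _ _ => Commute.sum_left _ _ _ fun _ _ =>
    secondDeriv_commute _ _ _ _

/-- The operator `D^Γ = ∏ e ∈ Γ, D_e`. -/
def treeOperator {n : ℕ} (N : ℕ) (Γ : Finset (Sym2 (Fin n))) :
    Module.End ℝ (MvPolynomial (Var n N) ℝ) :=
  Γ.noncommProd (bondOperator N) fun e _ e' _ _ => bondOperator_commute N e e'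

/-! ### Closed Motzkin paths and the terms of the expansion -/

/-- The functions `h : {1, …, n} → {1, …, N}` such that `|h (θ i) - h i| ≤ 1` for all `i`. -/
def motzkin {n : ℕ} (N : ℕ) (θ : Equiv.Perm (Fin n)) : Finset (Fin n → ℕ) :=
  {h ∈ Fintype.piFinset fun _ => Finset.Icc 1 N | ∀ i, |(h (θ i) : ℤ) - h i| ≤ 1}

/-- `J_h(ε) = {i | h (θ i) = h i + ε}`. -/
def stepSet {n : ℕ} (θ : Equiv.Perm (Fin n)) (h : Fin n → ℕ) (ε : ℤ) : Finset (Fin n) :=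
  {i | (h (θ i) : ℤ) = h i + ε}

/-- The polynomial `f^h = ∏_{i ∈ J_h(0)} z_{i0} ∏_{i ∈ J_h(1)} ∑_{j=1}^{2 h(i)} z_{ij}^2 / 2`. -/
def pathPolynomial {n : ℕ} (N : ℕ) (θ : Equiv.Perm (Fin n)) (h : Fin n → ℕ) :
    MvPolynomial (Var n N) ℝ :=
  (∏ i ∈ stepSet θ h 0, MvPolynomial.X (i, 0)) *
    ∏ i ∈ stepSet θ h 1, ∑ j : Fin (2 * N + 1) with 1 ≤ j.val ∧ j.val ≤ 2 * h i,
      MvPolynomial.C (1 / 2 : ℝ) * MvPolynomial.X (i, j) ^ 2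

/-- The law of a family `ξ_{kj}` of independent standard normal random variables. -/
def normalFamily : Measure (ℕ × ℕ → ℝ) := Measure.infinitePi fun _ => gaussianReal 0 1

/-- The Gaussian family `ζ^h_{ij} = ξ_{h(i), j}`. -/
def pathGaussian {n : ℕ} (N : ℕ) (h : Fin n → ℕ) (p : Var n N) (ξ : ℕ × ℕ → ℝ) : ℝ :=
  ξ (h p.1, p.2)

/-- The law of the `Q`-recoupling `ζ ⋆ Q` of a family `ζ`: the centered Gaussian law whose
covariances are `Q(i, i') E[ζ_{ij} ζ_{i'j'}]`. -/
def recoupledLaw {Ω : Type*} [MeasurableSpace Ω] (P : Measure Ω) {n N : ℕ}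
    (ζ : Var n N → Ω → ℝ) (Q : Fin n → Fin n → ℝ) : Measure (EuclideanSpace ℝ (Var n N)) :=
  multivariateGaussian 0 (Matrix.of fun p q => Q p.1 q.1 * ∫ ω, ζ p ω * ζ q ω ∂P)

/-- The partition of `{1, …, n}` into the orbits of `θ`. -/
def orbitPartition {n : ℕ} (θ : Equiv.Perm (Fin n)) : Setoid (Fin n) :=
  Equiv.Perm.SameCycle.setoid θ

open Classical in
/-- The term
`(∏_{{i, i'} ∈ Γ} δ_{h(i), h(i')}) ∫ E[(D^Γ f^h)(ζ^h ⋆ Q)] dP_Γ^Θ(Q)`, where `Θ` is the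
partition into the orbits of `θ`. -/
def expansionTerm {n : ℕ} (N : ℕ) (θ : Equiv.Perm (Fin n)) (Γ : Finset (Sym2 (Fin n)))
    (h : Fin n → ℕ) : ℝ :=
  (∏ e ∈ Γ, if ∀ i ∈ e, ∀ i' ∈ e, h i = h i' then (1 : ℝ) else 0) *
    ∫ Q, (∫ x, MvPolynomial.eval (fun p => x p) (treeOperator N Γ (pathPolynomial N θ h))
        ∂(recoupledLaw normalFamily (pathGaussian N h) Q))
      ∂(treeMeasure (orbitPartition θ) Γ)

end

end GUECumulant

open GUECumulant MeasureTheory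

/-! Two mechanisms carry the proof: GUE traces have the same mixed moments as traces of powers of a
tridiagonal matrix, and cumulants of Gaussian polynomials can be computed by switching on
correlations one bond at a time.

Gaussian expectations of polynomials are treated algebraically. `IsWick R L` is integration by parts
with covariance `R`; it reduces the degree, so it determines `L` (`IsWick.unique`). For symmetric
`R` a solution is `wick R`, the value at `0` of `exp(½ ∑ R a b ∂_a ∂_b) p`, which satisfies a heat
equation in `R` (`hasDerivAt_wick`). Equality of moments thus reduces to equality of covariances;
unitary invariance of the GUE is an instance.

Tridiagonalization goes by induction on the size. With the last row and column frozen, unitary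
invariance of the remaining minor rotates the bordering column to a multiple of the last basis
vector. Its squared length `∑ ξ² / 2` is put above the diagonal and `1` below it
(`integral_traceStats_gueModel`). Expanding traces into closed walks gives Motzkin paths; descents
have weight `1`, so a path contributes exactly `f^h`.

For `Ψ` coarser than `Θ`, the product of moments over the blocks of `Ψ` is one Wick functional
`W([Ψ])` in which copies of the variables are equal within blocks of `Ψ` and independent across
them. So the cumulant is `∑_{Ψ ≥ Θ} μ(Ψ) W([Ψ])` with `μ(Ψ) = (-1)^(|Ψ|-1) (|Ψ|-1)!`. If `Θ` is not
the one-block partition, `∑ μ(Ψ) = 0`, so `W([Ψ])` may be replaced by `W([Ψ]) - W([Θ])`, an integral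
along the segment from `[Θ]` to `[Ψ]`. The derivative there is a sum over bonds lying in a block of
`Ψ` but not of `Θ`. Each such bond `e` merges two blocks of `Θ`, and the remaining sum over `Ψ`
coarser than `{e} ∨ Θ` has the same form. Iteration (`sum_isTreeSeq_integral`) ends at one block,
having produced ordered trees with decreasing times.

The vanishing statement is a degree count for `f^h` row by row, together with the Kronecker factor.
-/

namespace GUECumulant
open MeasureTheory ProbabilityTheory
open scoped Nat

/-! ### Wick functionals on polynomial rings -/

section Wick

open MvPolynomial

variable {σ τ K : Type*}

/-- The polynomials all of whose monomials have `w`-weight less than `d`. -/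
noncomputable def lowWeight [CommRing K] (w : σ → ℕ) (d : ℕ) : Submodule K (MvPolynomial σ K) where
  carrier := {p | ∀ m, coeff m p ≠ 0 → Finsupp.weight w m < d}
  add_mem' := by
    intro p q hp hq m hm
    rw [coeff_add] at hm
    by_cases h : coeff m p = 0
    · exact hq m (by simpa [h] using hm)
    · exact hp m h
  zero_mem' := by simp
  smul_mem' := by
    intro c p hp m hm
    refine hp m fun h => hm ?_
    rw [coeff_smul, h, smul_zero]

theorem mem_lowWeight [CommRing K] {w : σ → ℕ} {d : ℕ} {p : MvPolynomial σ K} :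
    p ∈ lowWeight w d ↔ ∀ m, coeff m p ≠ 0 → Finsupp.weight w m < d := Iff.rfl

theorem lowWeight_mono [CommRing K] {w : σ → ℕ} {d d' : ℕ} (h : d ≤ d') :
    lowWeight (K := K) w d ≤ lowWeight w d' := fun _ hp m hm => (hp m hm).trans_le h

theorem eq_zero_of_mem_lowWeight_zero [CommRing K] {w : σ → ℕ} {p : MvPolynomial σ K}
    (h : p ∈ lowWeight w 0) : p = 0 := by
  ext m
  by_contra hm
  exact absurd (h m (by simpa using hm)) (by simp)

/-- The bound in `lowWeight` is strict and the subtraction truncates, so for `d ≤ w a` this says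
that the derivative is zero. All vanishing arguments below use it in this way. -/
theorem pderiv_mem_lowWeight [CommRing K] {w : σ → ℕ} {d : ℕ} {p : MvPolynomial σ K}
    (hp : p ∈ lowWeight w d) (a : σ) : pderiv a p ∈ lowWeight w (d - w a) := by
  intro m hm
  rw [coeff_pderiv] at hm
  have := hp _ (left_ne_zero_of_mul hm)
  rw [map_add, Finsupp.weight_single, one_smul] at this
  omega

theorem exists_mem_lowWeight [CommRing K] (w : σ → ℕ) (p : MvPolynomial σ K) :
    ∃ d, p ∈ lowWeight w d := by
  refine ⟨p.support.sup (Finsupp.weight w) + 1, fun m hm => ?_⟩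
  exact Nat.lt_succ_of_le (Finset.le_sup (f := Finsupp.weight w) (mem_support_iff.mpr hm))

/-- A linear functional satisfying the Gaussian integration by parts formula with covariance
matrix `R`. -/
structure IsWick [CommRing K] [Fintype σ] (R : σ → σ → K) (L : MvPolynomial σ K →ₗ[K] K) :
    Prop where
  one : L 1 = 1
  X_mul : ∀ a p, L (X a * p) = ∑ b, R a b * L (pderiv b p)

/-- To prove an identity between linear expressions in a polynomial, it suffices to prove it for `1`
and for `X a * p`, given its truth for all polynomials of smaller degree. -/
theorem linear_ext_of_degree [CommRing K] {M : Type*} [AddCommGroup M] [Module K M]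
    {f g : MvPolynomial σ K →ₗ[K] M} (h1 : f 1 = g 1)
    (hX : ∀ a p, (∀ b, f (pderiv b p) = g (pderiv b p)) → f (X a * p) = g (X a * p)) : f = g := by
  classical
  have key : ∀ d : ℕ, ∀ m : σ →₀ ℕ, m.degree = d → f (monomial m 1) = g (monomial m 1) := by
    intro d
    induction d using Nat.strong_induction_on with
    | _ d ih =>
      intro m hm
      rcases eq_or_ne m 0 with rfl | hm0
      · exact h1
      · obtain ⟨a, ha⟩ := Finsupp.ne_iff.mp hm0
        obtain ⟨m', rfl⟩ : ∃ m', m = Finsupp.single a 1 + m' := by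
          refine ⟨m - Finsupp.single a 1, ?_⟩
          rw [add_tsub_cancel_of_le]
          rw [Finsupp.single_le_iff]
          exact Nat.one_le_iff_ne_zero.mpr ha
        have : monomial (Finsupp.single a 1 + m') (1 : K) = X a * monomial m' 1 := by
          rw [X, monomial_mul, one_mul]
        rw [this]
        refine hX a _ fun b => ?_
        rw [pderiv_monomial]
        have hs : ∀ c : K, monomial (m' - Finsupp.single b 1) c
            = c • monomial (m' - Finsupp.single b 1) (1 : K) := by
          intro c; rw [smul_monomial, smul_eq_mul, mul_one]
        rw [hs, map_smul, map_smul, ih (m' - Finsupp.single b 1).degree _ _ rfl]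
        rw [← hm, map_add, Finsupp.degree_single]
        have : (m' - Finsupp.single b 1).degree ≤ m'.degree :=
          Finsupp.degree_mono tsub_le_self
        omega
  refine LinearMap.ext fun p => ?_
  induction p using MvPolynomial.induction_on' with
  | monomial m c =>
    have hs : monomial m c = c • monomial m (1 : K) := by rw [smul_monomial, smul_eq_mul, mul_one]
    rw [hs, map_smul, map_smul, key _ m rfl]
  | add p q hp hq => rw [map_add, map_add, hp, hq]

/-- The substitution `X a ↦ ∑ s, A a s • X s`. -/
noncomputable def linearSubst [CommRing K] [Fintype τ] (A : σ → τ → K) :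
    MvPolynomial σ K →ₐ[K] MvPolynomial τ K :=
  aeval fun a => ∑ s, A a s • X s

theorem linearSubst_X [CommRing K] [Fintype τ] (A : σ → τ → K) (a : σ) :
    linearSubst A (X a) = ∑ s, A a s • X s := by
  rw [linearSubst, aeval_X]

/-- The chain rule: both sides obey the same Leibniz rule, so checking generators suffices. -/
theorem pderiv_linearSubst [CommRing K] [Fintype σ] [Fintype τ] (A : σ → τ → K) (t : τ)
    (p : MvPolynomial σ K) :
    pderiv t (linearSubst A p) = ∑ a, A a t • linearSubst A (pderiv a p) := by
  classical
  induction p using MvPolynomial.induction_on with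
  | C c => simp [← algebraMap_eq]
  | add p q hp hq => simp only [map_add, hp, hq, smul_add, Finset.sum_add_distrib]
  | mul_X p b hp =>
    simp only [map_mul, linearSubst_X, pderiv_mul, hp, map_add, smul_add, Finset.sum_add_distrib]
    congr 1
    · rw [Finset.sum_mul]
      exact Finset.sum_congr rfl fun _ _ => by rw [smul_mul_assoc]
    · rw [Finset.sum_eq_single b]
      · simp only [map_sum, Derivation.map_smul, pderiv_X_self, map_one, mul_one]
        rw [Finset.sum_eq_single t]
        · rw [pderiv_X_self, mul_smul_comm, mul_one]
        · intro s _ hs; rw [pderiv_X_of_ne hs, smul_zero]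
        · simp
      · intro c _ hc; rw [pderiv_X_of_ne hc.symm]; simp
      · simp

theorem eval_linearSubst [CommRing K] [Fintype τ] (A : σ → τ → K) (x : τ → K)
    (p : MvPolynomial σ K) :
    eval x (linearSubst A p) = eval (fun a => ∑ s, A a s * x s) p := by
  induction p using MvPolynomial.induction_on with
  | C c => simp [← algebraMap_eq]
  | add p q hp hq => simp only [map_add, hp, hq]
  | mul_X p b hp => simp only [map_mul, hp, linearSubst_X, map_sum, smul_eval, eval_X]

/-- The substitution which sets the variables outside `s` to zero. -/
noncomputable def killOutside [CommRing K] (s : Set σ) [DecidablePred (· ∈ s)] :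
    MvPolynomial σ K →ₐ[K] MvPolynomial σ K :=
  aeval fun a => if a ∈ s then X a else 0

theorem killOutside_X [CommRing K] (s : Set σ) [DecidablePred (· ∈ s)] (a : σ) :
    killOutside s (X a : MvPolynomial σ K) = if a ∈ s then X a else 0 := by
  rw [killOutside, aeval_X]

theorem killOutside_eq_self [CommRing K] {s : Set σ} [DecidablePred (· ∈ s)] {p : MvPolynomial σ K}
    (hp : ∀ a ∈ p.vars, a ∈ s) : killOutside s p = p := by
  have := hom_congr_vars (f₁ := (killOutside (K := K) s : _ →+* _))
    (f₂ := RingHom.id (MvPolynomial σ K)) (p₁ := p) (p₂ := p) ?_ ?_ rfl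
  · simpa using this
  · ext c : 1
    simp [← algebraMap_eq]
  · intro a ha _
    simp [killOutside_X, hp a ha]

theorem pderiv_killOutside [CommRing K] (s : Set σ) [DecidablePred (· ∈ s)] (b : σ)
    (p : MvPolynomial σ K) :
    pderiv b (killOutside s p) = if b ∈ s then killOutside s (pderiv b p) else 0 := by
  classical
  induction p using MvPolynomial.induction_on with
  | C c => simp [← algebraMap_eq]
  | add p q hp hq => simp only [map_add, hp, hq]; split_ifs <;> simp
  | mul_X p a hp =>
    simp only [map_mul, killOutside_X, pderiv_mul, hp, map_add]
    rcases eq_or_ne a b with rfl | hab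
    · by_cases ha : a ∈ s <;> simp [ha]
    · by_cases ha : a ∈ s <;> by_cases hb : b ∈ s <;> simp [ha, hb, pderiv_X_of_ne hab]

/-! ### Uniqueness, linear substitution and factorization of Wick functionals. -/

namespace IsWick

variable [CommRing K] [Fintype σ] {R R' : σ → σ → K} {L L' : MvPolynomial σ K →ₗ[K] K}

/-- Integration by parts expresses a value in degree `d + 1` through values in lower degree, down to
`L 1 = 1`. -/
theorem unique (h : IsWick R L) (h' : IsWick R L') : L = L' :=
  linear_ext_of_degree (h.one.trans h'.one.symm) fun a p hp => by
    rw [h.X_mul, h'.X_mul]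
    exact Finset.sum_congr rfl fun b _ => by rw [hp b]

/-- Wick functionals are preserved by linear substitutions. -/
theorem comp_linearSubst [Fintype τ] {D : τ → τ → K} {M : MvPolynomial τ K →ₗ[K] K}
    (h : IsWick D M) (A : σ → τ → K) :
    IsWick (fun a b => ∑ s, ∑ t, A a s * D s t * A b t)
      (M ∘ₗ (linearSubst A).toLinearMap) where
  one := by simp [h.one]
  X_mul a p := by
    simp only [LinearMap.comp_apply, AlgHom.toLinearMap_apply, map_mul, linearSubst_X,
      Finset.sum_mul, map_sum, map_smul, smul_mul_assoc, h.X_mul, smul_eq_mul,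
      pderiv_linearSubst, Finset.mul_sum]
    rw [eq_comm, Finset.sum_comm]
    refine Finset.sum_congr rfl fun _ _ => ?_
    rw [Finset.sum_comm]
    exact Finset.sum_congr rfl fun _ _ => Finset.sum_congr rfl fun _ _ => by ring

/-- A factor whose variables are uncorrelated with the other variables splits off. -/
theorem mul_of_uncorrelated (h : IsWick R L) (h' : IsWick R' L') (s : Set σ)
    {p q : MvPolynomial σ K} (hp : ∀ a ∈ p.vars, a ∈ s)
    (hs : ∀ a ∈ s, ∀ b ∈ s, R a b = R' a b) (hq : ∀ a ∈ s, ∀ b ∈ q.vars, R a b = 0) :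
    L (p * q) = L' p * L q := by
  classical
  -- Precomposing with `killOutside s` turns a claim about polynomials in the variables of `s` into
  -- an identity of linear maps on the whole ring, so the induction on degree applies.
  have key : (L ∘ₗ LinearMap.mulRight K q) ∘ₗ (killOutside s).toLinearMap =
      (LinearMap.mulRight K (L q) ∘ₗ L') ∘ₗ (killOutside s).toLinearMap := by
    refine linear_ext_of_degree (by simp [h'.one]) fun a p ih => ?_
    simp only [LinearMap.comp_apply, AlgHom.toLinearMap_apply, LinearMap.mulRight_apply] at ih ⊢
    rw [map_mul (killOutside s), killOutside_X]
    split_ifs with ha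
    · rw [mul_assoc, h.X_mul, h'.X_mul, Finset.sum_mul]
      refine Finset.sum_congr rfl fun b _ => ?_
      -- The derivative falling on `q` is always killed: either `b` is uncorrelated with `a`, or `b`
      -- does not occur in `q`.
      have hb : R a b * L (killOutside s p * pderiv b q) = 0 := by
        by_cases hbq : b ∈ q.vars
        · rw [hq a ha b hbq, zero_mul]
        · rw [pderiv_eq_zero_of_notMem_vars hbq]; simp
      rw [pderiv_mul, map_add, mul_add, hb, add_zero, pderiv_killOutside]
      split_ifs with hbs
      · rw [ih, hs a ha b hbs, mul_assoc]
      · simp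
    · simp
  have := LinearMap.congr_fun key p
  simpa [killOutside_eq_self hp] using this

/-- If the variables are grouped into uncorrelated blocks, then the functional is multiplicative
over the blocks. -/
theorem prod_of_blocks {β : Type*} [DecidableEq β] (h : IsWick R L) (h' : IsWick R' L')
    (blk : σ → β) (hR : ∀ a b, R a b = if blk a = blk b then R' a b else 0) (S : Finset β)
    (p : β → MvPolynomial σ K) (hp : ∀ A ∈ S, ∀ a ∈ (p A).vars, blk a = A) :
    L (∏ A ∈ S, p A) = ∏ A ∈ S, L' (p A) := by
  classical
  induction S using Finset.induction_on with
  | empty => simp [h.one]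
  | insert A S hA ih =>
    rw [Finset.prod_insert hA, Finset.prod_insert hA,
      h.mul_of_uncorrelated h' {a | blk a = A} (hp A (Finset.mem_insert_self _ _)),
      ih fun B hB => hp B (Finset.mem_insert_of_mem hB)]
    · rintro a rfl b hb
      rw [hR, if_pos hb.symm]
    · rintro a rfl b hb
      obtain ⟨B, hB, hb⟩ := Finset.mem_biUnion.mp (vars_prod p hb)
      rw [hR, if_neg]
      rintro hab
      exact hA (by rw [hab, hp B (Finset.mem_insert_of_mem hB) b hb]; exact hB)

end IsWick

/-! ### The Wick functional of a symmetric matrix -/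

theorem pderiv_comm [CommRing K] (a b : σ) (p : MvPolynomial σ K) :
    pderiv a (pderiv b p) = pderiv b (pderiv a p) := by
  classical
  have h : ⁅pderiv (R := K) a, pderiv (R := K) b⁆ = 0 := by
    apply MvPolynomial.derivation_ext
    intro i
    rw [Derivation.commutator_apply]
    simp [pderiv_X, Pi.single_apply, apply_ite]
  have h2 := congrArg (fun D : Derivation K (MvPolynomial σ K) (MvPolynomial σ K) => D p) h
  simp only [Derivation.commutator_apply, Derivation.zero_apply] at h2
  exact sub_eq_zero.mp h2

section Laplacian

variable [Fintype σ] [Field K]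

/-- The second order differential operator `½ ∑ a b, R a b ∂_a ∂_b`. -/
noncomputable def laplacian (R : σ → σ → K) : Module.End K (MvPolynomial σ K) :=
  ∑ a, ∑ b, (R a b / 2) • ((pderiv a).toLinearMap * (pderiv b).toLinearMap)

theorem laplacian_apply (R : σ → σ → K) (p : MvPolynomial σ K) :
    laplacian R p = ∑ a, ∑ b, (R a b / 2) • pderiv a (pderiv b p) := by
  simp [laplacian]

theorem pderiv_laplacian (R : σ → σ → K) (c : σ) (p : MvPolynomial σ K) :
    pderiv c (laplacian R p) = laplacian R (pderiv c p) := by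
  simp only [laplacian_apply, map_sum, Derivation.map_smul]
  refine Finset.sum_congr rfl fun a _ => Finset.sum_congr rfl fun b _ => ?_
  rw [pderiv_comm c a, pderiv_comm c b]

theorem laplacian_commute (R R' : σ → σ → K) : Commute (laplacian R) (laplacian R') := by
  refine LinearMap.ext fun p => ?_
  simp only [Module.End.mul_apply]
  rw [laplacian_apply R', laplacian_apply R' (laplacian R p)]
  simp only [map_sum, map_smul, pderiv_laplacian]

theorem laplacian_add_smul (R R' : σ → σ → K) (t : K) :
    laplacian (R + t • R') = laplacian R + t • laplacian R' := by
  refine LinearMap.ext fun p => ?_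
  simp only [LinearMap.add_apply, LinearMap.smul_apply, laplacian_apply, Finset.smul_sum,
    ← Finset.sum_add_distrib, smul_smul, ← add_smul, Pi.add_apply, Pi.smul_apply, smul_eq_mul]
  refine Finset.sum_congr rfl fun a _ => Finset.sum_congr rfl fun b _ => ?_
  congr 1
  ring

/-- The commutator of the Laplacian with multiplication by `X c` is first order: the Leibniz rule
lets either derivative hit `X c`, and symmetry of `R` merges the two halves. -/
theorem laplacian_X_mul [CharZero K] {R : σ → σ → K} (hR : ∀ a b, R a b = R b a) (c : σ)
    (p : MvPolynomial σ K) :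
    laplacian R (X c * p) = X c * laplacian R p + ∑ b, R c b • pderiv b p := by
  classical
  have h : ∀ a b, pderiv a (pderiv b (X c * p)) = X c * pderiv a (pderiv b p) +
      ((if a = c then pderiv b p else 0) + if b = c then pderiv a p else 0) := by
    intro a b
    simp only [pderiv_mul, map_add, pderiv_X, Pi.single_apply, eq_comm (a := c)]
    split_ifs <;> simp <;> ring
  simp only [laplacian_apply, h, smul_add, Finset.sum_add_distrib, Finset.mul_sum, mul_smul_comm,
    smul_ite, smul_zero]
  congr 1
  rw [Finset.sum_comm (f := fun a b => if b = c then (R a b / 2) • pderiv a p else 0),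
    Finset.sum_comm (f := fun a b => if a = c then (R a b / 2) • pderiv b p else 0)]
  rw [Finset.sum_comm (f := fun y x => if y = c then (R x y / 2) • pderiv x p else 0)]
  simp only [Finset.sum_ite_eq', Finset.mem_univ, if_true]
  rw [← Finset.sum_add_distrib]
  refine Finset.sum_congr rfl fun b _ => ?_
  rw [hR b c, ← add_smul, add_halves]

/-- The commutator `∑ R c b ∂_b` itself commutes with the Laplacian, so commuting `X c` past `k + 1`
factors gives `k + 1` equal terms. -/
theorem laplacian_pow_X_mul [CharZero K] {R : σ → σ → K} (hR : ∀ a b, R a b = R b a) (c : σ)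
    (p : MvPolynomial σ K) (k : ℕ) :
    (laplacian R ^ (k + 1)) (X c * p) = X c * (laplacian R ^ (k + 1)) p +
      (k + 1 : K) • ∑ b, R c b • (laplacian R ^ k) (pderiv b p) := by
  induction k with
  | zero => simp [laplacian_X_mul hR]
  | succ k ih =>
    rw [pow_succ', Module.End.mul_apply, ih, map_add, laplacian_X_mul hR, map_smul, map_sum,
      ← Module.End.mul_apply, ← pow_succ', add_assoc]
    congr 1
    have h1 : ∀ b, pderiv b ((laplacian R ^ (k + 1)) p) = (laplacian R ^ (k + 1)) (pderiv b p) := by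
      intro b
      have : Commute ((pderiv b).toLinearMap : Module.End K (MvPolynomial σ K)) (laplacian R) :=
        LinearMap.ext fun q => pderiv_laplacian R b q
      exact LinearMap.congr_fun (this.pow_right (k + 1)) p
    simp only [h1, map_smul, ← Module.End.mul_apply, ← pow_succ']
    push_cast
    module

/-- The degree drops by two; a drop by one is enough for nilpotency. -/
theorem laplacian_mem_lowWeight (R : σ → σ → K) {d : ℕ} {p : MvPolynomial σ K}
    (hp : p ∈ lowWeight (fun _ => 1) (d + 1)) : laplacian R p ∈ lowWeight (fun _ => 1) d := by
  rw [laplacian_apply]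
  refine Submodule.sum_mem _ fun a _ => Submodule.sum_mem _ fun b _ => Submodule.smul_mem _ _ ?_
  refine lowWeight_mono ?_ (pderiv_mem_lowWeight (pderiv_mem_lowWeight hp b) a)
  simp

/-- The bound comes from the degree of `p` alone. Its uniformity in `R` makes `wick R p` one fixed
finite sum, which can be differentiated in `R`. -/
theorem exists_laplacian_pow_eq_zero (p : MvPolynomial σ K) :
    ∃ d, ∀ R : σ → σ → K, ∀ k ≥ d, (laplacian R ^ k) p = 0 := by
  obtain ⟨d, hd⟩ := exists_mem_lowWeight (fun _ => 1) p
  refine ⟨d, fun R k hk => ?_⟩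
  have : ∀ j ≤ d, (laplacian R ^ j) p ∈ lowWeight (fun _ => 1) (d - j) := by
    intro j
    induction j with
    | zero => exact fun _ => hd
    | succ j ih =>
      intro hj
      rw [pow_succ', Module.End.mul_apply]
      refine laplacian_mem_lowWeight R ?_
      have hj' : d - (j + 1) + 1 = d - j := by omega
      rw [hj']
      exact ih (by omega)
  obtain ⟨l, rfl⟩ := Nat.exists_eq_add_of_le' hk
  have h0 := this d le_rfl
  rw [Nat.sub_self] at h0
  rw [pow_add, Module.End.mul_apply, eq_zero_of_mem_lowWeight_zero h0, map_zero]

/-- The Wick functional `p ↦ ∑ k, (½ ∑ a b, R a b ∂_a ∂_b)^k p (0) / k!`. -/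
noncomputable def wick (R : σ → σ → K) : MvPolynomial σ K →ₗ[K] K where
  toFun p := ∑ᶠ k : ℕ, (k ! : K)⁻¹ * coeff 0 ((laplacian R ^ k) p)
  map_add' p q := by
    have hfin : ∀ p : MvPolynomial σ K,
        (Function.support fun k : ℕ => (k ! : K)⁻¹ * coeff 0 ((laplacian R ^ k) p)).Finite := by
      intro p
      obtain ⟨d, hd⟩ := exists_laplacian_pow_eq_zero p
      refine (Set.finite_lt_nat d).subset fun k hk => ?_
      by_contra hk'
      exact hk (by simp [hd R k (not_lt.mp hk')])
    rw [← finsum_add_distrib (hfin p) (hfin q)]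
    exact finsum_congr fun k => by rw [map_add, coeff_add, mul_add]
  map_smul' c p := by
    rw [RingHom.id_apply, smul_eq_mul, mul_finsum]
    exact finsum_congr fun k => by rw [map_smul, coeff_smul, smul_eq_mul]; ring

theorem wick_eq_sum (R : σ → σ → K) {p : MvPolynomial σ K} {d : ℕ}
    (hd : ∀ k ≥ d, (laplacian R ^ k) p = 0) :
    wick R p = ∑ k ∈ Finset.range d, (k ! : K)⁻¹ * coeff 0 ((laplacian R ^ k) p) := by
  refine finsum_eq_sum_of_support_subset _ fun k hk => ?_
  simp only [Finset.coe_range, Set.mem_Iio]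
  by_contra hk'
  exact hk (by simp [hd k (not_lt.mp hk')])

/-- In `exp(Δ)(X c * p)` the term where `X c` stays in front vanishes at the origin; the commutator
terms, divided by `(k + 1)!`, reassemble `∑ R c b exp(Δ) ∂_b p`. -/
theorem isWick_wick [CharZero K] {R : σ → σ → K} (hR : ∀ a b, R a b = R b a) :
    IsWick R (wick R) where
  one := by
    rw [wick_eq_sum R (d := 1)]
    · simp
    · intro k hk
      obtain ⟨l, rfl⟩ := Nat.exists_eq_add_of_le' hk
      rw [pow_add, Module.End.mul_apply, pow_one, laplacian_apply]
      simp
  X_mul c p := by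
    have hX : ∀ q : MvPolynomial σ K, coeff 0 (X c * q) = 0 := fun q => by
      rw [← constantCoeff_eq]; simp
    obtain ⟨d, hd⟩ := exists_laplacian_pow_eq_zero (X c * p)
    choose e he using fun b => exists_laplacian_pow_eq_zero (pderiv b p)
    -- A common truncation order, so that the finite sums can be compared termwise.
    set D := d + ∑ b, e b
    have heD : ∀ b, e b ≤ D := fun b =>
      (Finset.single_le_sum (f := e) (fun _ _ => Nat.zero_le _) (Finset.mem_univ b)).trans
        (Nat.le_add_left _ _)
    rw [wick_eq_sum R (d := D + 1) fun k hk => hd R k (by omega)]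
    -- The term `k = 0` is the constant coefficient of `X c * p`, which is zero; the others are
    -- shifted by one to meet the commutator formula.
    rw [Finset.sum_range_succ']
    simp only [pow_zero, Module.End.one_apply, hX, mul_zero, add_zero]
    have : ∀ b, wick R (pderiv b p) =
        ∑ k ∈ Finset.range D, (k ! : K)⁻¹ * coeff 0 ((laplacian R ^ k) (pderiv b p)) := fun b =>
      wick_eq_sum R fun k hk => he b R k ((heD b).trans hk)
    simp only [this, Finset.mul_sum]
    rw [Finset.sum_comm]
    refine Finset.sum_congr rfl fun k _ => ?_
    rw [laplacian_pow_X_mul hR, coeff_add, hX, zero_add, coeff_smul, coeff_sum,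
      smul_eq_mul, Finset.mul_sum, Finset.mul_sum]
    refine Finset.sum_congr rfl fun b _ => ?_
    rw [coeff_smul, smul_eq_mul, Nat.factorial_succ]
    have : (k + 1 : K) ≠ 0 := Nat.cast_add_one_ne_zero k
    push_cast
    field_simp

end Laplacian

/-! ### Continuity and differentiation of the Wick functional in the covariance. -/

section Calculus

variable [Fintype σ]

theorem continuous_laplacian_pow (ℓ : MvPolynomial σ ℝ →ₗ[ℝ] ℝ) (k : ℕ) (p : MvPolynomial σ ℝ) :
    Continuous fun R : σ → σ → ℝ => ℓ ((laplacian R ^ k) p) := by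
  induction k generalizing p with
  | zero => simpa using continuous_const
  | succ k ih =>
    simp only [pow_succ, Module.End.mul_apply, laplacian_apply, map_sum, map_smul, smul_eq_mul]
    refine continuous_finsetSum _ fun a _ => continuous_finsetSum _ fun b _ => ?_
    exact (by fun_prop : Continuous fun R : σ → σ → ℝ => R a b / 2).mul (ih _)

theorem continuous_wick (p : MvPolynomial σ ℝ) : Continuous fun R : σ → σ → ℝ => wick R p := by
  obtain ⟨d, hd⟩ := exists_laplacian_pow_eq_zero p
  simp only [fun R => wick_eq_sum R (hd R)]
  exact continuous_finsetSum _ fun k _ => continuous_const.mul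
    (continuous_laplacian_pow (lcoeff ℝ 0) k p)

/-- The ordinary power rule holds because Laplacians of different matrices commute. A general
functional `ℓ` keeps everything real-valued. -/
theorem hasDerivAt_laplacian_pow (ℓ : MvPolynomial σ ℝ →ₗ[ℝ] ℝ) (k : ℕ) (p : MvPolynomial σ ℝ)
    (A B : σ → σ → ℝ) (t : ℝ) :
    HasDerivAt (fun t : ℝ => ℓ ((laplacian (A + t • B) ^ (k + 1)) p))
      ((k + 1) * ℓ ((laplacian (A + t • B) ^ k) (laplacian B p))) t := by
  induction k generalizing p with
  | zero =>
    simp only [zero_add, pow_one, laplacian_add_smul, LinearMap.add_apply, LinearMap.smul_apply,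
      map_add, map_smul, smul_eq_mul, pow_zero, Module.End.one_apply, Nat.cast_zero, one_mul]
    simpa using ((hasDerivAt_id t).mul_const (ℓ (laplacian B p))).const_add (ℓ (laplacian A p))
  | succ k ih =>
    have h1 : (fun t : ℝ => ℓ ((laplacian (A + t • B) ^ (k + 1 + 1)) p)) = fun t : ℝ =>
        ℓ ((laplacian (A + t • B) ^ (k + 1)) (laplacian A p)) +
          t * ℓ ((laplacian (A + t • B) ^ (k + 1)) (laplacian B p)) := by
      funext t
      rw [pow_succ, Module.End.mul_apply, laplacian_add_smul A B t]
      simp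
    rw [h1]
    refine ((ih (laplacian A p)).add ((hasDerivAt_id t).mul (ih (laplacian B p)))).congr_deriv ?_
    have hc : laplacian B (laplacian A p) = laplacian A (laplacian B p) :=
      LinearMap.congr_fun (laplacian_commute B A) p
    rw [hc]
    have h2 : ℓ ((laplacian (A + t • B) ^ (k + 1)) (laplacian B p)) =
        ℓ ((laplacian (A + t • B) ^ k) (laplacian A (laplacian B p))) +
          t * ℓ ((laplacian (A + t • B) ^ k) (laplacian B (laplacian B p))) := by
      rw [pow_succ, Module.End.mul_apply, laplacian_add_smul A B t]
      simp
    simp only [id_eq, Nat.cast_add, Nat.cast_one]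
    linear_combination (-(k + 1 : ℝ)) * h2

/-- The heat equation: termwise, the factor `k + 1` from the power rule turns `1 / (k + 1)!` into `1
/ k!`. -/
theorem hasDerivAt_wick (p : MvPolynomial σ ℝ) (A B : σ → σ → ℝ) (t : ℝ) :
    HasDerivAt (fun t : ℝ => wick (A + t • B) p) (wick (A + t • B) (laplacian B p)) t := by
  obtain ⟨d, hd⟩ := exists_laplacian_pow_eq_zero p
  obtain ⟨e, he⟩ := exists_laplacian_pow_eq_zero (laplacian B p)
  simp only [fun R => wick_eq_sum R (d := d + e + 1) fun k hk => hd R k (by omega),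
    fun R => wick_eq_sum R (d := d + e) fun k hk => he R k (by omega)]
  simp only [Finset.sum_range_succ' _ (d + e)]
  simp only [pow_zero, Module.End.one_apply]
  refine (HasDerivAt.add_const _ (HasDerivAt.fun_sum fun k _ =>
    (hasDerivAt_laplacian_pow (lcoeff ℝ 0) k p A B t).const_mul _)).congr_deriv ?_
  refine Finset.sum_congr rfl fun k _ => ?_
  rw [Nat.factorial_succ]
  have : (k + 1 : ℝ) ≠ 0 := Nat.cast_add_one_ne_zero k
  push_cast
  simp only [lcoeff_apply]
  field_simp

end Calculus

end Wick

/-! ### Gaussian expectations of polynomials -/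

section Gaussian

open MvPolynomial

variable {σ τ Ω 𝕜 : Type*} [RCLike 𝕜] {mΩ : MeasurableSpace Ω} {P : Measure Ω}

/-- Polynomials in random variables with moments of all orders have moments of all orders. -/
theorem memLp_eval [IsFiniteMeasure P] {x : σ → Ω → 𝕜} (hx : ∀ a (k : ℕ), MemLp (x a) k P)
    (p : MvPolynomial σ 𝕜) (k : ℕ) : MemLp (fun ω => eval (fun a => x a ω) p) k P := by
  induction p using MvPolynomial.induction_on generalizing k with
  | C c => simpa using memLp_const c
  | add p q hp hq => simp only [map_add]; exact (hp k).add (hq k)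
  | mul_X p a hp =>
    simp only [map_mul, eval_X]
    -- Hölder with both exponents doubled; for `k = 0` the identity of inverses reads `⊤ + ⊤ = ⊤`.
    have hk : ENNReal.HolderTriple (2 * k : ℕ) (2 * k : ℕ) k := by
      constructor
      push_cast
      rw [ENNReal.mul_inv (by simp) (by simp), ← add_mul, ENNReal.inv_two_add_inv_two, one_mul]
    exact (hx a (2 * k)).mul' (hp (2 * k)) (hpqr := hk)

theorem integrable_eval [IsFiniteMeasure P] {x : σ → Ω → 𝕜}
    (hx : ∀ a (k : ℕ), MemLp (x a) k P) (p : MvPolynomial σ 𝕜) :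
    Integrable (fun ω => eval (fun a => x a ω) p) P := by
  simpa using memLp_one_iff_integrable.mp (by simpa using memLp_eval hx p 1)

/-- The expectation of a polynomial in random variables with moments of all orders. -/
noncomputable def expectation [IsFiniteMeasure P] {x : σ → Ω → 𝕜}
    (hx : ∀ a (k : ℕ), MemLp (x a) k P) : MvPolynomial σ 𝕜 →ₗ[𝕜] 𝕜 where
  toFun p := ∫ ω, eval (fun a => x a ω) p ∂P
  map_add' p q := by
    simp only [map_add]
    exact integral_add (integrable_eval hx p) (integrable_eval hx q)
  map_smul' c p := by
    simp only [smul_eval, RingHom.id_apply, smul_eq_mul]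
    exact integral_const_mul c _

theorem expectation_apply [IsFiniteMeasure P] {x : σ → Ω → 𝕜}
    (hx : ∀ a (k : ℕ), MemLp (x a) k P) (p : MvPolynomial σ 𝕜) :
    expectation hx p = ∫ ω, eval (fun a => x a ω) p ∂P := rfl

/-- Gaussian integration by parts for powers. -/
theorem integral_pow_succ_gaussianReal (v : NNReal) (k : ℕ) :
    ∫ x, x ^ (k + 1) ∂gaussianReal 0 v = v * (k * ∫ x, x ^ (k - 1) ∂gaussianReal 0 v) := by
  -- Moments are derivatives at `0` of the moment generating function `g(t) = exp(v t² / 2)`. Since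
  -- `g' = v t g`, the Leibniz rule at `0` keeps only the term where `v t` is differentiated once.
  -- For `k = 0` the truncated exponent is harmless because of the factor `k`.
  have hmom : ∀ j : ℕ, ∫ x, x ^ j ∂gaussianReal 0 v =
      iteratedDeriv j (fun t : ℝ => Real.exp (v * t ^ 2 / 2)) 0 := by
    intro j
    have := iteratedDeriv_mgf_zero (X := id) (μ := gaussianReal 0 v) (by simp) j
    rw [mgf_id_gaussianReal] at this
    simpa using this.symm
  rw [hmom, hmom, iteratedDeriv_succ']
  have hd : deriv (fun t : ℝ => Real.exp (v * t ^ 2 / 2)) =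
      fun t : ℝ => (v * t) * Real.exp (v * t ^ 2 / 2) := by
    funext t
    have h1 : HasDerivAt (fun t : ℝ => v * t ^ 2 / 2) (v * t) t := by
      have := ((hasDerivAt_pow 2 t).const_mul (v : ℝ)).div_const 2
      refine this.congr_deriv ?_
      push_cast
      ring
    rw [h1.exp.deriv, mul_comm]
  rw [hd]
  have := iteratedDeriv_mul (n := k) (x := (0 : ℝ)) (𝕜 := ℝ) (f := fun t : ℝ => (v : ℝ) * t)
    (g := fun t : ℝ => Real.exp (v * t ^ 2 / 2)) (by fun_prop) (by fun_prop)
  have h0 : ((fun t : ℝ => (v * t) * Real.exp (v * t ^ 2 / 2)) : ℝ → ℝ) =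
    (fun t : ℝ => (v : ℝ) * t) * (fun t : ℝ => Real.exp (v * t ^ 2 / 2)) := rfl
  rw [h0, this]
  have hi : ∀ i, iteratedDeriv i (fun t : ℝ => (v : ℝ) * t) 0 = if i = 1 then (v : ℝ) else 0 := by
    intro i
    have hone : deriv (fun t : ℝ => (v : ℝ) * t) = fun _ => (v : ℝ) := by
      funext t
      simp
    rcases i with _ | _ | i
    · simp
    · simp [iteratedDeriv_one, hone]
    · rw [iteratedDeriv_succ', hone, iteratedDeriv_const]
      simp
  simp only [hi]
  rcases k with _ | k
  · simp
  · rw [Finset.sum_eq_single 1]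
    · simp
      ring
    · intro b _ hb
      simp [hb]
    · simp

/-- Expectations of polynomials in independent centered Gaussian variables satisfy the integration
by parts formula. -/
theorem isWick_expectation_of_iIndepFun [IsProbabilityMeasure P] [Fintype σ] [DecidableEq σ]
    {x : σ → Ω → ℝ} (hx : iIndepFun x P) {v : σ → NNReal}
    (hlaw : ∀ a, HasLaw (x a) (gaussianReal 0 (v a)) P)
    (hx' : ∀ a (k : ℕ), MemLp (fun ω => (x a ω : 𝕜)) k P) :
    IsWick (fun a b => if a = b then ((v a : ℝ) : 𝕜) else 0) (expectation hx') := by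
  -- Independence factors the moment of a monomial, so integration by parts reduces to one variable.
  have hmon : ∀ m : σ →₀ ℕ, expectation hx' (monomial m 1) =
      ((∏ a, ∫ y, y ^ m a ∂gaussianReal 0 (v a) : ℝ) : 𝕜) := by
    intro m
    rw [expectation_apply]
    have h1 : ∀ ω, eval (fun a => (x a ω : 𝕜)) (monomial m 1) = ((∏ a, x a ω ^ m a : ℝ) : 𝕜) := by
      intro ω
      rw [eval_monomial, one_mul, Finsupp.prod_fintype _ _ (by simp)]
      push_cast
      rfl
    simp only [h1]
    rw [integral_ofReal]
    congr 1
    rw [hx.integral_fun_prod_comp (f := fun a y => y ^ m a) (fun a => (hlaw a).aemeasurable)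
      (fun a => by fun_prop)]
    refine Finset.prod_congr rfl fun a _ => ?_
    rw [← (hlaw a).map_eq, integral_map (hlaw a).aemeasurable (by fun_prop)]
  constructor
  · have := hmon 0
    simpa using this
  · intro a p
    induction p using MvPolynomial.induction_on' with
    | monomial m c =>
      have hs : ∀ (m : σ →₀ ℕ) (c : 𝕜), monomial m c = c • monomial m (1 : 𝕜) := by
        intro m c; rw [smul_monomial, smul_eq_mul, mul_one]
      rw [Finset.sum_eq_single a, if_pos rfl, pderiv_monomial, hs m, hs _ (c * _), mul_smul_comm,
        map_smul, map_smul, X, monomial_mul, one_mul, hmon, hmon]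
      · simp only [smul_eq_mul]
        rw [← Finset.mul_prod_erase _ _ (Finset.mem_univ a),
          ← Finset.mul_prod_erase _ (fun b => ∫ y, y ^ ((m - Finsupp.single a 1 : σ →₀ ℕ) b)
            ∂gaussianReal 0 (v b)) (Finset.mem_univ a)]
        have h2 : ∀ b ∈ Finset.univ.erase a,
            ∫ y, y ^ (Finsupp.single a 1 + m : σ →₀ ℕ) b ∂gaussianReal 0 (v b) =
              ∫ y, y ^ (m - Finsupp.single a 1 : σ →₀ ℕ) b ∂gaussianReal 0 (v b) := by
          intro b hb
          have hba : a ≠ b := (Finset.ne_of_mem_erase hb).symm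
          simp [Finsupp.single_eq_of_ne' hba]
        rw [Finset.prod_congr rfl h2]
        have h3 : (Finsupp.single a 1 + m : σ →₀ ℕ) a = m a + 1 := by simp [add_comm]
        have h4 : (m - Finsupp.single a 1 : σ →₀ ℕ) a = m a - 1 := by simp
        rw [h3, h4, integral_pow_succ_gaussianReal]
        push_cast
        ring
      · intro b _ hb
        rw [if_neg hb.symm, zero_mul]
      · simp
    | add p q hp hq =>
      simp only [mul_add, map_add, hp, hq, Finset.sum_add_distrib]

theorem memLp_ofReal_of_hasLaw_gaussianReal [IsProbabilityMeasure P] {x : Ω → ℝ} {v : NNReal}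
    (h : HasLaw x (gaussianReal 0 v) P) (k : ℕ) : MemLp (fun ω => (x ω : 𝕜)) k P := by
  have h1 : MemLp x k P := by
    have := memLp_id_gaussianReal' (μ := 0) (v := v) k (by simp)
    rw [← h.map_eq] at this
    simpa using (memLp_map_measure_iff (by fun_prop) h.aemeasurable).mp this
  exact h1.ofReal

theorem memLp_linear [Fintype σ] {x : σ → Ω → 𝕜}
    (hx : ∀ a (k : ℕ), MemLp (x a) k P) (A : τ → σ → 𝕜) (b : τ) (k : ℕ) :
    MemLp (fun ω => ∑ a, A b a * x a ω) k P :=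
  memLp_finsetSum _ fun a _ => (hx a k).const_mul _

/-- Expectations of polynomials in linear combinations. -/
theorem isWick_expectation_linear [IsFiniteMeasure P] [Fintype σ] [Fintype τ] {x : σ → Ω → 𝕜}
    {hx : ∀ a (k : ℕ), MemLp (x a) k P} {R : σ → σ → 𝕜} (h : IsWick R (expectation hx))
    (A : τ → σ → 𝕜) {y : τ → Ω → 𝕜} (hy : ∀ b (k : ℕ), MemLp (y b) k P)
    (hxy : ∀ b, y b =ᵐ[P] fun ω => ∑ a, A b a * x a ω) :
    IsWick (fun a b => ∑ s, ∑ t, A a s * R s t * A b t) (expectation hy) := by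
  convert h.comp_linearSubst A using 1
  refine LinearMap.ext fun p => ?_
  simp only [LinearMap.comp_apply, AlgHom.toLinearMap_apply, expectation_apply, eval_linearSubst]
  refine integral_congr_ae ?_
  filter_upwards [ae_all_iff.mpr hxy] with ω hω
  simp only [hω]

open scoped MatrixOrder in
-- Presents the Gaussian law as a linear image of independent standard normals, to which the
-- substitution rule for Wick functionals applies.
theorem exists_sqrt_multivariateGaussian [Fintype σ] [DecidableEq σ] {S : Matrix σ σ ℝ}
    (hS : S.PosSemidef) : ∃ A : Matrix σ σ ℝ, A * A.transpose = S ∧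
      multivariateGaussian 0 S = (Measure.pi fun _ : σ => gaussianReal 0 1).map
        (fun x => WithLp.toLp 2 (A.mulVec x)) := by
  refine ⟨CFC.sqrt S, ?_, ?_⟩
  · have h : (CFC.sqrt S).transpose = CFC.sqrt S := by
      have := (CFC.sqrt_nonneg S).isSelfAdjoint.star_eq
      rwa [Matrix.star_eq_conjTranspose, Matrix.conjTranspose_eq_transpose_of_trivial] at this
    rw [h, CFC.sqrt_mul_sqrt_self S hS.nonneg]
  · rw [multivariateGaussian, ← map_pi_eq_stdGaussian, Measure.map_map (by fun_prop) (by fun_prop)]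
    congr 1
    funext x
    simp [Matrix.toEuclideanCLM_toLp]

/-- Both sides satisfy integration by parts with covariance `S`. Semidefiniteness is needed for the
probabilistic side only; `wick S` makes sense for every `S`. -/
theorem integral_eval_multivariateGaussian [Fintype σ] [DecidableEq σ] {S : Matrix σ σ ℝ}
    (hS : S.PosSemidef) (p : MvPolynomial σ ℝ) :
    ∫ x, eval (fun a => x a) p ∂(multivariateGaussian 0 S) = wick S p := by
  obtain ⟨A, hAA, hA⟩ := exists_sqrt_multivariateGaussian hS
  have hlaw : ∀ a : σ, HasLaw (fun x : σ → ℝ => x a) (gaussianReal 0 1)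
      (Measure.pi fun _ : σ => gaussianReal 0 1) := fun a =>
    ⟨(measurable_pi_apply a).aemeasurable, (measurePreserving_eval _ a).map_eq⟩
  have hind : iIndepFun (fun (a : σ) (x : σ → ℝ) => x a)
      (Measure.pi fun _ : σ => gaussianReal 0 1) :=
    iIndepFun_pi (X := fun _ x => x) fun _ => aemeasurable_id
  have hm : ∀ (a : σ) (k : ℕ), MemLp (fun x : σ → ℝ => x a) k
      (Measure.pi fun _ : σ => gaussianReal 0 1) := fun a k =>
    memLp_ofReal_of_hasLaw_gaussianReal (𝕜 := ℝ) (hlaw a) k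
  have hw := isWick_expectation_of_iIndepFun (𝕜 := ℝ) hind hlaw hm
  have hAw := isWick_expectation_linear hw A (memLp_linear hm A) fun _ => Filter.EventuallyEq.rfl
  have hcov : (fun a b => ∑ s, ∑ t, A a s *
      (if s = t then (((1 : NNReal) : ℝ) : ℝ) else 0) * A b t) = S := by
    funext a b
    rw [← hAA, Matrix.mul_apply]
    simp
  have hsymm : ∀ a b, S a b = S b a := fun a b => by
    simpa using (hS.isHermitian.apply a b).symm
  have huniq := (hcov ▸ hAw).unique (isWick_wick hsymm)
  rw [← huniq, expectation_apply, hA, integral_map (by fun_prop)]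
  · simp [Matrix.mulVec, dotProduct]
  · refine Continuous.aestronglyMeasurable ?_
    exact (MvPolynomial.continuous_eval p).comp (by fun_prop)

end Gaussian

/-! ### Covariances of the entries of a GUE matrix and unitary invariance -/

section GUE

open MvPolynomial

variable {Ω : Type*} {mΩ : MeasurableSpace Ω} {P : Measure Ω} {N : ℕ}

/-- The covariances `E[H p H q]` of the entries of a standard GUE matrix. -/
noncomputable def gueCov (p q : Fin N × Fin N) : ℂ := if q = p.swap then 1 else 0

/-- The coefficients of the entries of a Hermitian matrix in terms of its real coordinates. -/
noncomputable def hermitianCoeff (p q : Fin N × Fin N) : ℂ :=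
  if p.1 = p.2 then (if q = p then 1 else 0)
  else if p.1 < p.2 then (if q = p then 1 else 0) + (if q = p.swap then Complex.I else 0)
  else (if q = p.swap then 1 else 0) + (if q = p then -Complex.I else 0)

theorem entry_eq_sum_hermitianCoeff {H : Matrix (Fin N) (Fin N) ℂ} (hH : H.IsHermitian)
    (p : Fin N × Fin N) : H p.1 p.2 = ∑ q, hermitianCoeff p q * (hermitianCoord H q : ℂ) := by
  obtain ⟨i, j⟩ := p
  have hij : H i j = (starRingEnd ℂ) (H j i) := (hH.apply i j).symm
  rcases lt_trichotomy i j with h | rfl | h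
  · simp only [hermitianCoeff, h, h.ne, if_true, if_false, add_mul, ite_mul, one_mul, zero_mul,
      Finset.sum_add_distrib, Finset.sum_ite_eq', Finset.mem_univ, Prod.swap, hermitianCoord,
      h.le, not_le.mpr h]
    apply Complex.ext <;> simp
  · simp only [hermitianCoeff, if_true, ite_mul, one_mul, zero_mul, Finset.sum_ite_eq',
      Finset.mem_univ, hermitianCoord, le_refl]
    apply Complex.ext
    · simp
    · have := congrArg Complex.im hij
      simp only [Complex.conj_im] at this
      simp only [Complex.ofReal_im]
      linarith
  · simp only [hermitianCoeff, h.ne', not_lt.mpr h.le, if_true, if_false, add_mul, ite_mul, one_mul,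
      zero_mul, Finset.sum_add_distrib, Finset.sum_ite_eq', Finset.mem_univ, Prod.swap,
      hermitianCoord, h.le, not_le.mpr h]
    rw [hij]
    apply Complex.ext <;> simp

/-- Off the diagonal the real and imaginary parts contribute `1/2` each: they cancel in `E[H_ij²]`
through `I² = -1` and add up to `1` in `E[H_ij H_ji]`. -/
theorem sum_hermitianCoeff (p q : Fin N × Fin N) :
    ∑ s, ∑ t, hermitianCoeff p s * (if s = t then
      ((((if s.1 = s.2 then 1 else 1 / 2 : NNReal) : NNReal) : ℝ) : ℂ) else 0) *
        hermitianCoeff q t = gueCov p q := by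
  have h1 : ∀ s : Fin N × Fin N, ∑ t, hermitianCoeff p s * (if s = t then
      ((((if s.1 = s.2 then 1 else 1 / 2 : NNReal) : NNReal) : ℝ) : ℂ) else 0) *
        hermitianCoeff q t = hermitianCoeff p s * ((if s.1 = s.2 then 1 else 1 / 2 : ℂ) *
          hermitianCoeff q s) := by
    intro s
    rw [Finset.sum_eq_single s]
    · rw [if_pos rfl, mul_assoc]
      split_ifs <;> simp
    · intro t _ ht
      rw [if_neg ht.symm]; simp
    · simp
  simp only [h1]
  obtain ⟨i, j⟩ := p
  obtain ⟨k, l⟩ := q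
  have hI := Complex.I_mul_I
  rcases lt_trichotomy i j with h | rfl | h
  · simp only [hermitianCoeff.eq_def (i, j), h, h.ne, if_true, if_false, add_mul, ite_mul, one_mul,
      zero_mul, Finset.sum_add_distrib, Finset.sum_ite_eq', Finset.mem_univ, Prod.swap, h.ne',
      gueCov]
    by_cases h1 : k = i ∧ l = j
    · obtain ⟨rfl, rfl⟩ := h1
      simp only [hermitianCoeff, Prod.swap, Prod.mk.injEq, h, h.ne, h.ne', if_true, if_false,
        and_self, add_zero, zero_add]
      linear_combination hI / 2
    · by_cases h2 : k = j ∧ l = i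
      · obtain ⟨rfl, rfl⟩ := h2
        simp only [hermitianCoeff, Prod.swap, Prod.mk.injEq, h.ne, h.ne', not_lt.mpr h.le,
          if_true, if_false, and_self, add_zero, zero_add]
        linear_combination -hI / 2
      · have h3 : ¬ (i = k ∧ j = l) := fun hh => h1 ⟨hh.1.symm, hh.2.symm⟩
        have h4 : ¬ (j = k ∧ i = l) := fun hh => h2 ⟨hh.1.symm, hh.2.symm⟩
        have h5 : ¬ (i = l ∧ j = k) := fun hh => h4 hh.symm
        have h6 : ¬ (j = l ∧ i = k) := fun hh => h3 hh.symm
        simp [hermitianCoeff, h2, h3, h4, h5, h6]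
  · simp only [hermitianCoeff.eq_def (i, i), if_true, ite_mul, one_mul, zero_mul,
      Finset.sum_ite_eq', Finset.mem_univ, gueCov, Prod.swap]
    by_cases h1 : k = i ∧ l = i
    · obtain ⟨rfl, rfl⟩ := h1
      simp [hermitianCoeff]
    · have h2 : ¬ (i = k ∧ i = l) := fun hh => h1 ⟨hh.1.symm, hh.2.symm⟩
      have h3 : ¬ (i = l ∧ i = k) := fun hh => h2 hh.symm
      simp [hermitianCoeff, h1, h2, h3]
  · simp only [hermitianCoeff.eq_def (i, j), not_lt.mpr h.le, h.ne', if_true, if_false, add_mul,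
      ite_mul, one_mul, zero_mul, Finset.sum_add_distrib, Finset.sum_ite_eq', Finset.mem_univ,
      Prod.swap, h.ne, gueCov]
    by_cases h1 : k = i ∧ l = j
    · obtain ⟨rfl, rfl⟩ := h1
      simp only [hermitianCoeff, Prod.swap, Prod.mk.injEq, not_lt.mpr h.le, h.ne, h.ne', if_true,
        if_false, and_self, add_zero, zero_add]
      linear_combination hI / 2
    · by_cases h2 : k = j ∧ l = i
      · obtain ⟨rfl, rfl⟩ := h2
        simp only [hermitianCoeff, Prod.swap, Prod.mk.injEq, h, h.ne, h.ne',
          if_true, if_false, and_self, add_zero, zero_add]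
        linear_combination -hI / 2
      · have h3 : ¬ (i = k ∧ j = l) := fun hh => h1 ⟨hh.1.symm, hh.2.symm⟩
        have h4 : ¬ (j = k ∧ i = l) := fun hh => h2 ⟨hh.1.symm, hh.2.symm⟩
        have h5 : ¬ (i = l ∧ j = k) := fun hh => h4 hh.symm
        have h6 : ¬ (j = l ∧ i = k) := fun hh => h3 hh.symm
        simp [hermitianCoeff, h2, h3, h4, h5, h6]

theorem IsStandardGUE.memLp [IsProbabilityMeasure P]
    {Ξ : Ω → Matrix (Fin N) (Fin N) ℂ} (hΞ : IsStandardGUE Ξ P) (p : Fin N × Fin N) (k : ℕ) :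
    MemLp (fun ω => Ξ ω p.1 p.2) k P := by
  refine (memLp_linear (𝕜 := ℂ) (fun q k => memLp_ofReal_of_hasLaw_gaussianReal (hΞ.hasLaw q) k)
    hermitianCoeff p k).ae_eq ?_
  filter_upwards [hΞ.isHermitian] with ω hω
  exact (entry_eq_sum_hermitianCoeff hω p).symm

theorem IsStandardGUE.isWick [IsProbabilityMeasure P]
    {Ξ : Ω → Matrix (Fin N) (Fin N) ℂ} (hΞ : IsStandardGUE Ξ P) :
    IsWick gueCov (expectation hΞ.memLp) := by
  have h := isWick_expectation_linear (𝕜 := ℂ) (isWick_expectation_of_iIndepFun hΞ.indep hΞ.hasLaw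
    fun q k => memLp_ofReal_of_hasLaw_gaussianReal (hΞ.hasLaw q) k) hermitianCoeff hΞ.memLp
    fun p => by
      filter_upwards [hΞ.isHermitian] with ω hω
      exact entry_eq_sum_hermitianCoeff hω p
  have hcov : (fun p q : Fin N × Fin N => ∑ s, ∑ t, hermitianCoeff p s * (if s = t then
      ((((if s.1 = s.2 then 1 else 1 / 2 : NNReal) : NNReal) : ℝ) : ℂ) else 0) *
        hermitianCoeff q t) = gueCov := funext fun p => funext fun q => sum_hermitianCoeff p q
  rw [← hcov]
  exact h

/-- Only `t = s.swap` contributes, after which the sum over `s` splits into a product of two entries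
of `U* U`. -/
theorem sum_conj_gueCov {U : Matrix (Fin N) (Fin N) ℂ} (hU : U.conjTranspose * U = 1) :
    (fun a b : Fin N × Fin N => ∑ s : Fin N × Fin N, ∑ t : Fin N × Fin N,
      (star (U s.1 a.1) * U s.2 a.2) * gueCov s t * (star (U t.1 b.1) * U t.2 b.2)) = gueCov := by
  have hUU : ∀ i j, ∑ k, star (U k i) * U k j = if i = j then 1 else 0 := by
    intro i j
    have := congrFun (congrFun hU i) j
    rwa [Matrix.mul_apply, Matrix.one_apply] at this
  funext a b
  have h1 : ∀ s : Fin N × Fin N, ∑ t : Fin N × Fin N,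
      (star (U s.1 a.1) * U s.2 a.2) * gueCov s t * (star (U t.1 b.1) * U t.2 b.2) =
        (star (U s.1 a.1) * U s.1 b.2) * (star (U s.2 b.1) * U s.2 a.2) := by
    intro s
    rw [Finset.sum_eq_single s.swap]
    · simp only [gueCov, if_true, Prod.fst_swap, Prod.snd_swap]
      ring
    · intro t _ ht
      simp [gueCov, ht]
    · simp
  rw [Finset.sum_congr rfl fun s _ => h1 s, Fintype.sum_prod_type]
  simp only [← Finset.mul_sum, ← Finset.sum_mul, hUU, gueCov]
  obtain ⟨a1, a2⟩ := a
  obtain ⟨b1, b2⟩ := b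
  simp only [Prod.swap, Prod.mk.injEq, eq_comm (a := b2)]
  by_cases h1 : a1 = b2 <;> by_cases h2 : b1 = a2 <;> simp [h1, h2]

/-- The law of a GUE matrix is invariant under unitary conjugation, as far as expectations of
polynomials in the entries are concerned. -/
theorem IsStandardGUE.integral_eval_conj [IsProbabilityMeasure P]
    {Ξ : Ω → Matrix (Fin N) (Fin N) ℂ} (hΞ : IsStandardGUE Ξ P) {U : Matrix (Fin N) (Fin N) ℂ}
    (hU : U.conjTranspose * U = 1) (p : MvPolynomial (Fin N × Fin N) ℂ) :
    ∫ ω, eval (fun q => (U.conjTranspose * Ξ ω * U) q.1 q.2) p ∂P =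
      ∫ ω, eval (fun q => Ξ ω q.1 q.2) p ∂P := by
  set A : Fin N × Fin N → Fin N × Fin N → ℂ := fun p q => star (U q.1 p.1) * U q.2 p.2 with hA
  have hy : ∀ (q : Fin N × Fin N), (fun ω => (U.conjTranspose * Ξ ω * U) q.1 q.2) =
      fun ω => ∑ s, A q s * Ξ ω s.1 s.2 := by
    intro q
    funext ω
    simp only [Matrix.mul_apply, Finset.sum_mul, Matrix.conjTranspose_apply, hA]
    rw [Finset.sum_comm, Fintype.sum_prod_type]
    exact Finset.sum_congr rfl fun _ _ => Finset.sum_congr rfl fun _ _ => by ring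
  have hm : ∀ (q : Fin N × Fin N) (k : ℕ),
      MemLp (fun ω => (U.conjTranspose * Ξ ω * U) q.1 q.2) k P := by
    intro q k
    rw [hy]
    exact memLp_linear (𝕜 := ℂ) hΞ.memLp A q k
  have h := isWick_expectation_linear (𝕜 := ℂ) hΞ.isWick A hm fun q =>
    Filter.EventuallyEq.of_eq (hy q)
  exact LinearMap.congr_fun (IsWick.unique (sum_conj_gueCov hU ▸ h) hΞ.isWick) p

/-- Two standard GUE matrices have the same polynomial moments. -/
theorem IsStandardGUE.integral_eval_eq [IsProbabilityMeasure P]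
    {Ξ : Ω → Matrix (Fin N) (Fin N) ℂ} (hΞ : IsStandardGUE Ξ P)
    {Ω' : Type*} {mΩ' : MeasurableSpace Ω'} {P' : Measure Ω'} [IsProbabilityMeasure P']
    {Ξ' : Ω' → Matrix (Fin N) (Fin N) ℂ} (hΞ' : IsStandardGUE Ξ' P')
    (p : MvPolynomial (Fin N × Fin N) ℂ) :
    ∫ ω, eval (fun q => Ξ ω q.1 q.2) p ∂P = ∫ ω, eval (fun q => Ξ' ω q.1 q.2) p ∂P' :=
  LinearMap.congr_fun (hΞ.isWick.unique hΞ'.isWick) p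

end GUE

/-! ### Tridiagonalization -/

section Tridiagonal

open MvPolynomial Matrix

/-- The family `tr M ^ k`, `w · M ^ k v`. -/
def traceStats {S ι : Type*} [CommRing S] [Fintype ι] [DecidableEq ι] (M : Matrix ι ι S)
    (w v : ι → S) : ℕ ⊕ ℕ → S :=
  Sum.elim (fun k => trace (M ^ k)) fun k => w ⬝ᵥ (M ^ k) *ᵥ v

theorem map_traceStats {S S' ι : Type*} [CommRing S] [CommRing S'] [Fintype ι] [DecidableEq ι]
    (f : S →+* S') (M : Matrix ι ι S) (w v : ι → S) (i : ℕ ⊕ ℕ) :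
    f (traceStats M w v i) = traceStats (M.map f) (f ∘ w) (f ∘ v) i := by
  have hpow : ∀ k, (M.map f) ^ k = (M ^ k).map f := fun k => by
    have := map_pow (f.mapMatrix : Matrix ι ι S →+* Matrix ι ι S') M k
    simpa using this.symm
  rcases i with k | k
  · simp only [traceStats, Sum.elim_inl, hpow]
    exact AddMonoidHom.map_trace f.toAddMonoidHom _
  · simp only [traceStats, Sum.elim_inr, hpow]
    rw [RingHom.map_dotProduct]
    congr 1
    funext j
    exact RingHom.map_mulVec f _ _ _

/-- A polynomial in the `traceStats` of a matrix is a polynomial in its entries. -/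
theorem exists_eval_traceStats {ι : Type*} [Fintype ι] [DecidableEq ι] (w v : ι → ℂ)
    (p : MvPolynomial (ℕ ⊕ ℕ) ℂ) : ∃ q : MvPolynomial (ι × ι) ℂ, ∀ M : Matrix ι ι ℂ,
      eval (traceStats M w v) p = eval (fun r => M r.1 r.2) q := by
  refine ⟨bind₁ (traceStats (mvPolynomialX ι ι ℂ) (C ∘ w) (C ∘ v)) p, fun M => ?_⟩
  rw [← eval₂_id, ← eval₂_id, ← coe_eval₂Hom, ← coe_eval₂Hom, eval₂Hom_bind₁]
  congr 2
  funext i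
  rw [map_traceStats]
  congr 1
  · ext j l; simp
  · funext j; simp
  · funext j; simp

/-- The `traceStats` of a bordered matrix are universal polynomials in the `traceStats` of the
smaller matrix. -/
theorem exists_bordered (a : ℂ) : ∃ r : ℕ ⊕ ℕ → MvPolynomial (ℕ ⊕ ℕ) ℂ,
    ∀ (n : ℕ) (M : Matrix (Fin (n + 1)) (Fin (n + 1)) ℂ), M (Fin.last n) (Fin.last n) = a → ∀ i,
      traceStats M (Pi.single (Fin.last n) 1) (Pi.single (Fin.last n) 1) i =
        eval (traceStats (M.submatrix Fin.castSucc Fin.castSucc)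
          (fun j => M (Fin.last n) j.castSucc) (fun j => M j.castSucc (Fin.last n))) (r i) := by
  -- Corner, last row, last column and minor of `M ^ k`, the latter three paired with all powers of
  -- `A`, form a family closed under `M ^ (k + 1) = M ^ k * M`; the corner alone would not support
  -- an induction.
  have key : ∀ k : ℕ, ∃ (g : MvPolynomial (ℕ ⊕ ℕ) ℂ) (ρ s t : ℕ → MvPolynomial (ℕ ⊕ ℕ) ℂ),
      ∀ (n : ℕ) (M : Matrix (Fin (n + 1)) (Fin (n + 1)) ℂ), M (Fin.last n) (Fin.last n) = a →
        ∀ (A : Matrix (Fin n) (Fin n) ℂ) (w v : Fin n → ℂ),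
        A = M.submatrix Fin.castSucc Fin.castSucc → (w = fun j => M (Fin.last n) j.castSucc) →
        (v = fun j => M j.castSucc (Fin.last n)) →
        (M ^ k) (Fin.last n) (Fin.last n) = eval (traceStats A w v) g ∧
        (∀ j, (fun i => (M ^ k) (Fin.last n) (Fin.castSucc i)) ⬝ᵥ (A ^ j) *ᵥ v =
          eval (traceStats A w v) (ρ j)) ∧
        (∀ j, (w ᵥ* (A ^ j)) ⬝ᵥ (fun i => (M ^ k) (Fin.castSucc i) (Fin.last n)) =
          eval (traceStats A w v) (s j)) ∧
        (∀ j, trace ((M ^ k).submatrix Fin.castSucc Fin.castSucc * A ^ j) =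
          eval (traceStats A w v) (t j)) := by
    intro k
    induction k with
    | zero =>
      refine ⟨1, fun _ => 0, fun _ => 0, fun j => X (Sum.inl j), ?_⟩
      intro n M ha A w v hA hw hv
      refine ⟨by simp, fun j => ?_, fun j => ?_, fun j => ?_⟩
      · simp [dotProduct, (Fin.castSucc_lt_last _).ne']
      · simp [dotProduct, (Fin.castSucc_lt_last _).ne]
      · rw [pow_zero, Matrix.submatrix_one _ (Fin.castSucc_injective n), one_mul]
        simp [traceStats]
    | succ k ih =>
      obtain ⟨g, ρ, s, t, h⟩ := ih
      refine ⟨ρ 0 + C a * g, fun j => ρ (j + 1) + g * X (Sum.inr j),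
        fun j => s (j + 1) + g * X (Sum.inr j), fun j => t (j + 1) + s j, ?_⟩
      intro n M ha A w v hA hw hv
      obtain ⟨h1, h2, h3, h4⟩ := h n M ha A w v hA hw hv
      have hu : ∀ j, eval (traceStats A w v) (X (Sum.inr j)) = w ⬝ᵥ (A ^ j) *ᵥ v := fun j => by
        simp [traceStats]
      have hrow : (fun i => (M ^ (k + 1)) (Fin.last n) (Fin.castSucc i)) =
          (fun i => (M ^ k) (Fin.last n) (Fin.castSucc i)) ᵥ* A +
            ((M ^ k) (Fin.last n) (Fin.last n)) • w := by
        funext i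
        rw [pow_succ, Matrix.mul_apply, Fin.sum_univ_castSucc, hA, hw]
        simp [vecMul, dotProduct]
      have hcol : (fun i => (M ^ (k + 1)) (Fin.castSucc i) (Fin.last n)) =
          A *ᵥ (fun i => (M ^ k) (Fin.castSucc i) (Fin.last n)) +
            ((M ^ k) (Fin.last n) (Fin.last n)) • v := by
        funext i
        rw [pow_succ', Matrix.mul_apply, Fin.sum_univ_castSucc, hA, hv]
        simp [mulVec, dotProduct, mul_comm]
      have hblk : (M ^ (k + 1)).submatrix Fin.castSucc Fin.castSucc =
          (M ^ k).submatrix Fin.castSucc Fin.castSucc * A +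
            vecMulVec (fun i => (M ^ k) (Fin.castSucc i) (Fin.last n)) w := by
        ext i j
        rw [Matrix.submatrix_apply, pow_succ, Matrix.mul_apply, Fin.sum_univ_castSucc, hA, hw]
        simp [Matrix.mul_apply, vecMulVec_apply]
      refine ⟨?_, fun j => ?_, fun j => ?_, fun j => ?_⟩
      · rw [map_add, map_mul, ← h2, ← h1, pow_succ, Matrix.mul_apply, Fin.sum_univ_castSucc, ha, hv]
        simp [dotProduct, mul_comm]
      · rw [hrow, add_dotProduct, smul_dotProduct, map_add, map_mul, hu, ← h1, ← h2,
          ← dotProduct_mulVec, mulVec_mulVec, ← pow_succ', smul_eq_mul]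
      · rw [hcol, dotProduct_add, dotProduct_smul, map_add, map_mul, hu, ← h1, ← h3,
          dotProduct_mulVec, vecMul_vecMul, ← pow_succ, smul_eq_mul, dotProduct_mulVec w (A ^ j)]
      · rw [hblk, add_mul, trace_add, mul_assoc, ← pow_succ', map_add, ← h4, ← h3,
          vecMulVec_mul, trace_vecMulVec, dotProduct_comm]
  choose g ρ s t h using key
  refine ⟨Sum.elim (fun k => t k 0 + g k) g, fun n M ha i => ?_⟩
  rcases i with k | k
  · obtain ⟨h1, -, -, h4⟩ := h k n M ha _ _ _ rfl rfl rfl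
    have h5 := h4 0
    rw [Sum.elim_inl, map_add, ← h1, ← h5, pow_zero, mul_one]
    simp [traceStats, trace, Fin.sum_univ_castSucc]
  · obtain ⟨h1, -, -, h4⟩ := h k n M ha _ _ _ rfl rfl rfl
    rw [Sum.elim_inr, ← h1]
    simp [traceStats]

/-- The normalized vector extends to an orthonormal basis, whose members are the columns of `U`. The
zero vector has no normalization and takes `c = 0`. -/
theorem exists_unitary_mulVec_single {n : ℕ} (v : Fin (n + 1) → ℂ) :
    ∃ (U : Matrix (Fin (n + 1)) (Fin (n + 1)) ℂ) (c : ℂ), U.conjTranspose * U = 1 ∧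
      v = c • (U *ᵥ Pi.single (Fin.last n) 1) := by
  obtain ⟨x, hxv⟩ : ∃ x : EuclideanSpace ℂ (Fin (n + 1)), ∀ i, x i = v i :=
    ⟨WithLp.toLp 2 v, by simp⟩
  by_cases hx : x = 0
  · refine ⟨1, 0, by simp, ?_⟩
    funext i
    simp [← hxv, hx]
  · have hx' : (‖x‖ : ℂ) ≠ 0 := by exact_mod_cast norm_ne_zero_iff.mpr hx
    have horth : Orthonormal ℂ (({Fin.last n} : Set (Fin (n + 1))).domRestrict
        fun _ => (‖x‖ : ℂ)⁻¹ • x) := by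
      constructor
      · intro i
        simp [norm_smul, norm_ne_zero_iff.mpr hx]
      · intro i j hij
        exact absurd (Subsingleton.elim i j) hij
    obtain ⟨b, hb⟩ := horth.exists_orthonormalBasis_extension_of_card_eq (by simp)
    refine ⟨Matrix.of fun i j => b j i, (‖x‖ : ℂ), ?_, ?_⟩
    · ext i j
      have := orthonormal_iff_ite.mp b.orthonormal i j
      rw [PiLp.inner_apply] at this
      rw [Matrix.mul_apply, Matrix.one_apply, ← this]
      simp [mul_comm]
    · have h1 := hb (Fin.last n) rfl
      funext i
      simp [h1, hx', hxv]

/-- The effect of unitary invariance on quadratic forms. -/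
theorem IsStandardGUE.integral_eval_traceStats {Ω : Type*} {mΩ : MeasurableSpace Ω} {P : Measure Ω}
    [IsProbabilityMeasure P] {n : ℕ} {Ξ : Ω → Matrix (Fin (n + 1)) (Fin (n + 1)) ℂ}
    (hΞ : IsStandardGUE Ξ P) (v : Fin (n + 1) → ℂ) (p : MvPolynomial (ℕ ⊕ ℕ) ℂ) :
    ∫ ω, eval (traceStats (Ξ ω) (star v) v) p ∂P =
      ∫ ω, eval (traceStats (Ξ ω) (Pi.single (Fin.last n) 1)
        ((star v ⬝ᵥ v) • Pi.single (Fin.last n) 1)) p ∂P := by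
  -- With `v = c U e`, the form `v* Ξ^k v` becomes `|c|² e* (U* Ξ U)^k e`, and `U* Ξ U` may be
  -- replaced by `Ξ` in expectations. The whole factor `|c|² = v* v` goes on the right vector, as in
  -- the tridiagonal model with its ones below the diagonal.
  obtain ⟨U, c, hU, hv⟩ := exists_unitary_mulVec_single v
  have hU' : U * U.conjTranspose = 1 := mul_eq_one_comm.mp hU
  set e : Fin (n + 1) → ℂ := Pi.single (Fin.last n) 1
  have hvv : star v ⬝ᵥ v = star c * c := by
    rw [hv, star_smul, smul_dotProduct, dotProduct_smul, star_mulVec, ← dotProduct_mulVec,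
      mulVec_mulVec, hU, one_mulVec]
    simp [e]
  obtain ⟨q, hq⟩ := exists_eval_traceStats e ((star v ⬝ᵥ v) • e) p
  simp only [hq]
  rw [← hΞ.integral_eval_conj hU]
  simp only [← hq]
  refine integral_congr_ae (Filter.Eventually.of_forall fun ω => ?_)
  dsimp only
  congr 2
  have hpow : ∀ k, (U.conjTranspose * Ξ ω * U) ^ k = U.conjTranspose * (Ξ ω) ^ k * U := by
    intro k
    induction k with
    | zero => simp [hU]
    | succ k ih =>
      calc _ = U.conjTranspose * (Ξ ω) ^ k * (U * U.conjTranspose) * Ξ ω * U := by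
            rw [pow_succ, ih]; simp only [mul_assoc]
        _ = _ := by rw [hU', mul_one, pow_succ]; simp only [mul_assoc]
  funext i
  rcases i with k | k
  · simp only [traceStats, Sum.elim_inl, hpow]
    rw [trace_mul_comm, ← mul_assoc, hU', one_mul]
  · simp only [traceStats, Sum.elim_inr, hpow]
    rw [hvv, mulVec_smul, dotProduct_smul, ← mulVec_mulVec, ← mulVec_mulVec, dotProduct_mulVec e]
    have he : e ᵥ* U.conjTranspose = star (U *ᵥ e) := by
      rw [star_mulVec]
      congr 1
      funext i
      simp [e, Pi.single_apply, apply_ite]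
    rw [he, hv, star_smul, smul_dotProduct, mulVec_smul, dotProduct_smul, smul_smul]

end Tridiagonal

/-! ### Explicit GUE and tridiagonal models on one probability space, and their comparison. -/

section Models

open MvPolynomial Matrix

instance : IsProbabilityMeasure normalFamily := by
  unfold normalFamily; infer_instance

theorem hasLaw_normalFamily (a : ℕ × ℕ) :
    HasLaw (fun ξ : ℕ × ℕ → ℝ => ξ a) (gaussianReal 0 1) normalFamily :=
  ⟨(measurable_pi_apply a).aemeasurable, (measurePreserving_eval_infinitePi _ a).map_eq⟩

theorem iIndepFun_normalFamily : iIndepFun (fun (a : ℕ × ℕ) (ξ : ℕ × ℕ → ℝ) => ξ a) normalFamily :=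
  iIndepFun_infinitePi (X := fun _ x => x) fun _ => measurable_id

theorem memLp_normalFamily {𝕜 : Type*} [RCLike 𝕜] (a : ℕ × ℕ) (k : ℕ) :
    MemLp (fun ξ : ℕ × ℕ → ℝ => (ξ a : 𝕜)) k normalFamily :=
  memLp_ofReal_of_hasLaw_gaussianReal (hasLaw_normalFamily a) k

open Classical in
/-- Replacing the variables outside `s` by independent copies preserves the law. -/
theorem measurePreserving_piecewise (s : Set (ℕ × ℕ)) :
    MeasurePreserving (fun x : (ℕ × ℕ → ℝ) × (ℕ × ℕ → ℝ) => s.piecewise x.1 x.2)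
      (normalFamily.prod normalFamily) normalFamily := by
  have hm : Measurable fun x : (ℕ × ℕ → ℝ) × (ℕ × ℕ → ℝ) => s.piecewise x.1 x.2 := by
    refine measurable_pi_lambda _ fun a => ?_
    by_cases ha : a ∈ s
    · simp only [Set.piecewise_eq_of_mem _ _ _ ha]; fun_prop
    · simp only [Set.piecewise_eq_of_notMem _ _ _ ha]; fun_prop
  refine ⟨hm, Measure.eq_infinitePi _ fun I t ht => ?_⟩
  rw [Measure.map_apply hm (MeasurableSet.pi I.countable_toSet fun a _ => ht a)]
  have hpre : (fun x : (ℕ × ℕ → ℝ) × (ℕ × ℕ → ℝ) => s.piecewise x.1 x.2) ⁻¹' (Set.pi I t) =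
      (Set.pi (I.filter (· ∈ s)) t) ×ˢ (Set.pi (I.filter (· ∉ s)) t) := by
    ext x
    simp only [Set.mem_preimage, Set.mem_pi, Set.mem_prod, Finset.coe_filter, Set.mem_ofPred_eq,
      Finset.mem_coe]
    constructor
    · intro h
      refine ⟨fun a ha => ?_, fun a ha => ?_⟩
      · simpa [ha.2] using h a ha.1
      · simpa [ha.2] using h a ha.1
    · rintro ⟨h1, h2⟩ a ha
      by_cases has : a ∈ s
      · simpa [has] using h1 a ⟨ha, has⟩
      · simpa [has] using h2 a ⟨ha, has⟩
  rw [hpre, Measure.prod_prod, normalFamily, Measure.infinitePi_pi _ fun a _ => ht a,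
    Measure.infinitePi_pi _ fun a _ => ht a, Finset.prod_filter_mul_prod_filter_not]

/-- A GUE matrix built from independent standard normal variables. -/
noncomputable def gueModel (N : ℕ) (ξ : ℕ × ℕ → ℝ) : Matrix (Fin N) (Fin N) ℂ :=
  Matrix.of fun i j =>
    if i = j then (ξ (i + 1, 0) : ℂ)
    else if i < j then ((ξ (j, 2 * i + 1) / √2 : ℝ) : ℂ) + (ξ (j, 2 * i + 2) / √2 : ℝ) * Complex.I
    else ((ξ (i, 2 * j + 1) / √2 : ℝ) : ℂ) - (ξ (i, 2 * j + 2) / √2 : ℝ) * Complex.I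

/-- The tridiagonal matrix with diagonal entries `ξ_{k0}`, entries `∑_{j=1}^{2k} ξ_{kj}² / 2` above
the diagonal, and entries `1` below. -/
noncomputable def triModel (N : ℕ) (ξ : ℕ × ℕ → ℝ) : Matrix (Fin N) (Fin N) ℝ :=
  Matrix.of fun i j =>
    if (j : ℕ) = i then ξ (i + 1, 0)
    else if (j : ℕ) = i + 1 then ∑ l ∈ Finset.Icc 1 (2 * ((i : ℕ) + 1)), ξ (i + 1, l) ^ 2 / 2
    else if (i : ℕ) = j + 1 then 1
    else 0

theorem isStandardGUE_gueModel (N : ℕ) : IsStandardGUE (gueModel N) normalFamily where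
  isHermitian := by
    refine Filter.Eventually.of_forall fun ξ => ?_
    ext i j
    simp only [conjTranspose_apply, gueModel, of_apply]
    rcases lt_trichotomy i j with h | rfl | h
    · simp [h, h.ne, h.ne', not_lt.mpr h.le, sub_eq_add_neg]
    · simp
    · simp [h, h.ne, h.ne', not_lt.mpr h.le, sub_eq_add_neg]
  indep := by
    -- The normal variable behind each real coordinate. Parity of the second index separates real
    -- from imaginary parts, and `0` marks the diagonal, whence injectivity and independence.
    let idx : Fin N × Fin N → ℕ × ℕ := fun p =>
      if p.1 = p.2 then (p.1 + 1, 0)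
      else if p.1 < p.2 then (p.2, 2 * p.1 + 1) else (p.1, 2 * p.2 + 2)
    have hidx : Function.Injective idx := by
      rintro ⟨i, j⟩ ⟨k, l⟩ h
      simp only [idx] at h
      simp only [Prod.mk.injEq, Fin.ext_iff, Fin.lt_def] at h ⊢
      split_ifs at h <;> simp only [Prod.mk.injEq] at h <;> omega
    have h1 := (iIndepFun_normalFamily.precomp hidx).comp
      (fun p x => if p.1 = p.2 then x else x / √2) (fun p => by
        split_ifs <;> fun_prop)
    convert h1 using 2 with p
    funext ξ
    obtain ⟨i, j⟩ := p
    simp only [hermitianCoord, gueModel, of_apply, Function.comp_apply, idx]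
    rcases lt_trichotomy i j with h | rfl | h
    · simp [h, h.ne, h.le]
    · simp
    · simp [h, h.ne, h.ne', not_lt.mpr h.le, not_le.mpr h]
  hasLaw := by
    have hs : ∀ a : ℕ × ℕ, HasLaw (fun ξ : ℕ × ℕ → ℝ => ξ a / √2) (gaussianReal 0 (1 / 2))
        normalFamily := by
      intro a
      refine ⟨((measurable_pi_apply a).div_const _).aemeasurable, ?_⟩
      have h2 := gaussianReal_map_div_const (μ := 0) (v := 1) (√2)
      rw [← (hasLaw_normalFamily a).map_eq, Measure.map_map (by fun_prop) (by fun_prop)] at h2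
      rw [show (fun ξ : ℕ × ℕ → ℝ => ξ a / √2) = (fun x => x / √2) ∘ fun ξ => ξ a from rfl, h2]
      congr 1
      · simp
      · ext; simp
    rintro ⟨i, j⟩
    rcases lt_trichotomy i j with h | rfl | h
    · simp only [h.ne, if_false]
      convert hs (j, 2 * i + 1) using 2 with ξ
      simp [hermitianCoord, gueModel, h, h.ne, h.le]
    · simp only [if_true]
      convert hasLaw_normalFamily (i + 1, 0) using 2 with ξ
      simp [hermitianCoord, gueModel]
    · simp only [h.ne', if_false]
      convert hs (i, 2 * j + 2) using 2 with ξ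
      simp [hermitianCoord, gueModel, h, h.ne, not_le.mpr h]

theorem memLp_triModel (N : ℕ) (p : Fin N × Fin N) (k : ℕ) :
    MemLp (fun ξ => (triModel N ξ p.1 p.2 : ℂ)) k normalFamily := by
  have h := memLp_eval (𝕜 := ℂ) (x := fun (a : ℕ × ℕ) (ξ : ℕ × ℕ → ℝ) => (ξ a : ℂ))
    memLp_normalFamily
    (if (p.2 : ℕ) = p.1 then X ((p.1 : ℕ) + 1, 0)
    else if (p.2 : ℕ) = p.1 + 1 then
      ∑ l ∈ Finset.Icc 1 (2 * ((p.1 : ℕ) + 1)), C (1 / 2) * X ((p.1 : ℕ) + 1, l) ^ 2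
    else if (p.1 : ℕ) = p.2 + 1 then 1
    else 0) k
  convert h using 2 with ξ
  simp only [triModel, of_apply]
  split_ifs
  · simp
  · simp only [Complex.ofReal_sum, map_sum, map_mul, map_pow, eval_X, eval_C]
    refine Finset.sum_congr rfl fun l _ => ?_
    push_cast
    ring
  · simp
  · simp

theorem integrable_eval_traceStats {Ω ι : Type*} {mΩ : MeasurableSpace Ω} {P : Measure Ω}
    [IsFiniteMeasure P] [Fintype ι] [DecidableEq ι] {M : Ω → Matrix ι ι ℂ}
    (hM : ∀ (p : ι × ι) (k : ℕ), MemLp (fun ω => M ω p.1 p.2) k P) (w v : ι → ℂ)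
    (p : MvPolynomial (ℕ ⊕ ℕ) ℂ) : Integrable (fun ω => eval (traceStats (M ω) w v) p) P := by
  obtain ⟨q, hq⟩ := exists_eval_traceStats w v p
  simp only [hq]
  exact integrable_eval (𝕜 := ℂ) hM q

/-- The variables which enter into the models of size `n`. -/
def modelVars (n : ℕ) : Set (ℕ × ℕ) := {a | (a.2 = 0 ∧ a.1 ≤ n) ∨ (a.2 ≠ 0 ∧ a.1 < n)}

theorem gueModel_congr {n : ℕ} {ξ ξ' : ℕ × ℕ → ℝ} (h : ∀ a ∈ modelVars n, ξ a = ξ' a) :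
    gueModel n ξ = gueModel n ξ' := by
  ext i j
  simp only [gueModel, of_apply]
  have hi := i.2
  have hj := j.2
  rw [h (i + 1, 0) (by simp [modelVars]), h (j, 2 * i + 1) (by simp [modelVars]),
    h (j, 2 * i + 2) (by simp [modelVars]), h (i, 2 * j + 1) (by simp [modelVars]),
    h (i, 2 * j + 2) (by simp [modelVars])]

theorem triModel_congr {n : ℕ} {ξ ξ' : ℕ × ℕ → ℝ} (h : ∀ a ∈ modelVars n, ξ a = ξ' a) :
    triModel n ξ = triModel n ξ' := by
  ext i j
  simp only [triModel, of_apply]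
  have hi := i.2
  have hj := j.2
  rw [h (i + 1, 0) (by simp [modelVars])]
  split_ifs with h1 h2
  · rfl
  · refine Finset.sum_congr rfl fun l hl => ?_
    rw [Finset.mem_Icc] at hl
    rw [h (i + 1, l) (Or.inr ⟨by dsimp only; omega, by dsimp only; omega⟩)]
  · rfl
  · rfl

theorem triModel_map_pow (n : ℕ) (ξ : ℕ × ℕ → ℝ) (k : ℕ) :
    ((triModel n ξ).map (↑) : Matrix _ _ ℂ) ^ k = (triModel n ξ ^ k).map (↑) := by
  have := map_pow (Complex.ofRealHom.mapMatrix : Matrix (Fin n) (Fin n) ℝ →+* _) (triModel n ξ) k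
  exact this.symm

theorem gueModel_submatrix (n : ℕ) (ξ : ℕ × ℕ → ℝ) :
    (gueModel (n + 1) ξ).submatrix Fin.castSucc Fin.castSucc = gueModel n ξ := by
  ext i j
  simp [gueModel]

theorem triModel_submatrix (n : ℕ) (ξ : ℕ × ℕ → ℝ) :
    (triModel (n + 1) ξ).submatrix Fin.castSucc Fin.castSucc = triModel n ξ := by
  ext i j
  simp [triModel]

/-- The column bordering `gueModel n` in `gueModel (n + 1)`. -/
noncomputable def gueColumn (n : ℕ) (ξ : ℕ × ℕ → ℝ) (j : Fin n) : ℂ :=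
  ((ξ (n, 2 * j + 1) / √2 : ℝ) : ℂ) + (ξ (n, 2 * j + 2) / √2 : ℝ) * Complex.I

/-- The squared length of the bordering column equals the corresponding superdiagonal entry of
`triModel` pointwise, not only in law, because both models use the same variables. -/
theorem star_gueColumn_dotProduct (n : ℕ) (ξ : ℕ × ℕ → ℝ) :
    star (gueColumn n ξ) ⬝ᵥ gueColumn n ξ =
      ((∑ l ∈ Finset.Icc 1 (2 * n), ξ (n, l) ^ 2 / 2 : ℝ) : ℂ) := by
  have h1 : ∀ j : Fin n, star (gueColumn n ξ) j * gueColumn n ξ j =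
      ((ξ (n, 2 * j + 1) ^ 2 / 2 + ξ (n, 2 * j + 2) ^ 2 / 2 : ℝ) : ℂ) := by
    intro j
    have h2 : √2 ^ 2 = 2 := Real.sq_sqrt (by norm_num)
    simp only [Pi.star_apply, gueColumn]
    apply Complex.ext
    · rw [Complex.ofReal_re]
      simp
      field_simp
      rw [h2]
      ring
    · rw [Complex.ofReal_im]
      simp
      ring
  rw [dotProduct, Finset.sum_congr rfl fun j _ => h1 j, ← Complex.ofReal_sum]
  congr 1
  rw [Fin.sum_univ_eq_sum_range
    (fun j => ξ (n, 2 * j + 1) ^ 2 / 2 + ξ (n, 2 * j + 2) ^ 2 / 2) n]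
  have : ∀ m, ∑ j ∈ Finset.range m, (ξ (n, 2 * j + 1) ^ 2 / 2 + ξ (n, 2 * j + 2) ^ 2 / 2) =
      ∑ l ∈ Finset.Icc 1 (2 * m), ξ (n, l) ^ 2 / 2 := by
    intro m
    induction m with
    | zero => simp
    | succ m ih =>
      rw [Finset.sum_range_succ, ih, show 2 * (m + 1) = 2 * m + 1 + 1 by ring,
        Finset.sum_Icc_succ_top (by omega), Finset.sum_Icc_succ_top (by omega)]
      ring_nf
  exact this n

theorem eval_bind₁ {σ τ : Type*} (f : τ → ℂ) (r : σ → MvPolynomial τ ℂ) (p : MvPolynomial σ ℂ) :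
    eval f (bind₁ r p) = eval (fun i => eval f (r i)) p := by
  rw [← eval₂_id, ← eval₂_id, ← coe_eval₂Hom, ← coe_eval₂Hom, eval₂Hom_bind₁]
  rfl

theorem gueModel_castSucc_last (n : ℕ) (ξ : ℕ × ℕ → ℝ) (j : Fin n) :
    gueModel (n + 1) ξ j.castSucc (Fin.last n) = gueColumn n ξ j := by
  have h := Fin.castSucc_lt_last j
  simp [gueModel, gueColumn, h, h.ne]

theorem gueModel_last_castSucc (n : ℕ) (ξ : ℕ × ℕ → ℝ) (j : Fin n) :
    gueModel (n + 1) ξ (Fin.last n) j.castSucc = star (gueColumn n ξ j) := by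
  have h := Fin.castSucc_lt_last j
  simp [gueModel, gueColumn, h.ne', h.not_gt, sub_eq_add_neg]

open Classical in
/-- Tridiagonalization: polynomials in the traces of powers have the same expectation for the two
models. -/
theorem integral_traceStats_gueModel (n : ℕ) (p : MvPolynomial (ℕ ⊕ ℕ) ℂ) :
    ∫ ξ, eval (traceStats (gueModel (n + 1) ξ) (Pi.single (Fin.last n) 1)
        (Pi.single (Fin.last n) 1)) p ∂normalFamily =
      ∫ ξ, eval (traceStats ((triModel (n + 1) ξ).map (↑)) (Pi.single (Fin.last n) 1)
        (Pi.single (Fin.last n) 1)) p ∂normalFamily := by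
  induction n generalizing p with
  | zero =>
    congr 1
    funext ξ
    congr 3
    ext i j
    have : j = i := Subsingleton.elim (α := Fin 1) _ _
    simp [gueModel, triModel, this]
  | succ n ih =>
    have hG := integrable_eval_traceStats (isStandardGUE_gueModel (n + 2)).memLp
      (Pi.single (Fin.last (n + 1)) 1) (Pi.single (Fin.last (n + 1)) 1) p
    have hT := integrable_eval_traceStats (M := fun ξ => (triModel (n + 2) ξ).map ((↑) : ℝ → ℂ))
      (memLp_triModel (n + 2))
      (Pi.single (Fin.last (n + 1)) 1) (Pi.single (Fin.last (n + 1)) 1) p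
    have hmp := measurePreserving_piecewise (modelVars (n + 1))
    -- Conditioning on the last row and column: `ξ` feeds the minor of size `n + 1`, while `ξ'`
    -- feeds the border and is frozen from here on.
    have split : ∀ f : (ℕ × ℕ → ℝ) → ℂ, Integrable f normalFamily →
        ∫ ξ, f ξ ∂normalFamily = ∫ ξ', ∫ ξ, f ((modelVars (n + 1)).piecewise ξ ξ') ∂normalFamily
          ∂normalFamily := by
      intro f hf
      have hf' : Integrable (fun x : (ℕ × ℕ → ℝ) × (ℕ × ℕ → ℝ) =>
          f ((modelVars (n + 1)).piecewise x.1 x.2)) (normalFamily.prod normalFamily) := by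
        have := (hmp.integrable_comp (g := f) hf.aestronglyMeasurable).mpr hf
        exact this
      rw [← integral_prod_symm _ hf']
      conv_lhs => rw [← hmp.map_eq]
      rw [integral_map hmp.aemeasurable]
      rw [hmp.map_eq]
      exact hf.aestronglyMeasurable
    rw [split _ hG, split _ hT]
    congr 1
    funext ξ'
    -- Both bordered models have the same corner entry, hence the same universal polynomials `r`.
    obtain ⟨r, hr⟩ := exists_bordered (ξ' (n + 2, 0) : ℂ)
    set v := gueColumn (n + 1) ξ' with hv
    set e : Fin (n + 1) → ℂ := Pi.single (Fin.last n) 1 with he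
    have hcol : ∀ ξ, gueColumn (n + 1) ((modelVars (n + 1)).piecewise ξ ξ') = v := by
      intro ξ
      funext j
      rw [hv, gueColumn, gueColumn, Set.piecewise_eq_of_notMem, Set.piecewise_eq_of_notMem] <;>
        simp [modelVars]
    have hGs : ∀ ξ, eval (traceStats (gueModel (n + 2) ((modelVars (n + 1)).piecewise ξ ξ'))
        (Pi.single (Fin.last (n + 1)) 1) (Pi.single (Fin.last (n + 1)) 1)) p =
          eval (traceStats (gueModel (n + 1) ξ) (star v) v) (bind₁ r p) := by
      intro ξ
      rw [eval_bind₁]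
      congr 2
      funext i
      rw [hr (n + 1) _ (by simp [gueModel, modelVars]) i]
      congr 3
      · rw [gueModel_submatrix]
        exact gueModel_congr fun a ha => Set.piecewise_eq_of_mem _ _ _ ha
      · funext j
        rw [gueModel_last_castSucc, hcol]
        rfl
      · funext j
        rw [gueModel_castSucc_last, hcol]
    have hTs : ∀ ξ, eval (traceStats ((triModel (n + 2)
        ((modelVars (n + 1)).piecewise ξ ξ')).map ((↑) : ℝ → ℂ))
        (Pi.single (Fin.last (n + 1)) 1) (Pi.single (Fin.last (n + 1)) 1)) p =
          eval (traceStats ((triModel (n + 1) ξ).map ((↑) : ℝ → ℂ)) e ((star v ⬝ᵥ v) • e))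
            (bind₁ r p) := by
      intro ξ
      rw [eval_bind₁]
      congr 2
      funext i
      rw [hr (n + 1) _ (by simp [triModel, modelVars]) i]
      congr 3
      · rw [submatrix_map, triModel_submatrix]
        congr 1
        exact triModel_congr fun a ha => Set.piecewise_eq_of_mem _ _ _ ha
      · funext j
        rw [he, map_apply, Pi.single_apply]
        have hj := j.2
        by_cases hj' : (j : ℕ) = n
        · have hj'' : j = Fin.last n := Fin.ext hj'
          simp only [triModel, of_apply, hj'', Fin.val_last, Fin.val_castSucc, if_true]
          rw [if_neg (by omega), if_neg (by omega), Complex.ofReal_one]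
        · have hj'' : j ≠ Fin.last n := fun h => hj' (by simp [h])
          rw [if_neg hj'']
          simp [triModel, hj.ne, Ne.symm hj', show (j : ℕ) ≠ n + 1 + 1 by omega]
      · funext j
        rw [hv, star_gueColumn_dotProduct, he, map_apply, Pi.smul_apply, Pi.single_apply]
        have hj := j.2
        by_cases hj' : (j : ℕ) = n
        · have hj'' : j = Fin.last n := Fin.ext hj'
          simp only [triModel, of_apply, hj'', Fin.val_last, Fin.val_castSucc, if_true,
            smul_eq_mul, mul_one]
          rw [if_neg (by omega)]
          congr 1
          refine Finset.sum_congr rfl fun l hl => ?_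
          rw [Finset.mem_Icc] at hl
          rw [Set.piecewise_eq_of_notMem]
          simp only [modelVars, Set.mem_ofPred_eq]
          omega
        · have hj'' : j ≠ Fin.last n := fun h => hj' (by simp [h])
          rw [if_neg hj'']
          simp [triModel, hj.ne', Ne.symm hj', show (j : ℕ) ≠ n + 1 + 1 by omega]
    -- The frozen scalar `v* v` is moved into the polynomial, since the induction hypothesis
    -- concerns the vectors `e`, `e` only.
    have hscale : ∀ M : Matrix (Fin (n + 1)) (Fin (n + 1)) ℂ,
        eval (traceStats M e ((star v ⬝ᵥ v) • e)) (bind₁ r p) =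
          eval (traceStats M e e) (bind₁ (Sum.elim (fun k => X (Sum.inl k))
            fun k => C (star v ⬝ᵥ v) * X (Sum.inr k)) (bind₁ r p)) := by
      intro M
      rw [eval_bind₁ _ _ (bind₁ r p)]
      congr 2
      funext i
      rcases i with k | k <;> simp [traceStats, mulVec_smul]
    have h1 := (isStandardGUE_gueModel (n + 1)).integral_eval_traceStats v (bind₁ r p)
    simp only [hGs, hTs]
    rw [h1]
    rw [integral_congr_ae (Filter.Eventually.of_forall fun ξ => hscale (gueModel (n + 1) ξ)),
      integral_congr_ae (Filter.Eventually.of_forall fun ξ =>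
        hscale ((triModel (n + 1) ξ).map ((↑) : ℝ → ℂ)))]
    exact ih (bind₁ (Sum.elim (fun k => X (Sum.inl k))
            fun k => C (star v ⬝ᵥ v) * X (Sum.inr k)) (bind₁ r p))

/-- Mixed moments of traces of powers of a standard GUE matrix agree with those of the tridiagonal
model. -/
theorem IsStandardGUE.integral_prod_trace {Ω : Type*} {mΩ : MeasurableSpace Ω} {P : Measure Ω}
    [IsProbabilityMeasure P] {N : ℕ} (hN : 0 < N) {Ξ : Ω → Matrix (Fin N) (Fin N) ℂ}
    (hΞ : IsStandardGUE Ξ P) {ι : Type*} (s : Finset ι) (m : ι → ℕ) :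
    ∫ ω, ∏ i ∈ s, (trace (Ξ ω ^ m i)).re ∂P =
      ∫ ξ, ∏ i ∈ s, trace (triModel N ξ ^ m i) ∂normalFamily := by
  obtain ⟨n, rfl⟩ := Nat.exists_eq_succ_of_ne_zero hN.ne'
  set e : Fin (n + 1) → ℂ := Pi.single (Fin.last n) 1
  set p : MvPolynomial (ℕ ⊕ ℕ) ℂ := ∏ i ∈ s, X (Sum.inl (m i)) with hp
  have heval : ∀ M : Matrix (Fin (n + 1)) (Fin (n + 1)) ℂ,
      eval (traceStats M e e) p = ∏ i ∈ s, trace (M ^ m i) := by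
    intro M
    simp [hp, traceStats]
  have hcplx : ∫ ω, eval (traceStats (Ξ ω) e e) p ∂P =
      ∫ ξ, eval (traceStats ((triModel (n + 1) ξ).map ((↑) : ℝ → ℂ)) e e) p ∂normalFamily := by
    rw [← integral_traceStats_gueModel n p]
    change _ = ∫ ξ, eval (traceStats (gueModel (n + 1) ξ) e e) p ∂normalFamily
    obtain ⟨q, hq⟩ := exists_eval_traceStats e e p
    simp only [hq]
    exact hΞ.integral_eval_eq (isStandardGUE_gueModel (n + 1)) q
  have hl : ∫ ω, eval (traceStats (Ξ ω) e e) p ∂P =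
      ((∫ ω, ∏ i ∈ s, (trace (Ξ ω ^ m i)).re ∂P : ℝ) : ℂ) := by
    rw [← integral_complex_ofReal]
    refine integral_congr_ae ?_
    filter_upwards [hΞ.isHermitian] with ω hω
    rw [heval, Complex.ofReal_prod]
    refine Finset.prod_congr rfl fun i _ => ?_
    -- Traces of powers of a Hermitian matrix are real.
    refine (Complex.conj_eq_iff_re.mp ?_).symm
    have := trace_conjTranspose (Ξ ω ^ m i)
    rw [(hω.pow (m i)).eq] at this
    exact this.symm
  have hr : ∫ ξ, eval (traceStats ((triModel (n + 1) ξ).map ((↑) : ℝ → ℂ)) e e) p ∂normalFamily =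
      ((∫ ξ, ∏ i ∈ s, trace (triModel (n + 1) ξ ^ m i) ∂normalFamily : ℝ) : ℂ) := by
    rw [← integral_complex_ofReal]
    refine integral_congr_ae (Filter.Eventually.of_forall fun ξ => ?_)
    dsimp only
    rw [heval, Complex.ofReal_prod]
    refine Finset.prod_congr rfl fun i _ => ?_
    rw [triModel_map_pow]
    exact (AddMonoidHom.map_trace Complex.ofRealHom.toAddMonoidHom _).symm
  exact_mod_cast hl.symm.trans (hcplx.trans hr)

end Models

/-! ### Set partitions -/

section Partitions

open Polynomial

variable {n : ℕ}

instance finite_setoid {α : Type*} [Finite α] : Finite (Setoid α) :=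
  Finite.of_injective (fun r : Setoid α => (fun a b => r a b : α → α → Prop)) fun _ _ h =>
    Setoid.ext fun a b => iff_of_eq (congrFun (congrFun h a) b)

noncomputable instance fintype_setoid {α : Type*} [Finite α] : Fintype (Setoid α) :=
  Fintype.ofFinite _

/-- The number of blocks. -/
noncomputable def blockCount (Ψ : Setoid (Fin n)) : ℕ := Nat.card (Quotient Ψ)

/-- The Möbius weight `(-1)^(|Ψ|-1) (|Ψ|-1)!`. -/
noncomputable def moebiusWeight (Ψ : Setoid (Fin n)) : ℝ :=
  (-1) ^ (blockCount Ψ - 1) * ((blockCount Ψ - 1)! : ℝ)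

theorem blockCount_pos (hn : 0 < n) (Ψ : Setoid (Fin n)) : 0 < blockCount Ψ := by
  have : Nonempty (Quotient Ψ) := ⟨Quotient.mk _ ⟨0, hn⟩⟩
  exact Nat.card_pos

theorem eq_top_of_blockCount_eq_one {Ψ : Setoid (Fin n)} (h : blockCount Ψ = 1) : Ψ = ⊤ :=
  Quotient.subsingleton_iff.mp ((Nat.card_eq_one_iff_unique.mp h).1)

theorem blockCount_top (hn : 0 < n) : blockCount (⊤ : Setoid (Fin n)) = 1 := by
  have : Nonempty (Quotient (⊤ : Setoid (Fin n))) := ⟨Quotient.mk _ ⟨0, hn⟩⟩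
  exact Nat.card_eq_one_iff_unique.mpr ⟨Quotient.subsingleton_iff.mpr rfl, inferInstance⟩

/-- A function with kernel exactly `Ψ` is an injection of the set of blocks. -/
theorem card_ker_eq (Ψ : Setoid (Fin n)) (x : ℕ) :
    Nat.card {f : Fin n → Fin x // Setoid.ker f = Ψ} = x.descFactorial (blockCount Ψ) := by
  classical
  let e : {f : Fin n → Fin x // Setoid.ker f = Ψ} ≃ (Quotient Ψ ↪ Fin x) :=
    { toFun := fun f => ⟨Quotient.lift f.1 fun a b (h : Ψ a b) => by
          rw [← f.2] at h; exact h, by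
        rintro ⟨a⟩ ⟨b⟩ (h : f.1 a = f.1 b)
        apply Quotient.sound
        change Ψ a b
        rw [← f.2]
        exact h⟩
      invFun := fun g => ⟨fun a => g (Quotient.mk Ψ a), Setoid.ext fun a b => by
        rw [Setoid.ker_def, g.injective.eq_iff]
        exact Quotient.eq⟩
      left_inv := fun f => rfl
      right_inv := fun g => by
        ext ⟨a⟩
        rfl }
  have : Fintype (Quotient Ψ) := Fintype.ofFinite _
  rw [Nat.card_congr e, Nat.card_eq_fintype_card, Fintype.card_embedding_eq, Fintype.card_fin,
    blockCount, Nat.card_eq_fintype_card]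

open Classical in
-- Counts the functions constant on the blocks of `Θ`, sorted by their kernel.
theorem pow_blockCount_eq_sum (Θ : Setoid (Fin n)) (x : ℕ) :
    x ^ blockCount Θ = ∑ Ψ with Θ ≤ Ψ, x.descFactorial (blockCount Ψ) := by
  have h1 : Nat.card {f : Fin n → Fin x // Θ ≤ Setoid.ker f} = x ^ blockCount Θ := by
    rw [Nat.card_congr (Setoid.liftEquiv Θ), Nat.card_fun]
    simp [blockCount]
  rw [← h1, Nat.card_eq_fintype_card, Fintype.card_subtype,
    Finset.card_eq_sum_card_fiberwise (f := fun f => Setoid.ker f)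
      (t := Finset.univ.filter fun Ψ => Θ ≤ Ψ)]
  · refine Finset.sum_congr rfl fun Ψ hΨ => ?_
    rw [← card_ker_eq, Nat.card_eq_fintype_card, Fintype.card_subtype, Finset.filter_filter]
    congr 1
    ext f
    simp only [Finset.mem_filter, Finset.mem_univ, true_and] at hΨ ⊢
    exact ⟨fun h => h.2, fun h => ⟨h ▸ hΨ, h⟩⟩
  · intro f hf
    simpa using hf

/-- Dividing `X (X - 1) ⋯ (X - k)` by `X` and setting `X = 0` leaves `(-1) ⋯ (-k)`: the Möbius
weight is the linear coefficient of a falling factorial. -/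
theorem coeff_one_descPochhammer (k : ℕ) :
    (descPochhammer ℝ (k + 1)).coeff 1 = (-1) ^ k * (k ! : ℝ) := by
  rw [descPochhammer_succ_left, coeff_X_mul, coeff_zero_eq_eval_zero, eval_comp]
  have h := ascPochhammer_eval_neg_eq_descPochhammer ℝ (-1) k
  rw [neg_neg, ascPochhammer_eval_one] at h
  rw [h, ← mul_assoc, ← mul_pow]
  simp

open Classical in
/-- The Möbius weights of the coarsenings of a nontrivial partition sum to zero. -/
theorem sum_moebiusWeight {Θ : Setoid (Fin n)} (hΘ : Θ ≠ ⊤) :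
    ∑ Ψ with Θ ≤ Ψ, moebiusWeight Ψ = 0 := by
  have hn : 0 < n := by
    rcases Nat.eq_zero_or_pos n with rfl | h
    · exact absurd (Setoid.ext fun a => a.elim0) hΘ
    · exact h
  -- The counting identity at all naturals is an identity of polynomials. Its linear coefficient is
  -- zero on the left as soon as `Θ` has at least two blocks.
  have hpoly : (X : ℝ[X]) ^ blockCount Θ = ∑ Ψ with Θ ≤ Ψ, descPochhammer ℝ (blockCount Ψ) := by
    refine Polynomial.eq_of_infinite_eval_eq _ _ ?_
    refine (Set.infinite_range_of_injective (Nat.cast_injective (R := ℝ))).mono ?_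
    rintro _ ⟨x, rfl⟩
    change eval (x : ℝ) _ = eval (x : ℝ) _
    rw [eval_pow, eval_X, eval_finsetSum]
    simp only [descPochhammer_eval_eq_descFactorial]
    exact_mod_cast pow_blockCount_eq_sum Θ x
  have h1 := congrArg (fun p : ℝ[X] => p.coeff 1) hpoly
  simp only [coeff_X_pow, finsetSum_coeff] at h1
  have h2 : 1 ≠ blockCount Θ := fun h => hΘ (eq_top_of_blockCount_eq_one h.symm)
  rw [if_neg h2] at h1
  rw [h1]
  refine Finset.sum_congr rfl fun Ψ _ => ?_
  obtain ⟨k, hk⟩ := Nat.exists_eq_succ_of_ne_zero (blockCount_pos hn Ψ).ne'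
  rw [moebiusWeight, hk, Nat.succ_eq_add_one, coeff_one_descPochhammer, Nat.add_sub_cancel]

/-- The bond `e` lies in a single block of `Ψ`. -/
def InBlock (Ψ : Setoid (Fin n)) (e : Sym2 (Fin n)) : Prop := ∀ i ∈ e, ∀ j ∈ e, Ψ i j

theorem inBlock_mk {Ψ : Setoid (Fin n)} {i j : Fin n} : InBlock Ψ s(i, j) ↔ Ψ i j := by
  constructor
  · intro h
    exact h i (Sym2.mem_mk_left i j) j (Sym2.mem_mk_right i j)
  · intro h a ha b hb
    rw [Sym2.mem_iff] at ha hb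
    rcases ha with rfl | rfl <;> rcases hb with rfl | rfl
    · exact Ψ.refl _
    · exact h
    · exact Ψ.symm h
    · exact Ψ.refl _

theorem InBlock.mono {Ψ Φ : Setoid (Fin n)} (h : Ψ ≤ Φ) {e : Sym2 (Fin n)} (he : InBlock Ψ e) :
    InBlock Φ e := fun i hi j hj => h (he i hi j hj)

/-- The universal property of the join, from which its further properties are derived. -/
theorem bondJoin_le_iff {Γ : Finset (Sym2 (Fin n))} {Θ Ψ : Setoid (Fin n)} :
    bondJoin Γ Θ ≤ Ψ ↔ Θ ≤ Ψ ∧ ∀ e ∈ Γ, InBlock Ψ e := by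
  constructor
  · intro h
    refine ⟨le_trans (le_sInf fun Φ hΦ => hΦ.1) h, fun e he => InBlock.mono h ?_⟩
    intro i hi j hj
    exact fun Φ hΦ => hΦ.2 e he i hi j hj
  · intro h
    exact sInf_le h

theorem le_bondJoin (Γ : Finset (Sym2 (Fin n))) (Θ : Setoid (Fin n)) : Θ ≤ bondJoin Γ Θ :=
  (bondJoin_le_iff.mp le_rfl).1

theorem bondJoin_empty (Θ : Setoid (Fin n)) : bondJoin ∅ Θ = Θ :=
  eq_of_forall_ge_iff fun Ψ => by simp [bondJoin_le_iff]

theorem bondJoin_insert (e : Sym2 (Fin n)) (Γ : Finset (Sym2 (Fin n))) (Θ : Setoid (Fin n)) :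
    bondJoin (insert e Γ) Θ = bondJoin Γ (bondJoin {e} Θ) :=
  eq_of_forall_ge_iff fun Ψ => by simp [bondJoin_le_iff, and_assoc]

theorem bondJoin_singleton_of_inBlock {e : Sym2 (Fin n)} {Θ : Setoid (Fin n)} (h : InBlock Θ e) :
    bondJoin {e} Θ = Θ :=
  le_antisymm (bondJoin_le_iff.mpr ⟨le_rfl, by simpa using h⟩) (le_bondJoin _ _)

/-- The join is the kernel of the map sending each point to its block, with the block of `j`
redirected to that of `i`; the range misses exactly one block. -/
theorem blockCount_bondJoin {e : Sym2 (Fin n)} {Θ : Setoid (Fin n)} (h : ¬ InBlock Θ e) :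
    blockCount (bondJoin {e} Θ) + 1 = blockCount Θ := by
  classical
  induction e using Sym2.ind with
  | _ i j =>
  rw [inBlock_mk] at h
  let col : Fin n → Quotient Θ := fun x =>
    if Quotient.mk Θ x = Quotient.mk Θ j then Quotient.mk Θ i else Quotient.mk Θ x
  have hij : Quotient.mk Θ i ≠ Quotient.mk Θ j := fun hh => h (Quotient.exact hh)
  have hker : bondJoin {s(i, j)} Θ = Setoid.ker col := by
    refine eq_of_forall_ge_iff fun Ψ => ?_
    simp only [bondJoin_le_iff, Finset.mem_singleton, forall_eq, inBlock_mk]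
    constructor
    · rintro ⟨h1, h2⟩ x y (hxy : col x = col y)
      have key : ∀ x, ∃ x', col x = Quotient.mk Θ x' ∧ Ψ x x' := by
        intro x
        by_cases hx : Quotient.mk Θ x = Quotient.mk Θ j
        · exact ⟨i, if_pos hx, Ψ.trans (h1 (Quotient.exact hx)) (Ψ.symm h2)⟩
        · exact ⟨x, if_neg hx, Ψ.refl x⟩
      obtain ⟨x', hx1, hx2⟩ := key x
      obtain ⟨y', hy1, hy2⟩ := key y
      rw [hx1, hy1] at hxy
      exact Ψ.trans hx2 (Ψ.trans (h1 (Quotient.exact hxy)) (Ψ.symm hy2))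
    · intro hle
      refine ⟨fun x y hxy => hle ?_, hle ?_⟩
      · have : Quotient.mk Θ x = Quotient.mk Θ y := Quotient.sound hxy
        simp [Setoid.ker_def, col, this]
      · simp [Setoid.ker_def, col]
  have hrange : Set.range col = {q | q ≠ Quotient.mk Θ j} := by
    ext q
    constructor
    · rintro ⟨x, rfl⟩
      change col x ≠ _
      simp only [col]
      split_ifs with hx
      · exact hij
      · exact hx
    · intro hq
      obtain ⟨x, rfl⟩ := Quotient.exists_rep q
      exact ⟨x, if_neg hq⟩
  have h1 : blockCount (bondJoin {s(i, j)} Θ) =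
      Nat.card {q : Quotient Θ // q ≠ Quotient.mk Θ j} := by
    rw [hker, blockCount, Nat.card_congr (Setoid.quotientKerEquivRange col), hrange]
    rfl
  have : Fintype (Quotient Θ) := Fintype.ofFinite _
  have h2 : 0 < Fintype.card (Quotient Θ) := Fintype.card_pos_iff.mpr ⟨Quotient.mk Θ j⟩
  rw [h1, blockCount, Nat.card_eq_fintype_card, Nat.card_eq_fintype_card,
    Fintype.card_subtype_compl, Fintype.card_subtype_eq]
  omega

/-- Each bond lowers the number of blocks by at most one. -/
theorem blockCount_le_add_card (Γ : Finset (Sym2 (Fin n))) (Θ : Setoid (Fin n)) :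
    blockCount Θ ≤ blockCount (bondJoin Γ Θ) + Γ.card := by
  classical
  induction Γ using Finset.induction_on generalizing Θ with
  | empty => simp [bondJoin_empty]
  | insert e Γ he ih =>
    rw [bondJoin_insert, Finset.card_insert_of_notMem he]
    have h1 := ih (bondJoin {e} Θ)
    by_cases h : InBlock Θ e
    · rw [bondJoin_singleton_of_inBlock h] at h1 ⊢
      omega
    · have := blockCount_bondJoin h
      omega

end Partitions

/-! ### The tree expansion -/

section TreeExpansion

variable {n : ℕ}

/-- The simplex `τ > t_1 > ⋯ > t_m > 0`. -/
def scaledSimplex (m : ℕ) (τ : ℝ) : Set (Fin m → ℝ) :=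
  {t | StrictAnti t ∧ ∀ α, 0 < t α ∧ t α < τ}

theorem measurableSet_scaledSimplex (m : ℕ) (τ : ℝ) : MeasurableSet (scaledSimplex m τ) := by
  have : scaledSimplex m τ = (⋂ (i : Fin m) (j : Fin m) (_ : i < j), {t : Fin m → ℝ | t j < t i}) ∩
      ⋂ α : Fin m, ({t : Fin m → ℝ | 0 < t α} ∩ {t : Fin m → ℝ | t α < τ}) := by
    ext t
    simp only [scaledSimplex, StrictAnti, Set.mem_inter_iff, Set.mem_iInter, Set.mem_ofPred_eq]
  rw [this]
  refine MeasurableSet.inter ?_ ?_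
  · refine MeasurableSet.iInter fun i => MeasurableSet.iInter fun j =>
      MeasurableSet.iInter fun _ => ?_
    exact measurableSet_lt (by fun_prop) (by fun_prop)
  · refine MeasurableSet.iInter fun α => MeasurableSet.inter ?_ ?_
    · exact measurableSet_lt (by fun_prop) (by fun_prop)
    · exact measurableSet_lt (by fun_prop) (by fun_prop)

theorem scaledSimplex_subset (m : ℕ) (τ : ℝ) :
    scaledSimplex m τ ⊆ Set.Icc (fun _ => 0) fun _ => τ :=
  fun _ ht => ⟨fun α => (ht.2 α).1.le, fun α => (ht.2 α).2.le⟩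

theorem integrableOn_scaledSimplex {m : ℕ} {τ : ℝ} {F : (Fin m → ℝ) → ℝ} (hF : Continuous F) :
    IntegrableOn F (scaledSimplex m τ) :=
  (hF.continuousOn.integrableOn_compact isCompact_Icc).mono_set (scaledSimplex_subset m τ)

/-- The largest time `t 0` is the upper bound for the others, which is why the simplex carries a
scale `τ`. -/
theorem mem_scaledSimplex_succ {m : ℕ} {τ : ℝ} (t : Fin (m + 1) → ℝ) :
    t ∈ scaledSimplex (m + 1) τ ↔ t 0 ∈ Set.Ioo 0 τ ∧ Fin.tail t ∈ scaledSimplex m (t 0) := by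
  constructor
  · rintro ⟨h1, h2⟩
    exact ⟨h2 0, fun i j hij => h1 (Fin.succ_lt_succ_iff.mpr hij),
      fun α => ⟨(h2 α.succ).1, h1 (Fin.succ_pos α)⟩⟩
  · rintro ⟨h0, h1, h2⟩
    refine ⟨fun i j hij => ?_, fun α => ?_⟩
    · induction i using Fin.cases with
      | zero =>
        induction j using Fin.cases with
        | zero => exact absurd hij (lt_irrefl _)
        | succ j => exact (h2 j).2
      | succ i =>
        induction j using Fin.cases with
        | zero => exact absurd hij (by simp)
        | succ j => exact h1 (Fin.succ_lt_succ_iff.mp hij)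
    · induction α using Fin.cases with
      | zero => exact h0
      | succ α => exact ⟨(h2 α).1, (h2 α).2.trans h0.2⟩

/-- Fubini's theorem for the ordered simplex. -/
theorem integral_scaledSimplex_succ {m : ℕ} {τ : ℝ} {F : ℝ → (Fin m → ℝ) → ℝ}
    (hF : Continuous (Function.uncurry F)) :
    IntegrableOn (fun t₀ => ∫ s in scaledSimplex m t₀, F t₀ s) (Set.Ioo 0 τ) ∧
    ∫ t in scaledSimplex (m + 1) τ, F (t 0) (Fin.tail t) =
      ∫ t₀ in Set.Ioo 0 τ, ∫ s in scaledSimplex m t₀, F t₀ s := by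
  set S : Set (ℝ × (Fin m → ℝ)) := {x | x.1 ∈ Set.Ioo 0 τ ∧ x.2 ∈ scaledSimplex m x.1} with hS
  set e := MeasurableEquiv.piFinSuccAbove (fun _ : Fin (m + 1) => ℝ) 0 with he
  have hmp : MeasurePreserving e volume volume := volume_preserving_piFinSuccAbove _ 0
  have he' : ∀ t, e t = (t 0, Fin.tail t) := fun t => rfl
  have hpre : e ⁻¹' S = scaledSimplex (m + 1) τ := by
    ext t
    rw [mem_scaledSimplex_succ]
    rfl
  have hSm : MeasurableSet S := by
    have := e.symm.measurable (measurableSet_scaledSimplex (m + 1) τ)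
    rwa [← hpre, ← Set.preimage_comp, MeasurableEquiv.self_comp_symm, Set.preimage_id] at this
  have hintegrable : Integrable (S.indicator (Function.uncurry F)) := by
    rw [integrable_indicator_iff hSm]
    refine (hF.continuousOn.integrableOn_compact
      (isCompact_Icc (a := ((0 : ℝ), fun _ : Fin m => (0 : ℝ)))
        (b := (τ, fun _ : Fin m => τ)))).mono_set ?_
    rintro ⟨t₀, s⟩ ⟨h0, h1⟩
    refine ⟨⟨h0.1.le, fun α => (h1.2 α).1.le⟩, ⟨h0.2.le, fun α => ?_⟩⟩
    exact ((h1.2 α).2.trans h0.2).le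
  have hinner : (fun t₀ => ∫ s, S.indicator (Function.uncurry F) (t₀, s)) =
      (Set.Ioo 0 τ).indicator fun t₀ => ∫ s in scaledSimplex m t₀, F t₀ s := by
    funext t₀
    by_cases h0 : t₀ ∈ Set.Ioo 0 τ
    · rw [Set.indicator_of_mem h0, ← integral_indicator (measurableSet_scaledSimplex m t₀)]
      congr 1
      funext s
      by_cases hs : s ∈ scaledSimplex m t₀
      · rw [Set.indicator_of_mem hs, Set.indicator_of_mem (show (t₀, s) ∈ S from ⟨h0, hs⟩)]
        rfl
      · rw [Set.indicator_of_notMem hs, Set.indicator_of_notMem fun h => hs h.2]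
    · rw [Set.indicator_of_notMem h0]
      have hz : ∀ s, S.indicator (Function.uncurry F) (t₀, s) = 0 := fun s =>
        Set.indicator_of_notMem (fun h => h0 h.1) _
      simp only [hz, integral_zero]
  rw [Measure.volume_eq_prod] at hintegrable
  constructor
  · rw [← integrable_indicator_iff measurableSet_Ioo, ← hinner]
    exact hintegrable.integral_prod_left
  · rw [← integral_indicator measurableSet_Ioo, ← hinner, ← integral_prod _ hintegrable,
      ← Measure.volume_eq_prod, integral_indicator hSm, ← hpre]
    have := hmp.setIntegral_preimage_emb e.measurableEmbedding (Function.uncurry F) S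
    exact this

/-- The interpolating matrix `(τ - t_1) [Θ] + (t_1 - t_2) [{e_1} ∨ Θ] + ⋯`. -/
noncomputable def pathMatrix : (m : ℕ) → Setoid (Fin n) → ℝ → (Fin m → Sym2 (Fin n)) →
    (Fin m → ℝ) → (Fin n → Fin n → ℝ)
  | 0, Θ, τ, _, _ => τ • partitionMatrix Θ
  | m + 1, Θ, τ, e, t => (τ - t 0) • partitionMatrix Θ +
      pathMatrix m (bondJoin {e 0} Θ) (t 0) (Fin.tail e) (Fin.tail t)

/-- Each bond of the sequence joins two different blocks of the partition generated by `Θ` and the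
previous bonds. -/
def IsTreeSeq : (m : ℕ) → Setoid (Fin n) → (Fin m → Sym2 (Fin n)) → Prop
  | 0, _, _ => True
  | m + 1, Θ, e => ¬ InBlock Θ (e 0) ∧ IsTreeSeq m (bondJoin {e 0} Θ) (Fin.tail e)

/-- The composition `D e_m ∘ ⋯ ∘ D e_1`. -/
def seqOperator {V : Type*} [AddCommGroup V] [Module ℝ V] (D : Sym2 (Fin n) → Module.End ℝ V) :
    (m : ℕ) → (Fin m → Sym2 (Fin n)) → Module.End ℝ V
  | 0, _ => 1
  | m + 1, e => seqOperator D m (Fin.tail e) * D (e 0)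

theorem continuous_pathMatrix (m : ℕ) (Θ : Setoid (Fin n)) (e : Fin m → Sym2 (Fin n)) :
    Continuous fun x : ℝ × (Fin m → ℝ) => pathMatrix m Θ x.1 e x.2 := by
  induction m generalizing Θ with
  | zero =>
    simp only [pathMatrix]
    fun_prop
  | succ m ih =>
    simp only [pathMatrix]
    refine Continuous.add (by fun_prop) ?_
    exact (ih (bondJoin {e 0} Θ) (Fin.tail e)).comp
      (f := fun x : ℝ × (Fin (m + 1) → ℝ) => (x.2 0, Fin.tail x.2)) (by unfold Fin.tail; fun_prop)

open Classical in
/-- The tree expansion of a sum over partitions weighted by Möbius weights. -/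
theorem sum_isTreeSeq_integral {V : Type*} [AddCommGroup V] [Module ℝ V]
    (D : Sym2 (Fin n) → Module.End ℝ V) (W : (Fin n → Fin n → ℝ) → V →ₗ[ℝ] ℝ)
    (hcont : ∀ p, Continuous fun Q => W Q p)
    (hderiv : ∀ (p : V) (A : Fin n → Fin n → ℝ) (Θ Ψ : Setoid (Fin n)), Θ ≤ Ψ → ∀ t : ℝ,
      HasDerivAt (fun t : ℝ => W (A + t • (partitionMatrix Ψ - partitionMatrix Θ)) p)
        (∑ e with InBlock Ψ e ∧ ¬ InBlock Θ e,
          W (A + t • (partitionMatrix Ψ - partitionMatrix Θ)) (D e p)) t)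
    (m : ℕ) (Θ : Setoid (Fin n)) (hΘ : blockCount Θ = m + 1) (A : Fin n → Fin n → ℝ) {τ : ℝ}
    (hτ : 0 ≤ τ) (p : V) :
    ∑ e with IsTreeSeq m Θ e, ∫ t in scaledSimplex m τ,
        W (A + pathMatrix m Θ τ e t) (seqOperator D m e p) =
      ∑ Ψ with Θ ≤ Ψ, moebiusWeight Ψ * W (A + τ • partitionMatrix Ψ) p := by
  -- `A` accumulates the part of the interpolating matrix already fixed by earlier bonds, and `τ` is
  -- the last time used.
  induction m generalizing Θ A τ p with
  | zero =>
    obtain rfl := eq_top_of_blockCount_eq_one hΘ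
    have h1 : (Finset.univ.filter fun Ψ : Setoid (Fin n) => ⊤ ≤ Ψ) = {⊤} := by
      ext Ψ; simp
    have h2 : scaledSimplex 0 τ = Set.univ := by
      ext t
      simp [scaledSimplex, Subsingleton.strictAnti]
    have h3 : (volume : Measure (Fin 0 → ℝ)).real Set.univ = 1 := by
      simp [Measure.real, volume_pi]
    rw [h1, Finset.sum_singleton, h2]
    simp [IsTreeSeq, pathMatrix, seqOperator, moebiusWeight, hΘ, h3]
  | succ m ih =>
    have hpath : ∀ (e₀ : Sym2 (Fin n)) (e : Fin m → Sym2 (Fin n)) (q : V),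
        Continuous (Function.uncurry fun (t₀ : ℝ) (s : Fin m → ℝ) =>
          W (A + (τ - t₀) • partitionMatrix Θ + pathMatrix m (bondJoin {e₀} Θ) t₀ e s) q) := by
      intro e₀ e q
      refine (hcont q).comp (Continuous.add (by fun_prop) ?_)
      exact continuous_pathMatrix m (bondJoin {e₀} Θ) e
    have hmat : ∀ (Ψ : Setoid (Fin n)) (t : ℝ),
        A + (τ - t) • partitionMatrix Θ + t • partitionMatrix Ψ =
          (A + τ • partitionMatrix Θ) + t • (partitionMatrix Ψ - partitionMatrix Θ) := by
      intro Ψ t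
      module
    -- For a fixed first bond, the time `t 0` is integrated last; the inner simplex is the induction
    -- hypothesis with `{e₀} ∨ Θ`, `A + (τ - t₀) [Θ]`, `t₀` and `D e₀ p`.
    have hstep : ∀ e₀, ¬ InBlock Θ e₀ → ∑ e with IsTreeSeq m (bondJoin {e₀} Θ) e,
        ∫ t in scaledSimplex (m + 1) τ, W (A + (τ - t 0) • partitionMatrix Θ +
          pathMatrix m (bondJoin {e₀} Θ) (t 0) e (Fin.tail t)) (seqOperator D m e (D e₀ p)) =
        ∑ Ψ with Θ ≤ Ψ ∧ InBlock Ψ e₀, moebiusWeight Ψ * ∫ t in (0 : ℝ)..τ,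
          W (A + τ • partitionMatrix Θ + t • (partitionMatrix Ψ - partitionMatrix Θ)) (D e₀ p) := by
      intro e₀ he₀
      have hF := fun e => integral_scaledSimplex_succ (τ := τ)
        (hpath e₀ e (seqOperator D m e (D e₀ p)))
      rw [Finset.sum_congr rfl fun e _ => (hF e).2, ← integral_finsetSum _ fun e _ => (hF e).1]
      have hbc : blockCount (bondJoin {e₀} Θ) = m + 1 := by
        have := blockCount_bondJoin he₀
        omega
      have hinner : ∀ t₀ ∈ Set.Ioo 0 τ, (∑ e with IsTreeSeq m (bondJoin {e₀} Θ) e,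
          ∫ s in scaledSimplex m t₀, W (A + (τ - t₀) • partitionMatrix Θ +
            pathMatrix m (bondJoin {e₀} Θ) t₀ e s) (seqOperator D m e (D e₀ p))) =
          ∑ Ψ with Θ ≤ Ψ ∧ InBlock Ψ e₀, moebiusWeight Ψ *
            W (A + τ • partitionMatrix Θ + t₀ • (partitionMatrix Ψ - partitionMatrix Θ))
              (D e₀ p) := by
        intro t₀ ht₀
        rw [ih (bondJoin {e₀} Θ) hbc (A + (τ - t₀) • partitionMatrix Θ) ht₀.1.le (D e₀ p)]
        refine Finset.sum_congr ?_ fun Ψ _ => by rw [hmat]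
        ext Ψ
        simp [bondJoin_le_iff]
      rw [setIntegral_congr_fun measurableSet_Ioo hinner, ← integral_Ioc_eq_integral_Ioo,
        ← intervalIntegral.integral_of_le hτ, intervalIntegral.integral_finsetSum]
      · simp only [intervalIntegral.integral_const_mul]
      · intro Ψ _
        refine Continuous.intervalIntegrable ?_ _ _
        exact continuous_const.mul ((hcont _).comp (by fun_prop))
    have hcons : ∑ e with IsTreeSeq (m + 1) Θ e, ∫ t in scaledSimplex (m + 1) τ,
          W (A + pathMatrix (m + 1) Θ τ e t) (seqOperator D (m + 1) e p) =
        ∑ e₀ with ¬ InBlock Θ e₀, ∑ e with IsTreeSeq m (bondJoin {e₀} Θ) e,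
        ∫ t in scaledSimplex (m + 1) τ, W (A + (τ - t 0) • partitionMatrix Θ +
          pathMatrix m (bondJoin {e₀} Θ) (t 0) e (Fin.tail t)) (seqOperator D m e (D e₀ p)) := by
      rw [Finset.sum_filter, ← (Fin.consEquiv fun _ => Sym2 (Fin n)).sum_comp,
        Fintype.sum_prod_type, Finset.sum_filter]
      refine Finset.sum_congr rfl fun e₀ _ => ?_
      by_cases h : InBlock Θ e₀
      · rw [if_neg (not_not.mpr h)]
        refine Finset.sum_eq_zero fun e _ => ?_
        rw [if_neg]
        simp [IsTreeSeq, h]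
      · rw [if_pos h, Finset.sum_filter]
        refine Finset.sum_congr rfl fun e _ => ?_
        have htail : Fin.tail ((Fin.consEquiv fun _ => Sym2 (Fin n)) (e₀, e)) = e := rfl
        simp only [htail, Fin.consEquiv_apply, IsTreeSeq, Fin.cons_zero, h,
          not_false_eq_true, true_and, pathMatrix, seqOperator, Module.End.mul_apply, add_assoc]
    have hne : Θ ≠ ⊤ := by
      rintro rfl
      have hn : 0 < n := by
        rcases Nat.eq_zero_or_pos n with rfl | h
        · rw [blockCount, Nat.card_eq_zero.mpr (Or.inl inferInstance)] at hΘ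
          omega
        · exact h
      rw [blockCount_top hn] at hΘ
      omega
    rw [hcons, Finset.sum_congr rfl fun e₀ he₀ => hstep e₀ (Finset.mem_filter.mp he₀).2]
    -- With `Ψ` outside, the bonds inside are precisely those in the derivative along the segment
    -- from `[Θ]` to `[Ψ]`.
    rw [Finset.sum_comm' (t' := Finset.univ.filter fun Ψ => Θ ≤ Ψ)
      (s' := fun Ψ => Finset.univ.filter fun e => InBlock Ψ e ∧ ¬ InBlock Θ e)
      (by intro e Ψ; simp; tauto)]
    have hFTC : ∀ Ψ, Θ ≤ Ψ → ∑ e with InBlock Ψ e ∧ ¬ InBlock Θ e, moebiusWeight Ψ *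
        ∫ t in (0 : ℝ)..τ, W (A + τ • partitionMatrix Θ +
          t • (partitionMatrix Ψ - partitionMatrix Θ)) (D e p) =
        moebiusWeight Ψ * W (A + τ • partitionMatrix Ψ) p -
          moebiusWeight Ψ * W (A + τ • partitionMatrix Θ) p := by
      intro Ψ hΨ
      have hc : ∀ q, Continuous fun t : ℝ => W (A + τ • partitionMatrix Θ +
          t • (partitionMatrix Ψ - partitionMatrix Θ)) q := fun q =>
        (hcont _).comp (by fun_prop)
      rw [← Finset.mul_sum, ← intervalIntegral.integral_finsetSum fun e _ =>
          (hc _).intervalIntegrable _ _,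
        intervalIntegral.integral_eq_sub_of_hasDerivAt (fun t _ => hderiv p _ Θ Ψ hΨ t)
          ((continuous_finsetSum _ fun e _ => hc _).intervalIntegrable _ _), ← mul_sub]
      congr 3
      · congr 1
        module
      · simp
    -- The lower boundary term does not depend on `Ψ`, so the vanishing sum of Möbius weights
    -- removes it.
    rw [Finset.sum_congr rfl fun Ψ hΨ => hFTC Ψ (Finset.mem_filter.mp hΨ).2,
      Finset.sum_sub_distrib, ← Finset.sum_mul, sum_moebiusWeight hne, zero_mul, sub_zero]

end TreeExpansion

/-! ### Trees and their enumerations -/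

section Enumerations

variable {n : ℕ}

open Classical in
theorem image_Iic_succ {m : ℕ} (e : Fin (m + 1) → Sym2 (Fin n)) (α : Fin m) :
    (Finset.Iic α.succ).image e = insert (e 0) ((Finset.Iic α).image (Fin.tail e)) := by
  ext b
  simp only [Finset.mem_image, Finset.mem_Iic, Finset.mem_insert, Fin.tail]
  rw [Fin.exists_fin_succ]
  simp only [Fin.zero_le, true_and, Fin.succ_le_succ_iff, eq_comm]

open Classical in
theorem image_Iio_succ {m : ℕ} (e : Fin (m + 1) → Sym2 (Fin n)) (α : Fin m) :
    (Finset.Iio α.succ).image e = insert (e 0) ((Finset.Iio α).image (Fin.tail e)) := by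
  ext b
  simp only [Finset.mem_image, Finset.mem_Iio, Finset.mem_insert, Fin.tail]
  rw [Fin.exists_fin_succ]
  simp only [Fin.succ_pos, true_and, Fin.succ_lt_succ_iff, eq_comm]

open Classical in
theorem image_univ_succ {m : ℕ} (e : Fin (m + 1) → Sym2 (Fin n)) :
    Finset.univ.image e = insert (e 0) (Finset.univ.image (Fin.tail e)) := by
  ext b
  simp only [Finset.mem_image, Finset.mem_univ, Finset.mem_insert, Fin.tail, true_and]
  rw [Fin.exists_fin_succ]
  simp only [eq_comm]

open Classical in
-- Summation by parts: the recursion weights partitions by time differences, which shows positivity;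
-- the definition of the measure weights differences of partitions by times.
theorem pathMatrix_eq (m : ℕ) (Θ : Setoid (Fin n)) (τ : ℝ) (e : Fin m → Sym2 (Fin n))
    (t : Fin m → ℝ) :
    pathMatrix m Θ τ e t = τ • partitionMatrix Θ + ∑ α, t α •
      (partitionMatrix (bondJoin ((Finset.Iic α).image e) Θ) -
        partitionMatrix (bondJoin ((Finset.Iio α).image e) Θ)) := by
  induction m generalizing Θ τ with
  | zero => simp [pathMatrix]
  | succ m ih =>
    rw [pathMatrix, ih, Fin.sum_univ_succ]
    have h0 : (Finset.Iic (0 : Fin (m + 1))).image e = {e 0} := by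
      ext b; simp [eq_comm]
    have h1 : (Finset.Iio (0 : Fin (m + 1))).image e = ∅ := by
      ext b; simp
    simp only [image_Iic_succ, image_Iio_succ, bondJoin_insert, h0, h1, bondJoin_empty]
    simp only [Fin.tail]
    module

theorem blockCount_pos_iff {Θ : Setoid (Fin n)} : 0 < blockCount Θ ↔ 0 < n := by
  refine ⟨fun h => ?_, fun h => blockCount_pos h Θ⟩
  rcases Nat.eq_zero_or_pos n with rfl | hn
  · rw [blockCount, Nat.card_eq_zero.mpr (Or.inl inferInstance)] at h
    exact absurd h (lt_irrefl 0)
  · exact hn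

/-- A bond inside a block could be dropped, leaving too few bonds to connect all blocks. -/
theorem not_inBlock_of_mem {Γ : Finset (Sym2 (Fin n))} {Θ : Setoid (Fin n)}
    (htop : bondJoin Γ Θ = ⊤) (hcard : Γ.card + 1 = blockCount Θ) {e : Sym2 (Fin n)} (he : e ∈ Γ) :
    ¬ InBlock Θ e := by
  classical
  intro h
  rw [← Finset.insert_erase he, bondJoin_insert, bondJoin_singleton_of_inBlock h] at htop
  have h1 := blockCount_le_add_card (Γ.erase e) Θ
  have hn : 0 < n := (blockCount_pos_iff (Θ := Θ)).mp (by omega)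
  rw [htop, blockCount_top hn, Finset.card_erase_of_mem he] at h1
  have := Finset.card_pos.mpr ⟨e, he⟩
  omega

/-- A diagonal pair lies inside a block, so nondegeneracy of the bonds follows from the count. -/
theorem mem_trees_iff {Θ : Setoid (Fin n)} {Γ : Finset (Sym2 (Fin n))} :
    Γ ∈ trees Θ ↔ bondJoin Γ Θ = ⊤ ∧ Γ.card + 1 = blockCount Θ := by
  classical
  simp only [trees, Finset.mem_filter, Finset.mem_univ, true_and]
  refine ⟨fun h => h.2, fun h => ⟨fun e he hd => not_inBlock_of_mem h.1 h.2 he ?_, h⟩⟩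
  induction e using Sym2.ind with
  | _ i j =>
    rw [Sym2.mk_isDiag_iff] at hd
    rw [inBlock_mk, hd]

open Classical in
-- With `m` bonds for `m + 1` blocks there is no slack: the bonds connect everything exactly when
-- each one merges two blocks in its turn.
theorem isTreeSeq_iff {m : ℕ} {Θ : Setoid (Fin n)} (hΘ : blockCount Θ = m + 1)
    (e : Fin m → Sym2 (Fin n)) :
    IsTreeSeq m Θ e ↔ bondJoin (Finset.univ.image e) Θ = ⊤ := by
  induction m generalizing Θ with
  | zero => simp [IsTreeSeq, bondJoin_empty, eq_top_of_blockCount_eq_one hΘ]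
  | succ m ih =>
    rw [image_univ_succ, bondJoin_insert, IsTreeSeq]
    by_cases h : InBlock Θ (e 0)
    · simp only [h, not_true_eq_false, false_and, false_iff]
      rw [bondJoin_singleton_of_inBlock h]
      intro htop
      have h1 := blockCount_le_add_card (Finset.univ.image (Fin.tail e)) Θ
      have hn : 0 < n := (blockCount_pos_iff (Θ := Θ)).mp (by omega)
      rw [htop, blockCount_top hn] at h1
      have h2 : (Finset.univ.image (Fin.tail e)).card ≤ m := by
        simpa using Finset.card_image_le (s := Finset.univ) (f := Fin.tail e)
      omega
    · have := blockCount_bondJoin h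
      rw [ih (by omega)]
      simp [h]

open Classical in
theorem IsTreeSeq.card_image {m : ℕ} {Θ : Setoid (Fin n)} (hΘ : blockCount Θ = m + 1)
    {e : Fin m → Sym2 (Fin n)} (he : IsTreeSeq m Θ e) : (Finset.univ.image e).card = m := by
  have h1 := blockCount_le_add_card (Finset.univ.image e) Θ
  have hn : 0 < n := (blockCount_pos_iff (Θ := Θ)).mp (by omega)
  rw [(isTreeSeq_iff hΘ e).mp he, blockCount_top hn] at h1
  have h2 : (Finset.univ.image e).card ≤ m := by
    simpa using Finset.card_image_le (s := Finset.univ) (f := e)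
  omega

open Classical in
/-- Summation over trees and their enumerations is summation over tree sequences. -/
theorem sum_trees_sum_equiv {m : ℕ} {Θ : Setoid (Fin n)} (hΘ : blockCount Θ = m + 1)
    (G : (m : ℕ) → (Fin m → Sym2 (Fin n)) → ℝ) :
    ∑ Γ ∈ trees Θ, ∑ e : Fin Γ.card ≃ Γ, G Γ.card (fun α => e α) =
      ∑ e with IsTreeSeq m Θ e, G m e := by
  rw [← Finset.sum_fiberwise_of_maps_to (s := Finset.univ.filter fun e => IsTreeSeq m Θ e)
    (t := trees Θ) (g := fun e => Finset.univ.image e)]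
  · refine Finset.sum_congr rfl fun Γ hΓ => ?_
    rw [mem_trees_iff] at hΓ
    obtain rfl : m = Γ.card := by omega
    refine Finset.sum_bij (fun e _ α => (e α : Sym2 (Fin n))) ?_ ?_ ?_ ?_
    · intro e _
      have himg : Finset.univ.image (fun α => (e α : Sym2 (Fin n))) = Γ := by
        ext b
        simp only [Finset.mem_image, Finset.mem_univ, true_and]
        refine ⟨?_, fun hb => ⟨e.symm ⟨b, hb⟩, by simp⟩⟩
        rintro ⟨α, rfl⟩
        exact (e α).2
      simp only [Finset.mem_filter, Finset.mem_univ, true_and]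
      exact ⟨(isTreeSeq_iff hΘ _).mpr (by rw [himg]; exact hΓ.1), himg⟩
    · intro e _ e' _ h
      exact Equiv.ext fun α => Subtype.ext (congrFun h α)
    · intro e he
      simp only [Finset.mem_filter, Finset.mem_univ, true_and] at he
      have hinj : Function.Injective e := by
        have := Finset.card_image_iff.mp ((he.1.card_image hΘ).trans (by simp) :
          (Finset.univ.image e).card = (Finset.univ : Finset (Fin Γ.card)).card)
        simpa using this
      let f : Fin Γ.card → Γ := fun α => ⟨e α, by
        rw [← he.2]; exact Finset.mem_image_of_mem e (Finset.mem_univ α)⟩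
      have hf : Function.Bijective f := by
        rw [Fintype.bijective_iff_injective_and_card]
        exact ⟨fun a b hab => hinj (congrArg Subtype.val hab), by simp⟩
      exact ⟨Equiv.ofBijective f hf, Finset.mem_univ _, rfl⟩
    · intro e _
      rfl
  · intro e he
    simp only [Finset.mem_filter, Finset.mem_univ, true_and] at he
    rw [mem_trees_iff, he.card_image hΘ]
    exact ⟨(isTreeSeq_iff hΘ e).mp he, hΘ.symm⟩

theorem seqOperator_smul {V : Type*} [AddCommGroup V] [Module ℝ V]
    (D : Sym2 (Fin n) → Module.End ℝ V) (c : Sym2 (Fin n) → ℝ) (m : ℕ)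
    (e : Fin m → Sym2 (Fin n)) :
    seqOperator (fun e => c e • D e) m e = (∏ α, c (e α)) • seqOperator D m e := by
  induction m with
  | zero => simp [seqOperator]
  | succ m ih =>
    rw [seqOperator, seqOperator, ih, Fin.prod_univ_succ, smul_mul_smul_comm, mul_comm (c (e 0))]
    rfl

theorem treeOperator_insert (N : ℕ) [DecidableEq (Sym2 (Fin n))] {Γ : Finset (Sym2 (Fin n))}
    {e : Sym2 (Fin n)} (he : e ∉ Γ) :
    treeOperator N (insert e Γ) = treeOperator N Γ * bondOperator N e :=
  Finset.noncommProd_insert_of_notMem' Γ e (bondOperator N)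
    (fun e _ e' _ _ => bondOperator_commute N e e') he

open Classical in
theorem seqOperator_bondOperator (N : ℕ) {m : ℕ} {e : Fin m → Sym2 (Fin n)}
    (he : Function.Injective e) :
    seqOperator (bondOperator N) m e = treeOperator N (Finset.univ.image e) := by
  induction m with
  | zero => simp [seqOperator, treeOperator]
  | succ m ih =>
    have hne : e 0 ∉ Finset.univ.image (Fin.tail e) := by
      simp only [Finset.mem_image, Finset.mem_univ, true_and, not_exists]
      intro α hα
      exact absurd (he hα) (Fin.succ_ne_zero α)
    rw [seqOperator, ih (e := Fin.tail e) fun a b hab => Fin.succ_injective _ (he hab),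
      image_univ_succ, treeOperator_insert N hne]

end Enumerations

/-! ### The tree expansion for recoupled Gaussian families -/

section Recoupling

variable {n : ℕ}

theorem integral_mul_normalFamily (a b : ℕ × ℕ) :
    ∫ ξ, ξ a * ξ b ∂normalFamily = if a = b then 1 else 0 := by
  split_ifs with hab
  · subst hab
    have h1 := (hasLaw_normalFamily a).integral_comp (f := fun x : ℝ => x ^ (1 + 1)) (by fun_prop)
    rw [integral_pow_succ_gaussianReal] at h1
    simpa [Function.comp_def, ← sq] using h1
  · have hind : IndepFun (fun ξ : ℕ × ℕ → ℝ => ξ a) (fun ξ => ξ b) normalFamily :=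
      iIndepFun_normalFamily.indepFun hab
    rw [hind.integral_fun_mul_eq_mul_integral (measurable_pi_apply a).aestronglyMeasurable
      (measurable_pi_apply b).aestronglyMeasurable]
    have h1 := (hasLaw_normalFamily a).integral_comp (f := fun x : ℝ => x) (by fun_prop)
    rw [integral_id_gaussianReal] at h1
    simp only [Function.comp_def] at h1
    rw [h1, zero_mul]

/-- The covariances of the Gaussian family `ζ^h ⋆ Q`. -/
noncomputable def pathCov (N : ℕ) (h : Fin n → ℕ) (Q : Fin n → Fin n → ℝ) :
    Var n N → Var n N → ℝ :=
  fun p q => Q p.1 q.1 * if h p.1 = h q.1 ∧ p.2 = q.2 then 1 else 0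

theorem recoupledLaw_pathGaussian (N : ℕ) (h : Fin n → ℕ) (Q : Fin n → Fin n → ℝ) :
    recoupledLaw normalFamily (pathGaussian N h) Q =
      multivariateGaussian 0 (Matrix.of (pathCov N h Q)) := by
  rw [recoupledLaw]
  congr 1
  ext p q
  simp [pathCov, pathGaussian, integral_mul_normalFamily, Fin.ext_iff]

theorem pathCov_add_smul (N : ℕ) (h : Fin n → ℕ) (A B : Fin n → Fin n → ℝ) (t : ℝ) :
    pathCov N h (A + t • B) = pathCov N h A + t • pathCov N h B := by
  ext p q
  simp only [pathCov, Pi.add_apply, Pi.smul_apply, smul_eq_mul]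
  ring

theorem continuous_pathCov (N : ℕ) (h : Fin n → ℕ) : Continuous (pathCov N h) := by
  unfold pathCov
  fun_prop

/-- The matrix of a kernel relation is positive semidefinite. -/
theorem posSemidef_ite_eq {α β : Type*} [Fintype α] [DecidableEq β] (f : α → β) :
    (Matrix.of fun a b => if f a = f b then (1 : ℝ) else 0).PosSemidef := by
  classical
  convert Matrix.posSemidef_self_mul_conjTranspose
    (Matrix.of fun (a : α) (c : Set.range f) => if f a = c then (1 : ℝ) else 0) using 1
  ext a b
  simp only [Matrix.of_apply, Matrix.mul_apply, Matrix.conjTranspose_apply]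
  rw [Finset.sum_eq_single ⟨f a, a, rfl⟩]
  · simp [eq_comm]
  · intro c _ hc
    rw [if_neg, zero_mul]
    exact fun hac => hc (Subtype.ext hac.symm)
  · simp

theorem posSemidef_pathCov_partitionMatrix (N : ℕ) (h : Fin n → ℕ) (Ψ : Setoid (Fin n)) :
    (Matrix.of (pathCov N h (partitionMatrix Ψ))).PosSemidef := by
  classical
  convert posSemidef_ite_eq fun p : Var n N => (Quotient.mk Ψ p.1, h p.1, p.2) using 1
  ext p q
  simp only [Matrix.of_apply, pathCov, partitionMatrix, Prod.mk.injEq, Quotient.eq]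
  split_ifs <;> simp_all

/-- On the simplex the coefficients `τ - t_1`, `t_1 - t_2`, … are nonnegative, and each partition
matrix gives a semidefinite covariance. -/
theorem posSemidef_pathCov_pathMatrix (N : ℕ) (h : Fin n → ℕ) {m : ℕ} (Θ : Setoid (Fin n)) {τ : ℝ}
    (hτ : 0 ≤ τ) (e : Fin m → Sym2 (Fin n)) {t : Fin m → ℝ} (ht : t ∈ scaledSimplex m τ) :
    (Matrix.of (pathCov N h (pathMatrix m Θ τ e t))).PosSemidef := by
  induction m generalizing Θ τ with
  | zero =>
    convert (posSemidef_pathCov_partitionMatrix N h Θ).smul hτ using 1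
    ext p q
    simp [pathCov, pathMatrix]
  | succ m ih =>
    rw [mem_scaledSimplex_succ] at ht
    convert ((posSemidef_pathCov_partitionMatrix N h Θ).smul (sub_nonneg.mpr ht.1.2.le)).add
      (ih (bondJoin {e 0} Θ) ht.1.1.le (Fin.tail e) ht.2) using 1
    ext p q
    simp only [pathCov, pathMatrix, Matrix.add_apply, Matrix.smul_apply, Matrix.of_apply,
      Pi.add_apply, Pi.smul_apply, smul_eq_mul]
    ring

/-- Supplies the measurability needed to pull an almost-everywhere statement back through the
interpolation map. -/
theorem isClosed_posSemidef {α : Type*} [Fintype α] :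
    IsClosed {A : Matrix α α ℝ | A.PosSemidef} := by
  have : {A : Matrix α α ℝ | A.PosSemidef} = {A | A.conjTranspose = A} ∩
      ⋂ x : α → ℝ, {A | 0 ≤ star x ⬝ᵥ (A.mulVec x)} := by
    ext A
    simp [Matrix.posSemidef_iff_dotProduct_mulVec, Matrix.IsHermitian]
  rw [this]
  refine (isClosed_eq (by fun_prop) continuous_id).inter (isClosed_iInter fun x => ?_)
  exact isClosed_le continuous_const (by fun_prop)

/-- A function of unordered pairs vanishing on the diagonal, summed over ordered pairs. -/
theorem sum_sum_sym2 {α M : Type*} [Fintype α] [DecidableEq α] [AddCommMonoid M] (g : Sym2 α → M)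
    (hg : ∀ e, e.IsDiag → g e = 0) : ∑ i, ∑ j, g s(i, j) = ∑ e, 2 • g e := by
  rw [← Fintype.sum_prod_type' (f := fun i j => g s(i, j)),
    ← Finset.sum_fiberwise Finset.univ fun x : α × α => s(x.1, x.2)]
  refine Finset.sum_congr rfl fun e _ => ?_
  induction e using Sym2.ind with
  | _ i j =>
    by_cases hij : i = j
    · rw [hg _ (Sym2.mk_isDiag_iff.mpr hij), smul_zero]
      refine Finset.sum_eq_zero fun x hx => ?_
      rw [(Finset.mem_filter.mp hx).2]
      exact hg _ (Sym2.mk_isDiag_iff.mpr hij)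
    · have : (Finset.univ.filter fun x : α × α => s(x.1, x.2) = s(i, j)) = {(i, j), (j, i)} := by
        ext x
        simp only [Finset.mem_filter, Finset.mem_univ, true_and, Finset.mem_insert,
          Finset.mem_singleton, Sym2.eq_iff, Prod.ext_iff]
      rw [this, Finset.sum_pair (by simp [hij]), Sym2.eq_swap, two_smul]

open Classical in
/-- The Kronecker factor of a bond. -/
noncomputable def bondDelta (h : Fin n → ℕ) (e : Sym2 (Fin n)) : ℝ :=
  if ∀ i ∈ e, ∀ i' ∈ e, h i = h i' then 1 else 0

theorem bondDelta_mk (h : Fin n → ℕ) (i j : Fin n) :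
    bondDelta h s(i, j) = if h i = h j then 1 else 0 := by
  simp only [bondDelta, Sym2.mem_iff, forall_eq_or_imp, forall_eq, true_and, and_true]
  congr 1
  exact propext ⟨fun h => h.1, fun h => ⟨h, h.symm⟩⟩

open Classical in
-- The entries of `[Ψ] - [Θ]` mark the pairs joined by `Ψ` but not by `Θ`. Each bond occurs as two
-- ordered pairs, absorbing the factor `½`, and the covariance of `ζ^h` contributes the Kronecker
-- delta.
theorem laplacian_pathCov (N : ℕ) (h : Fin n → ℕ) {Θ Ψ : Setoid (Fin n)} (hΘΨ : Θ ≤ Ψ)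
    (p : MvPolynomial (Var n N) ℝ) :
    laplacian (pathCov N h (partitionMatrix Ψ - partitionMatrix Θ)) p =
      ∑ e with InBlock Ψ e ∧ ¬ InBlock Θ e, (bondDelta h e • bondOperator N e) p := by
  have h1 := sum_sum_sym2 (fun e : Sym2 (Fin n) => if InBlock Ψ e ∧ ¬ InBlock Θ e then
    (1 / 2 : ℝ) • (bondDelta h e • bondOperator N e) p else 0) (by
      intro e he
      induction e using Sym2.ind with
      | _ i j =>
        rw [Sym2.mk_isDiag_iff] at he
        subst he
        simp [inBlock_mk])
  rw [Finset.sum_filter]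
  refine Eq.trans ?_ (h1.trans ?_)
  · rw [laplacian_apply, Fintype.sum_prod_type]
    refine Finset.sum_congr rfl fun i _ => ?_
    rw [Finset.sum_comm, Fintype.sum_prod_type]
    refine Finset.sum_congr rfl fun i' _ => ?_
    have hB : (partitionMatrix Ψ - partitionMatrix Θ) i i' =
        if InBlock Ψ s(i, i') ∧ ¬ InBlock Θ s(i, i') then 1 else 0 := by
      simp only [Pi.sub_apply, partitionMatrix, inBlock_mk]
      by_cases hΘ : Θ i i'
      · simp [hΘ, hΘΨ hΘ]
      · simp [hΘ]
    simp only [pathCov, hB, bondDelta_mk]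
    split_ifs with hin hh
    · rw [Finset.sum_comm]
      simp [hh, bondOperator, secondDeriv, Finset.smul_sum, ite_div, ite_smul]
    · simp [hh]
    · simp
  · refine Finset.sum_congr rfl fun e _ => ?_
    split_ifs
    · rw [← Nat.cast_smul_eq_nsmul ℝ, smul_smul]
      norm_num
    · simp

open Classical in
-- Brings the term into the shape of the tree expansion with `A = 0` and `τ = 1`, the Kronecker
-- factors being absorbed into the bond operators.
theorem expansionTerm_eq (N : ℕ) (θ : Equiv.Perm (Fin n)) (Γ : Finset (Sym2 (Fin n)))
    (h : Fin n → ℕ) :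
    expansionTerm N θ Γ h = ∑ e : Fin Γ.card ≃ Γ, ∫ t in scaledSimplex Γ.card 1,
      wick (pathCov N h (0 + pathMatrix Γ.card (orbitPartition θ) 1 (fun α => e α) t))
        (seqOperator (fun e => bondDelta h e • bondOperator N e) Γ.card (fun α => e α)
          (pathPolynomial N θ h)) := by
  set q := treeOperator N Γ (pathPolynomial N θ h) with hq
  set Θ := orbitPartition θ
  have hmat : ∀ e : Fin Γ.card ≃ Γ, interpolationMatrix Θ Γ e =
      fun t => pathMatrix Γ.card Θ 1 (fun α => (e α : Sym2 (Fin n))) t := by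
    intro e
    funext t
    rw [pathMatrix_eq, interpolationMatrix, one_smul]
  have hcm : ∀ e : Fin Γ.card ≃ Γ, Continuous (interpolationMatrix Θ Γ e) := by
    intro e
    rw [hmat]
    exact (continuous_pathMatrix Γ.card Θ _).comp (by fun_prop : Continuous fun t => ((1 : ℝ), t))
  have hcw : Continuous fun Q => wick (pathCov N h Q) q :=
    (continuous_wick q).comp (continuous_pathCov N h)
  -- The Gaussian integral is known to be `wick` only for semidefinite covariances, so the equality
  -- is asserted almost everywhere for the interpolation measure.
  have hae : ∀ e : Fin Γ.card ≃ Γ,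
      (fun Q => ∫ x, MvPolynomial.eval (fun p => x p) q
        ∂(recoupledLaw normalFamily (pathGaussian N h) Q)) =ᵐ[
          (volume.restrict (orderedSimplex Γ.card)).map (interpolationMatrix Θ Γ e)]
        fun Q => wick (pathCov N h Q) q := by
    intro e
    have hps : ∀ᵐ Q ∂(volume.restrict (orderedSimplex Γ.card)).map (interpolationMatrix Θ Γ e),
        (Matrix.of (pathCov N h Q)).PosSemidef := by
      refine (ae_map_iff (hcm e).measurable.aemeasurable
        (isClosed_posSemidef.preimage (continuous_pathCov N h)).measurableSet).mpr ?_
      -- `orderedSimplex` is definitionally `scaledSimplex` at scale `1`.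
      refine (ae_restrict_iff' (measurableSet_scaledSimplex _ _)).mpr (ae_of_all _ fun t ht => ?_)
      rw [hmat]
      exact posSemidef_pathCov_pathMatrix N h Θ zero_le_one _ ht
    filter_upwards [hps] with Q hQ
    rw [recoupledLaw_pathGaussian, integral_eval_multivariateGaussian hQ]
    rfl
  have hintegrable : ∀ e : Fin Γ.card ≃ Γ, Integrable (fun Q => wick (pathCov N h Q) q)
      ((volume.restrict (orderedSimplex Γ.card)).map (interpolationMatrix Θ Γ e)) := by
    intro e
    rw [integrable_map_measure hcw.aestronglyMeasurable (hcm e).measurable.aemeasurable]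
    exact integrableOn_scaledSimplex (hcw.comp (hcm e))
  rw [expansionTerm, treeMeasure, integral_finsetSum_measure fun e _ =>
    (hintegrable e).congr (hae e).symm, Finset.mul_sum]
  refine Finset.sum_congr rfl fun e _ => ?_
  rw [integral_congr_ae (hae e), integral_map (hcm e).measurable.aemeasurable
    hcw.aestronglyMeasurable, ← integral_const_mul]
  refine integral_congr_ae (ae_of_all _ fun t => ?_)
  have himg : Finset.univ.image (fun α => (e α : Sym2 (Fin n))) = Γ := by
    ext b
    simp only [Finset.mem_image, Finset.mem_univ, true_and]
    refine ⟨?_, fun hb => ⟨e.symm ⟨b, hb⟩, by simp⟩⟩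
    rintro ⟨α, rfl⟩
    exact (e α).2
  have hop := seqOperator_bondOperator N (e := fun α => (e α : Sym2 (Fin n)))
    (Subtype.val_injective.comp e.injective)
  rw [himg] at hop
  have hprod : ∏ b ∈ Γ, bondDelta h b = ∏ α, bondDelta h (e α) := by
    rw [← Finset.prod_coe_sort Γ, ← e.prod_comp fun b : Γ => bondDelta h b]
  simp only [seqOperator_smul, hop, zero_add, LinearMap.smul_apply, map_smul, smul_eq_mul, hmat,
    ← hprod]
  rfl

open Classical in
theorem sum_trees_expansionTerm (N : ℕ) (hn : 0 < n) (θ : Equiv.Perm (Fin n)) (h : Fin n → ℕ) :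
    ∑ Γ ∈ trees (orbitPartition θ), expansionTerm N θ Γ h =
      ∑ Ψ with orbitPartition θ ≤ Ψ,
        moebiusWeight Ψ * wick (pathCov N h (partitionMatrix Ψ)) (pathPolynomial N θ h) := by
  obtain ⟨m, hm⟩ := Nat.exists_eq_add_of_le' (blockCount_pos hn (orbitPartition θ))
  have h1 := sum_isTreeSeq_integral (fun e => bondDelta h e • bondOperator N e)
    (fun Q => wick (pathCov N h Q)) (fun p => (continuous_wick p).comp (continuous_pathCov N h))
    (by
      intro p A Θ Ψ hΘΨ t
      simp only [pathCov_add_smul]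
      rw [← map_sum, ← laplacian_pathCov N h hΘΨ]
      exact hasDerivAt_wick p _ _ t) m (orbitPartition θ) hm 0 zero_le_one (pathPolynomial N θ h)
  rw [← sum_trees_sum_equiv hm (fun m e => ∫ t in scaledSimplex m 1,
    wick (pathCov N h (0 + pathMatrix m (orbitPartition θ) 1 e t))
      (seqOperator (fun e => bondDelta h e • bondOperator N e) m e (pathPolynomial N θ h)))] at h1
  simp only [expansionTerm_eq]
  rw [h1]
  simp only [one_smul, zero_add]

end Recoupling

/-! ### Vanishing terms -/

section Vanishing

open MvPolynomial

/-- Strict bounds `a + 1` and `b + 1` encode weights at most `a` and `b`, which add. -/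
theorem mul_mem_lowWeight {σ K : Type*} [CommRing K] {w : σ → ℕ} {a b : ℕ}
    {p q : MvPolynomial σ K} (hp : p ∈ lowWeight w (a + 1)) (hq : q ∈ lowWeight w (b + 1)) :
    p * q ∈ lowWeight w (a + b + 1) := by
  classical
  rw [mem_lowWeight] at *
  intro m hm
  rw [coeff_mul] at hm
  obtain ⟨x, hx, hx0⟩ := Finset.exists_ne_zero_of_sum_ne_zero hm
  rw [Finset.HasAntidiagonal.mem_antidiagonal] at hx
  have h1 := hp x.1 (left_ne_zero_of_mul hx0)
  have h2 := hq x.2 (right_ne_zero_of_mul hx0)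
  rw [← hx, map_add]
  omega

theorem one_mem_lowWeight {σ K : Type*} [CommRing K] (w : σ → ℕ) :
    (1 : MvPolynomial σ K) ∈ lowWeight w 1 := by
  classical
  rw [mem_lowWeight]
  intro m hm
  rw [coeff_one] at hm
  have : 0 = m := by by_contra h; simp [h] at hm
  subst this
  simp

theorem X_mem_lowWeight {σ K : Type*} [CommRing K] (w : σ → ℕ) (a : σ) :
    (X a : MvPolynomial σ K) ∈ lowWeight w (w a + 1) := by
  classical
  rw [mem_lowWeight]
  intro m hm
  rw [coeff_X] at hm
  have : Finsupp.single a 1 = m := by by_contra h; simp [h] at hm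
  subst this
  simp [Finsupp.weight_single]

theorem prod_mem_lowWeight {σ K ι : Type*} [CommRing K] {w : σ → ℕ} (s : Finset ι) (b : ι → ℕ)
    (p : ι → MvPolynomial σ K) (hp : ∀ i ∈ s, p i ∈ lowWeight w (b i + 1)) :
    ∏ i ∈ s, p i ∈ lowWeight w (∑ i ∈ s, b i + 1) := by
  classical
  induction s using Finset.induction_on with
  | empty => simpa using one_mem_lowWeight w
  | insert i s hi ih =>
    rw [Finset.prod_insert hi, Finset.sum_insert hi]
    exact mul_mem_lowWeight (hp i (Finset.mem_insert_self i s))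
      (ih fun j hj => hp j (Finset.mem_insert_of_mem hj))

variable {n : ℕ}

theorem pathPolynomial_mem_lowWeight {N : ℕ} {θ : Equiv.Perm (Fin n)} {h : Fin n → ℕ}
    {w : Var n N → ℕ} {b₀ b₁ : Fin n → ℕ} (h₀ : ∀ i ∈ stepSet θ h 0, w (i, 0) ≤ b₀ i)
    (h₁ : ∀ i ∈ stepSet θ h 1, ∀ j : Fin (2 * N + 1), 1 ≤ j.val → w (i, j) ≤ b₁ i) :
    pathPolynomial N θ h ∈
      lowWeight w (∑ i ∈ stepSet θ h 0, b₀ i + ∑ i ∈ stepSet θ h 1, 2 * b₁ i + 1) := by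
  refine mul_mem_lowWeight (prod_mem_lowWeight _ _ _ fun i hi => ?_)
    (prod_mem_lowWeight _ _ _ fun i hi => ?_)
  · exact lowWeight_mono (Nat.succ_le_succ (h₀ i hi)) (X_mem_lowWeight w _)
  · refine Submodule.sum_mem _ fun j hj => ?_
    rw [← smul_eq_C_mul, sq]
    refine Submodule.smul_mem _ _ (lowWeight_mono ?_ (mul_mem_lowWeight (X_mem_lowWeight w _)
      (X_mem_lowWeight w _)))
    have := h₁ i hi j (Finset.mem_filter.mp hj).2.1
    omega

theorem pderiv_pathPolynomial_eq_zero {N : ℕ} {θ : Equiv.Perm (Fin n)} {h : Fin n → ℕ}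
    {i : Fin n} {j : Fin (2 * N + 1)} (h₀ : i ∈ stepSet θ h 0 → j ≠ 0)
    (h₁ : i ∈ stepSet θ h 1 → j = 0) : pderiv (i, j) (pathPolynomial N θ h) = 0 := by
  classical
  have h1 := pathPolynomial_mem_lowWeight (N := N) (θ := θ) (h := h)
    -- Weighting only the variable `z_{ij}` shows that it does not occur in the polynomial.
    (w := fun a => if a = (i, j) then 1 else 0) (b₀ := 0) (b₁ := 0) (by
      intro a ha
      by_cases hai : a = i
      · subst hai
        simp [(h₀ ha).symm]
      · simp [hai]) (by
      intro a ha k hk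
      by_cases hai : a = i
      · subst hai
        have := h₁ ha
        have hkj : k ≠ j := by rintro rfl; simp [this] at hk
        simp [hkj]
      · simp [hai])
  have h2 := pderiv_mem_lowWeight (a := (i, j)) h1
  refine eq_zero_of_mem_lowWeight_zero (lowWeight_mono ?_ h2)
  simp

/-- Row `i` involves only column `0` if `i ∈ J_h(0)`, only columns `≥ 1` if `i ∈ J_h(1)`, and
nothing otherwise. A bond operator differentiates both rows in the same column, so its endpoints
must be of the same kind. -/
theorem bondOperator_pathPolynomial_eq_zero {N : ℕ} {θ : Equiv.Perm (Fin n)} {h : Fin n → ℕ}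
    {e : Sym2 (Fin n)}
    (he : ¬ ((∀ i ∈ e, i ∈ stepSet θ h 0) ∨ (∀ i ∈ e, i ∈ stepSet θ h 1))) :
    bondOperator N e (pathPolynomial N θ h) = 0 := by
  induction e using Sym2.ind with
  | _ i i' =>
    simp only [Sym2.mem_iff, forall_eq_or_imp, forall_eq] at he
    simp only [bondOperator, Sym2.lift_mk, LinearMap.sum_apply]
    refine Finset.sum_eq_zero fun j _ => ?_
    have hdis : ∀ a : Fin n, a ∈ stepSet θ h 0 → a ∈ stepSet θ h 1 → False := by
      intro a h0 h1
      simp only [stepSet, Finset.mem_filter, Finset.mem_univ, true_and] at h0 h1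
      omega
    change pderiv (i, j) (pderiv (i', j) (pathPolynomial N θ h)) = 0
    by_cases hi : (i ∈ stepSet θ h 0 → j ≠ 0) ∧ (i ∈ stepSet θ h 1 → j = 0)
    · rw [pderiv_comm, pderiv_pathPolynomial_eq_zero hi.1 hi.2, map_zero]
    · rw [pderiv_pathPolynomial_eq_zero (i := i') (j := j) _ _, map_zero]
      · intro h0 hj
        by_cases h' : i ∈ stepSet θ h 0
        · exact he (Or.inl ⟨h', h0⟩)
        · exact hi ⟨fun h'' => absurd h'' h', fun _ => hj⟩
      · intro h1
        by_contra hj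
        by_cases h' : i ∈ stepSet θ h 1
        · exact he (Or.inr ⟨h', h1⟩)
        · exact hi ⟨fun _ => hj, fun h'' => absurd h'' h'⟩

theorem treeOperator_eq_zero_of_mem {N : ℕ} {Γ : Finset (Sym2 (Fin n))} {e : Sym2 (Fin n)}
    (he : e ∈ Γ) {p : MvPolynomial (Var n N) ℝ} (hp : bondOperator N e p = 0) :
    treeOperator N Γ p = 0 := by
  classical
  rw [← Finset.insert_erase he, treeOperator_insert N (Finset.notMem_erase e Γ)]
  simp [hp]

/-- The weight counting the variables of the row `i`. -/
def rowWeight {N : ℕ} (i : Fin n) (a : Var n N) : ℕ := if a.1 = i then 1 else 0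

theorem bondOperator_mem_lowWeight {N : ℕ} {i : Fin n} {e : Sym2 (Fin n)} {d : ℕ}
    {p : MvPolynomial (Var n N) ℝ} (hp : p ∈ lowWeight (rowWeight i) d) :
    bondOperator N e p ∈ lowWeight (rowWeight i) (d - if i ∈ e then 1 else 0) := by
  induction e using Sym2.ind with
  | _ k l =>
    simp only [bondOperator, Sym2.lift_mk, LinearMap.sum_apply]
    refine Submodule.sum_mem _ fun j _ => lowWeight_mono ?_
      (pderiv_mem_lowWeight (a := (k, j)) (pderiv_mem_lowWeight (a := (l, j)) hp))
    simp only [rowWeight, Sym2.mem_iff]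
    split_ifs with h1 h2 h3 <;> grind

/-- Every bond at `i` takes at least one degree away from row `i`. -/
theorem treeOperator_mem_lowWeight {N : ℕ} {i : Fin n} (Γ : Finset (Sym2 (Fin n))) {d : ℕ}
    {p : MvPolynomial (Var n N) ℝ} (hp : p ∈ lowWeight (rowWeight i) d) :
    treeOperator N Γ p ∈ lowWeight (rowWeight i) (d - (Γ.filter fun e => i ∈ e).card) := by
  classical
  induction Γ using Finset.induction_on generalizing d p with
  | empty => exact hp
  | insert e Γ he ih =>
    rw [treeOperator_insert N he, Module.End.mul_apply]
    refine lowWeight_mono (le_of_eq ?_) (ih (bondOperator_mem_lowWeight (e := e) hp))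
    rw [Finset.filter_insert]
    split_ifs with h
    · rw [Finset.card_insert_of_notMem (fun h' => he (Finset.mem_filter.mp h').1)]
      omega
    · simp

theorem expansionTerm_eq_zero_of_treeOperator {N : ℕ} {θ : Equiv.Perm (Fin n)}
    {Γ : Finset (Sym2 (Fin n))} {h : Fin n → ℕ}
    (hz : treeOperator N Γ (pathPolynomial N θ h) = 0) : expansionTerm N θ Γ h = 0 := by
  simp [expansionTerm, hz]

theorem expansionTerm_eq_zero {N : ℕ} {θ : Equiv.Perm (Fin n)}
    {Γ : Finset (Sym2 (Fin n))} {h : Fin n → ℕ}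
    (hcond : ¬ ((∀ e ∈ Γ, ∀ i ∈ e, ∀ i' ∈ e, h i = h i') ∧
      (∀ e ∈ Γ, (∀ i ∈ e, i ∈ stepSet θ h 0) ∨ (∀ i ∈ e, i ∈ stepSet θ h 1)) ∧
      (∀ i ∈ stepSet θ h 0, (Γ.filter fun e => i ∈ e).card ≤ 1) ∧
      (∀ i : Fin n, (Γ.filter fun e => i ∈ e).card ≤ 2))) :
    expansionTerm N θ Γ h = 0 := by
  classical
  have hrow : ∀ (i : Fin n) (d : ℕ), pathPolynomial N θ h ∈ lowWeight (rowWeight i) d →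
      d ≤ (Γ.filter fun e => i ∈ e).card → expansionTerm N θ Γ h = 0 := by
    intro i d hd hle
    refine expansionTerm_eq_zero_of_treeOperator (eq_zero_of_mem_lowWeight_zero
      (lowWeight_mono ?_ (treeOperator_mem_lowWeight Γ hd)))
    omega
  -- The degree of `f^h` in row `i` is at most `1` on `J_h(0)`, `2` on `J_h(1)` and `0` elsewhere;
  -- the final `+ 1` makes the bound strict.
  have hlow : ∀ i : Fin n, pathPolynomial N θ h ∈ lowWeight (rowWeight i)
      ((if i ∈ stepSet θ h 0 then 1 else 0) + (if i ∈ stepSet θ h 1 then 2 else 0) + 1) := by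
    intro i
    convert pathPolynomial_mem_lowWeight (N := N) (θ := θ) (h := h) (w := rowWeight i)
      (b₀ := fun a => if a = i then 1 else 0) (b₁ := fun a => if a = i then 1 else 0)
      (fun a _ => le_rfl) (fun a _ j _ => le_rfl) using 3
    simp
  by_contra hne
  refine hcond ⟨?_, ?_, ?_, ?_⟩
  · intro e he
    by_contra hc
    exact hne (by rw [expansionTerm, Finset.prod_eq_zero he (if_neg hc), zero_mul])
  · intro e he
    by_contra hc
    exact hne (expansionTerm_eq_zero_of_treeOperator
      (treeOperator_eq_zero_of_mem he (bondOperator_pathPolynomial_eq_zero hc)))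
  · intro i hi
    by_contra hc
    refine hne (hrow i _ (hlow i) ?_)
    have : i ∉ stepSet θ h 1 := by
      simp only [stepSet, Finset.mem_filter, Finset.mem_univ, true_and] at hi ⊢
      omega
    rw [if_pos hi, if_neg this]
    omega
  · intro i
    by_contra hc
    refine hne (hrow i _ (hlow i) ?_)
    have : ¬ (i ∈ stepSet θ h 0 ∧ i ∈ stepSet θ h 1) := by
      simp only [stepSet, Finset.mem_filter, Finset.mem_univ, true_and]
      omega
    split_ifs <;> grind

end Vanishing

/-! ### Traces of powers and orbits -/

section Orbits

open Matrix

variable {n : ℕ}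

/-- An arbitrary function `F` of the endpoints lets the last step be absorbed into it, which closes
the induction; `F a b = M b a` later closes the walk. -/
theorem sum_prod_walk {ν : Type*} [Fintype ν] [DecidableEq ν] (M : Matrix ν ν ℝ) (k : ℕ)
    (F : ν → ν → ℝ) :
    ∑ g : Fin (k + 1) → ν, (∏ s : Fin k, M (g s.castSucc) (g s.succ)) * F (g 0) (g (Fin.last k)) =
      ∑ a, ∑ b, (M ^ k) a b * F a b := by
  induction k generalizing F with
  | zero =>
    rw [← (Equiv.funUnique (Fin 1) ν).symm.sum_comp]
    simp [Matrix.one_apply]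
  | succ k ih =>
    have h1 := ih fun a c => ∑ b, M c b * F a b
    rw [← (Fin.snocEquiv fun _ : Fin (k + 2) => ν).sum_comp, Fintype.sum_prod_type,
      Finset.sum_comm]
    refine Eq.trans ?_ (h1.trans ?_)
    · refine Finset.sum_congr rfl fun g _ => ?_
      rw [Finset.mul_sum]
      refine Finset.sum_congr rfl fun b _ => ?_
      rw [Fin.prod_univ_castSucc]
      simp only [Fin.snocEquiv_apply, Fin.snoc_castSucc, Fin.succ_last, Fin.snoc_last,
        ← Fin.castSucc_succ]
      have h0 : (Fin.snoc g b : Fin (k + 2) → ν) 0 = g 0 := by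
        rw [← Fin.castSucc_zero]
        exact Fin.snoc_castSucc (α := fun _ => ν) b g 0
      rw [h0]
      ring
    · refine Finset.sum_congr rfl fun a _ => ?_
      simp only [pow_succ, Matrix.mul_apply, Finset.mul_sum, Finset.sum_mul]
      rw [Finset.sum_comm]
      simp only [mul_assoc]

/-- Addition in `Fin (k + 1)` is cyclic, so `s = k` gives the closing step. -/
theorem trace_pow_succ_eq_sum {ν : Type*} [Fintype ν] [DecidableEq ν] (M : Matrix ν ν ℝ) (k : ℕ) :
    trace (M ^ (k + 1)) = ∑ g : Fin (k + 1) → ν, ∏ s, M (g s) (g (s + 1)) := by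
  have h1 := sum_prod_walk M k fun a b => M b a
  have h2 : trace (M ^ (k + 1)) = ∑ a, ∑ b, (M ^ k) a b * M b a := by
    simp [trace, pow_succ, Matrix.mul_apply]
  rw [h2, ← h1]
  refine Finset.sum_congr rfl fun g _ => ?_
  rw [Fin.prod_univ_castSucc]
  simp [Fin.coeSucc_eq_succ]

theorem mk_apply_eq (θ : Equiv.Perm (Fin n)) (i : Fin n) :
    Quotient.mk (orbitPartition θ) (θ i) = Quotient.mk (orbitPartition θ) i :=
  Quotient.sound (Equiv.Perm.sameCycle_apply_left.mpr (Equiv.Perm.SameCycle.refl θ i))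

/-- The elements of an orbit. -/
abbrev Orbit (θ : Equiv.Perm (Fin n)) (O : Quotient (orbitPartition θ)) : Type :=
  {i : Fin n // Quotient.mk (orbitPartition θ) i = O}

/-- The permutation acting on an orbit. -/
def orbitNext (θ : Equiv.Perm (Fin n)) {O : Quotient (orbitPartition θ)} (i : Orbit θ O) :
    Orbit θ O := ⟨θ i, (mk_apply_eq θ i).trans i.2⟩

/-- Powers of `θ` applied to a representative enumerate the orbit; the cyclic wrap holds because the
power given by the orbit's size fixes the representative. -/
theorem exists_orbit_equiv (θ : Equiv.Perm (Fin n)) (O : Quotient (orbitPartition θ)) {k : ℕ}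
    (hk : Nat.card (Orbit θ O) = k + 1) :
    ∃ e : Fin (k + 1) ≃ Orbit θ O, ∀ s, orbitNext θ (e s) = e (s + 1) := by
  classical
  induction O using Quotient.inductionOn with
  | _ x =>
  set s : Finset (Fin n) :=
    Finset.univ.filter fun i => Quotient.mk (orbitPartition θ) i = Quotient.mk _ x with hs
  have hmem : ∀ i, i ∈ s ↔ θ.SameCycle i x := by
    intro i
    simp only [hs, Finset.mem_filter, Finset.mem_univ, true_and]
    exact Quotient.eq
  have hcyc : θ.IsCycleOn s := by
    refine ⟨⟨fun i hi => ?_, θ.injective.injOn, fun i hi => ⟨θ.symm i, ?_, by simp⟩⟩,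
      fun i hi j hj => ?_⟩
    · simpa [hmem] using hi
    · have : i ∈ s := hi
      rw [hmem] at this
      change θ.symm i ∈ s
      rw [hmem]
      exact Equiv.Perm.sameCycle_apply_left.mp (by simpa using this)
    · exact ((hmem i).mp hi).trans ((hmem j).mp hj).symm
  have hxs : x ∈ s := (hmem x).mpr (Equiv.Perm.SameCycle.refl θ x)
  have hcard : s.card = k + 1 := by
    rw [← hk, Nat.card_eq_fintype_card, Fintype.card_subtype]
  have hpow : ∀ m : ℕ, Quotient.mk (orbitPartition θ) ((θ ^ m) x) = Quotient.mk _ x := by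
    intro m
    induction m with
    | zero => simp
    | succ m ih => rw [pow_succ', Equiv.Perm.mul_apply, mk_apply_eq, ih]
  let f : Fin (k + 1) → Orbit θ (Quotient.mk _ x) := fun r => ⟨(θ ^ (r : ℕ)) x, hpow r⟩
  have hf : Function.Bijective f := by
    rw [Fintype.bijective_iff_surjective_and_card]
    refine ⟨fun y => ?_, by rw [← Nat.card_eq_fintype_card (α := Orbit _ _), hk]; simp⟩
    obtain ⟨m, hm, hmy⟩ := hcyc.exists_pow_eq hxs ((hmem y).mpr (Quotient.exact y.2))
    exact ⟨⟨m, hcard ▸ hm⟩, Subtype.ext hmy⟩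
  refine ⟨Equiv.ofBijective f hf, fun r => Subtype.ext ?_⟩
  simp only [Equiv.ofBijective_apply, orbitNext, f]
  rw [← Equiv.Perm.mul_apply, ← pow_succ']
  induction r using Fin.lastCases with
  | last =>
    have := hcyc.pow_card_apply hxs
    rw [hcard] at this
    simpa using this
  | cast r => simp

theorem trace_pow_card_orbit {ν : Type*} [Fintype ν] [DecidableEq ν] (M : Matrix ν ν ℝ)
    (θ : Equiv.Perm (Fin n)) (O : Quotient (orbitPartition θ)) [Fintype (Orbit θ O)]
    [DecidableEq (Orbit θ O)] :
    trace (M ^ Nat.card (Orbit θ O)) =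
      ∑ g : Orbit θ O → ν, ∏ i, M (g i) (g (orbitNext θ i)) := by
  have hpos : 0 < Nat.card (Orbit θ O) := by
    have : Nonempty (Orbit θ O) := ⟨O.out, Quotient.out_eq O⟩
    exact Nat.card_pos
  obtain ⟨k, hk⟩ := Nat.exists_eq_add_of_le' hpos
  obtain ⟨e, he⟩ := exists_orbit_equiv θ O hk
  rw [hk, trace_pow_succ_eq_sum, ← (e.arrowCongr (Equiv.refl ν)).sum_comp]
  refine Finset.sum_congr rfl fun g _ => ?_
  rw [← e.prod_comp]
  simp [he]

/-- Equal multisets of values mean fibres of equal size, which can be matched one by one. -/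
theorem exists_equiv_of_map_eq {α β γ : Type*} [Fintype α] [Fintype β] [DecidableEq γ] {f : α → γ}
    {g : β → γ}
    (h : (Finset.univ : Finset α).val.map f = (Finset.univ : Finset β).val.map g) :
    ∃ e : α ≃ β, ∀ a, g (e a) = f a := by
  have hc : ∀ c, Fintype.card {a // f a = c} = Fintype.card {b // g b = c} := by
    intro c
    have := congrArg (Multiset.count c) h
    rw [Multiset.count_map, Multiset.count_map] at this
    rw [Fintype.card_subtype, Fintype.card_subtype]
    simpa [eq_comm, Finset.card, Finset.filter] using this
  exact ⟨Equiv.ofFiberEquiv fun c => Fintype.equivOfCardEq (hc c), Equiv.ofFiberEquiv_map _⟩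

open Classical in
theorem card_orbit_eq_card_support (θ : Equiv.Perm (Fin n)) {x : Fin n} (hx : θ x ≠ x) :
    Nat.card (Orbit θ (Quotient.mk _ x)) = (θ.cycleOf x).support.card := by
  rw [Nat.card_eq_fintype_card, Fintype.card_subtype]
  congr 1
  ext y
  simp only [Finset.mem_filter, Finset.mem_univ, true_and]
  rw [Equiv.Perm.mem_support_cycleOf_iff' hx, Quotient.eq]
  exact Equiv.Perm.sameCycle_comm

open Classical in
-- Nontrivial orbits correspond to the cycle factors, and fixed points give parts `1`; since both
-- multisets sum to `n`, the number of ones agrees.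
theorem map_card_orbit (θ : Equiv.Perm (Fin n)) :
    (Finset.univ : Finset (Quotient (orbitPartition θ))).val.map (fun O => Nat.card (Orbit θ O)) =
      θ.partition.parts := by
  set s : Finset (Quotient (orbitPartition θ)) :=
    Finset.univ.filter fun O => θ O.out ≠ O.out with hs
  have h1 : s.val.map (fun O => Nat.card (Orbit θ O)) = θ.cycleType := by
    have himg : s.image (fun O => θ.cycleOf O.out) = θ.cycleFactorsFinset := by
      ext c
      simp only [hs, Finset.mem_image, Finset.mem_filter, Finset.mem_univ, true_and]
      constructor
      · rintro ⟨O, hO, rfl⟩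
        exact Equiv.Perm.cycleOf_mem_cycleFactorsFinset_iff.mpr (Equiv.Perm.mem_support.mpr hO)
      · intro hc
        obtain ⟨x, hx⟩ := (Equiv.Perm.mem_cycleFactorsFinset_iff.mp hc).1.nonempty_support
        have hxc := Equiv.Perm.cycle_is_cycleOf hx hc
        have hxθ : θ x ≠ x :=
          Equiv.Perm.mem_support.mp (Equiv.Perm.mem_cycleFactorsFinset_support_le hc hx)
        have hsame : θ.SameCycle (Quotient.mk (orbitPartition θ) x).out x :=
          Quotient.exact (Quotient.out_eq (Quotient.mk (orbitPartition θ) x))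
        refine ⟨Quotient.mk _ x, ?_, ?_⟩
        · exact fun h => hxθ (hsame.apply_eq_self_iff.mp h)
        · rw [hxc, hsame.cycleOf_eq]
    have hinj : Set.InjOn (fun O : Quotient (orbitPartition θ) => θ.cycleOf O.out) s := by
      intro O hO O' hO' h
      rw [← Quotient.out_eq O, ← Quotient.out_eq O']
      exact Quotient.sound (Equiv.Perm.sameCycle_iff_cycleOf_eq_of_mem_support
        (Equiv.Perm.mem_support.mpr (Finset.mem_filter.mp hO).2)
        (Equiv.Perm.mem_support.mpr (Finset.mem_filter.mp hO').2) |>.mpr h)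
    rw [Equiv.Perm.cycleType_def, ← himg, Finset.image_val_of_injOn hinj, Multiset.map_map]
    refine Multiset.map_congr rfl fun O hO => ?_
    have hO' : θ O.out ≠ O.out := (Finset.mem_filter.mp (show O ∈ s from hO)).2
    have := card_orbit_eq_card_support θ hO'
    rw [Quotient.out_eq] at this
    simpa using this
  have h2 : (Finset.univ.filter fun O : Quotient (orbitPartition θ) => ¬ θ O.out ≠ O.out).val.map
      (fun O => Nat.card (Orbit θ O)) = Multiset.replicate
        (Finset.univ.filter fun O : Quotient (orbitPartition θ) => ¬ θ O.out ≠ O.out).card 1 := by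
    rw [Multiset.eq_replicate]
    refine ⟨by rw [Multiset.card_map]; rfl, fun c hc => ?_⟩
    obtain ⟨O, hO, rfl⟩ := Multiset.mem_map.mp hc
    have hO' : θ O.out = O.out := not_not.mp (Finset.mem_filter.mp (Finset.mem_val.mp hO)).2
    rw [Nat.card_eq_one_iff_unique]
    refine ⟨⟨fun a b => ?_⟩, ⟨O.out, Quotient.out_eq O⟩⟩
    have key : ∀ a : Orbit θ O, (a : Fin n) = O.out := by
      intro a
      have : θ.SameCycle O.out a := by
        exact Quotient.exact ((Quotient.out_eq O).trans a.2.symm)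
      exact (Equiv.Perm.SameCycle.eq_of_left this hO').symm
    exact Subtype.ext ((key a).trans (key b).symm)
  have h3 : (Finset.univ : Finset (Quotient (orbitPartition θ))).val.map
      (fun O => Nat.card (Orbit θ O)) = θ.cycleType + Multiset.replicate
        (Finset.univ.filter fun O : Quotient (orbitPartition θ) => ¬ θ O.out ≠ O.out).card 1 := by
    rw [← h1, ← h2, ← Multiset.map_add, hs, Finset.filter_val, Finset.filter_val,
      Multiset.filter_add_not]
  have hsum : ((Finset.univ : Finset (Quotient (orbitPartition θ))).val.map
      (fun O => Nat.card (Orbit θ O))).sum = n := by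
    change ∑ O : Quotient (orbitPartition θ), Nat.card (Orbit θ O) = n
    have := Fintype.card_congr (Equiv.sigmaFiberEquiv (Quotient.mk (orbitPartition θ)))
    rw [Fintype.card_sigma, Fintype.card_fin] at this
    simpa only [Nat.card_eq_fintype_card] using this
  have hparts := θ.partition.parts_sum
  rw [Equiv.Perm.parts_partition] at hparts ⊢
  rw [h3] at hsum ⊢
  simp only [Multiset.sum_add, Multiset.sum_replicate, smul_eq_mul, mul_one,
    Fintype.card_fin] at hsum hparts
  rw [Fintype.card_fin, show (Finset.univ.filter fun O : Quotient (orbitPartition θ) =>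
    ¬ θ O.out ≠ O.out).card = n - θ.support.card by omega]

theorem exists_equiv_orbits {lam : n.Partition} {θ : Equiv.Perm (Fin n)}
    (hθ : θ.partition.parts = lam.parts) :
    ∃ b : Fin (lam.parts.sort (· ≥ ·)).length ≃ Quotient (orbitPartition θ),
      ∀ i, Nat.card (Orbit θ (b i)) = (lam.parts.sort (· ≥ ·)).get i := by
  classical
  refine exists_equiv_of_map_eq (γ := ℕ) (g := fun O => Nat.card (Orbit θ O)) ?_
  rw [map_card_orbit, hθ]
  conv_rhs => rw [← Multiset.sort_eq lam.parts (· ≥ ·)]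
  exact (Fin.univ_val_map _).trans (congrArg _ (List.ofFn_get _))

end Orbits

/-! ### Cumulants as sums over coarsenings of a partition -/

section Coarsenings

variable {n : ℕ}

theorem parts_eq_image_part {ι : Type*} [Fintype ι] [DecidableEq ι]
    (π : Finpartition (Finset.univ : Finset ι)) : π.parts = Finset.univ.image π.part := by
  ext A
  rw [Finset.mem_image]
  constructor
  · intro hA
    obtain ⟨a, ha, h⟩ := π.part_surjOn hA
    exact ⟨a, Finset.mem_univ a, h⟩
  · rintro ⟨a, ha, rfl⟩
    exact π.part_mem.mpr ha

theorem mk_out_eq {Θ Ψ : Setoid (Fin n)} (h : Θ ≤ Ψ) (x : Fin n) :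
    Quotient.mk Ψ (Quotient.mk Θ x).out = Quotient.mk Ψ x :=
  Quotient.sound (h (Quotient.exact (Quotient.out_eq (Quotient.mk Θ x))))

open Classical in
-- Partitions of the set of `Θ`-blocks are the same as coarsenings of `Θ`, with the same number of
-- blocks.
theorem jointCumulant_eq_sum_coarsenings {Ω : Type*} [MeasurableSpace Ω] (P : Measure Ω)
    {ι : Type*} [Fintype ι] [DecidableEq ι] (X : ι → Ω → ℝ) (Θ : Setoid (Fin n))
    (b : ι ≃ Quotient Θ) :
    jointCumulant P X = ∑ Ψ with Θ ≤ Ψ, moebiusWeight Ψ *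
      ∏ B : Quotient Ψ, ∫ ω, ∏ i with Quotient.mk Ψ (b i).out = B, X i ω ∂P := by
  rw [jointCumulant, eq_comm]
  refine Finset.sum_bij' (fun Ψ _ => Finpartition.ofSetoid
      (Setoid.ker fun i => Quotient.mk Ψ (b i).out))
    (fun π _ => Setoid.ker fun x => π.part (b.symm (Quotient.mk Θ x))) ?_ ?_ ?_ ?_ ?_
  · intro Ψ _
    exact Finset.mem_univ _
  · intro π _
    simp only [Finset.mem_filter, Finset.mem_univ, true_and]
    intro x y hxy
    change π.part (b.symm (Quotient.mk Θ x)) = π.part (b.symm (Quotient.mk Θ y))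
    rw [Quotient.sound hxy]
  · intro Ψ hΨ
    have hΨ' := (Finset.mem_filter.mp hΨ).2
    ext x y
    rw [Setoid.ker_def, eq_comm, ← Finpartition.mem_part_iff_part_eq_part _ (Finset.mem_univ _)
      (Finset.mem_univ _), Finpartition.mem_part_ofSetoid_iff_rel, Setoid.ker_def]
    simp only [Equiv.apply_symm_apply, mk_out_eq hΨ']
    exact Quotient.eq
  · intro π _
    refine Finpartition.ext ?_
    rw [parts_eq_image_part π, Finpartition.ofSetoid, Finpartition.ofSetSetoid]
    refine Finset.image_congr fun a _ => ?_
    ext c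
    simp only [Finset.mem_filter, Finset.mem_univ, true_and]
    change Quotient.mk (Setoid.ker _) _ = Quotient.mk (Setoid.ker _) _ ↔ _
    rw [Quotient.eq, Setoid.ker_def]
    simp only [Quotient.out_eq, Equiv.symm_apply_apply]
    rw [π.mem_part_iff_part_eq_part (Finset.mem_univ _) (Finset.mem_univ _), eq_comm]
  · intro Ψ hΨ
    have hΨ' := (Finset.mem_filter.mp hΨ).2
    -- Each block of `Ψ` contains a block of `Θ`, so no block is lost and the Möbius weights agree.
    have hsurj : ∀ B : Quotient Ψ, ∃ i, Quotient.mk Ψ (b i).out = B := by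
      intro B
      induction B using Quotient.inductionOn with
      | _ x => exact ⟨b.symm (Quotient.mk Θ x), by rw [b.apply_symm_apply, mk_out_eq hΨ']⟩
    have hparts : (Finpartition.ofSetoid (Setoid.ker fun i => Quotient.mk Ψ (b i).out)).parts =
        Finset.univ.image fun B : Quotient Ψ =>
          Finset.univ.filter fun i => Quotient.mk Ψ (b i).out = B := by
      rw [Finpartition.ofSetoid, Finpartition.ofSetSetoid]
      ext A
      simp only [Finset.mem_image, Finset.mem_univ, true_and]
      constructor
      · rintro ⟨a, rfl⟩
        refine ⟨Quotient.mk Ψ (b a).out, Finset.filter_congr fun i _ => ?_⟩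
        exact eq_comm
      · rintro ⟨B, rfl⟩
        obtain ⟨a, rfl⟩ := hsurj B
        refine ⟨a, Finset.filter_congr fun i _ => ?_⟩
        exact eq_comm
    have hinj : Function.Injective fun B : Quotient Ψ =>
        Finset.univ.filter fun i => Quotient.mk Ψ (b i).out = B := by
      intro B B' h
      obtain ⟨a, rfl⟩ := hsurj B
      exact (Finset.mem_filter.mp ((Finset.ext_iff.mp h a).mp (by simp))).2
    rw [hparts, Finset.card_image_of_injective _ hinj, Finset.prod_image fun _ _ _ _ h => hinj h,
      moebiusWeight, blockCount, Nat.card_eq_fintype_card, Finset.card_univ]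

end Coarsenings

/-! ### Motzkin path expansion of products of moments -/

section PathExpansion

open MvPolynomial

variable {n : ℕ}

/-- The indices `(i, k, j)` of independent copies, coupled through `i`, of the variables
`ξ_{k+1, j}`. -/
abbrev LevelVar (n N : ℕ) : Type := Fin n × Fin N × Fin (2 * N + 1)

/-- The entries of the tridiagonal model as polynomials in the variables of the `i`-th copy. -/
noncomputable def entryPoly {N : ℕ} (i : Fin n) (k k' : Fin N) : MvPolynomial (LevelVar n N) ℝ :=
  if (k' : ℕ) = k then X (i, k, 0)
  else if (k' : ℕ) = k + 1 then
    ∑ j : Fin (2 * N + 1) with 1 ≤ j.val ∧ j.val ≤ 2 * ((k : ℕ) + 1),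
      C (1 / 2 : ℝ) * X (i, k, j) ^ 2
  else if (k : ℕ) = k' + 1 then 1
  else 0

/-- All copies evaluated at the same variables. -/
def levelGaussian {N : ℕ} (a : LevelVar n N) (ξ : ℕ × ℕ → ℝ) : ℝ := ξ ((a.2.1 : ℕ) + 1, a.2.2)

theorem eval_entryPoly {N : ℕ} (i : Fin n) (k k' : Fin N) (ξ : ℕ × ℕ → ℝ) :
    eval (fun a => levelGaussian a ξ) (entryPoly i k k') = triModel N ξ k k' := by
  simp only [entryPoly, triModel, Matrix.of_apply]
  split_ifs with h1 h2 h3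
  · simp [levelGaussian]
  · simp only [map_sum, map_mul, eval_C, map_pow, eval_X, levelGaussian]
    refine Finset.sum_bij (fun j _ => j.val) ?_ ?_ ?_ ?_
    · intro j hj
      simpa using hj
    · intro j _ j' _ h
      exact Fin.ext h
    · intro l hl
      rw [Finset.mem_Icc] at hl
      have hk := k'.isLt
      exact ⟨⟨l, by omega⟩, by simpa using hl, rfl⟩
    · intro j _
      ring
  · simp
  · simp

theorem vars_entryPoly {N : ℕ} {i : Fin n} {k k' : Fin N} {a : LevelVar n N}
    (ha : a ∈ (entryPoly i k k').vars) : a.1 = i := by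
  classical
  unfold entryPoly at ha
  split_ifs at ha with h1 h2 h3
  · rw [vars_X, Finset.mem_singleton] at ha
    rw [ha]
  · obtain ⟨j, _, hj⟩ := Finset.mem_biUnion.mp (vars_sum_subset _ _ ha)
    have h4 := vars_mul _ _ hj
    rw [vars_C, Finset.empty_union] at h4
    have h5 := vars_pow _ _ h4
    rw [vars_X, Finset.mem_singleton] at h5
    rw [h5]
  · simp at ha
  · simp at ha

open Classical in
/-- The trace of a power of the tridiagonal model, as a sum over closed paths. -/
noncomputable def orbitPoly (N : ℕ) (θ : Equiv.Perm (Fin n)) (O : Quotient (orbitPartition θ)) :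
    MvPolynomial (LevelVar n N) ℝ :=
  ∑ g : Orbit θ O → Fin N, ∏ i : Orbit θ O, entryPoly i (g i) (g (orbitNext θ i))

theorem eval_orbitPoly (N : ℕ) (θ : Equiv.Perm (Fin n)) (O : Quotient (orbitPartition θ))
    (ξ : ℕ × ℕ → ℝ) :
    eval (fun a => levelGaussian a ξ) (orbitPoly N θ O) =
      Matrix.trace (triModel N ξ ^ Nat.card (Orbit θ O)) := by
  classical
  rw [trace_pow_card_orbit]
  simp only [orbitPoly, map_sum, map_prod, eval_entryPoly]

theorem vars_orbitPoly {N : ℕ} {θ : Equiv.Perm (Fin n)} {O : Quotient (orbitPartition θ)}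
    {a : LevelVar n N} (ha : a ∈ (orbitPoly N θ O).vars) :
    Quotient.mk (orbitPartition θ) a.1 = O := by
  classical
  obtain ⟨g, _, hg⟩ := Finset.mem_biUnion.mp (vars_sum_subset _ _ ha)
  obtain ⟨i, _, hi⟩ := Finset.mem_biUnion.mp (vars_prod _ hg)
  rw [vars_entryPoly hi, i.2]

open Classical in
-- Choosing a closed path on every orbit amounts to choosing one function on all of `Fin n`.
theorem prod_orbitPoly (N : ℕ) (θ : Equiv.Perm (Fin n)) :
    ∏ O, orbitPoly N θ O = ∑ h : Fin n → Fin N, ∏ i, entryPoly i (h i) (h (θ i)) := by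
  simp only [orbitPoly]
  rw [Fintype.prod_sum]
  symm
  refine Finset.sum_nbij' (fun h O i => h i) (fun g i => g (Quotient.mk _ i) ⟨i, rfl⟩)
    ?_ ?_ ?_ ?_ ?_
  · intros; simp
  · intros; simp
  · intros; rfl
  · intro g _
    funext O i
    obtain ⟨i, rfl⟩ := i
    rfl
  · intro h _
    exact (Fintype.prod_fiberwise (Quotient.mk (orbitPartition θ))
      fun i => entryPoly i (h i) (h (θ i))).symm

theorem memLp_levelGaussian {N : ℕ} (a : LevelVar n N) (k : ℕ) :
    MemLp (levelGaussian a) k normalFamily := by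
  change MemLp (fun ξ : ℕ × ℕ → ℝ => ξ ((a.2.1 : ℕ) + 1, (a.2.2 : ℕ))) k normalFamily
  simpa using memLp_normalFamily (𝕜 := ℝ) ((a.2.1 : ℕ) + 1, (a.2.2 : ℕ)) k

/-- All copies are the same variables, so the covariance ignores the first index: this is the fully
coupled case. -/
theorem isWick_levelGaussian (n N : ℕ) :
    IsWick (fun a b : LevelVar n N => if a.2 = b.2 then (1 : ℝ) else 0)
      (expectation (P := normalFamily) memLp_levelGaussian) := by
  let idx : Fin N × Fin (2 * N + 1) → ℕ × ℕ := fun s => ((s.1 : ℕ) + 1, s.2)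
  have hidx : Function.Injective idx := by
    rintro ⟨a, b⟩ ⟨c, d⟩ h
    simp only [idx, Prod.mk.injEq, Nat.add_right_cancel_iff] at h
    exact Prod.ext (Fin.ext h.1) (Fin.ext h.2)
  have hm : ∀ s (k : ℕ), MemLp (fun ξ : ℕ × ℕ → ℝ => ξ (idx s)) k normalFamily :=
    fun s k => memLp_normalFamily (𝕜 := ℝ) (idx s) k
  have hw := isWick_expectation_of_iIndepFun (𝕜 := ℝ) (iIndepFun_normalFamily.precomp hidx)
    (v := fun _ => 1) (fun s => hasLaw_normalFamily (idx s)) hm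
  let A : LevelVar n N → Fin N × Fin (2 * N + 1) → ℝ := fun b s => if b.2 = s then 1 else 0
  have hA : ∀ b : LevelVar n N, levelGaussian b =ᵐ[normalFamily]
      fun ξ => ∑ s, A b s * ξ (idx s) := fun b =>
    Filter.Eventually.of_forall fun ξ => by simp [A, levelGaussian, idx]
  have hAw := isWick_expectation_linear hw A memLp_levelGaussian hA
  have hcov : (fun a b => ∑ s, ∑ t, A a s *
      (if s = t then (((1 : NNReal) : ℝ) : ℝ) else 0) * A b t) =
        fun a b : LevelVar n N => if a.2 = b.2 then (1 : ℝ) else 0 := by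
    funext a b
    simp [A, eq_comm]
  exact hcov ▸ hAw

/-- The covariances of copies coupled by a partition. -/
noncomputable def levelCov (N : ℕ) (Ψ : Setoid (Fin n)) (a b : LevelVar n N) : ℝ :=
  partitionMatrix Ψ a.1 b.1 * if a.2 = b.2 then 1 else 0

theorem partitionMatrix_comm (Ψ : Setoid (Fin n)) (i j : Fin n) :
    partitionMatrix Ψ i j = partitionMatrix Ψ j i := by
  simp only [partitionMatrix]
  congr 1
  exact propext ⟨Ψ.symm, Ψ.symm⟩

theorem isWick_levelCov (N : ℕ) (Ψ : Setoid (Fin n)) :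
    IsWick (levelCov N Ψ) (wick (levelCov N Ψ)) :=
  isWick_wick fun a b => by
    simp only [levelCov, partitionMatrix_comm Ψ a.1 b.1, eq_comm]

open Classical in
-- Under `levelCov N Ψ` the copies are fully coupled inside a block of `Ψ` and uncorrelated across
-- blocks, so one Wick functional factors into the separate moments.
theorem prod_integral_trace_eq_wick (N : ℕ) {θ : Equiv.Perm (Fin n)} {Ψ : Setoid (Fin n)}
    (hΨ : orbitPartition θ ≤ Ψ) :
    ∏ B : Quotient Ψ, ∫ ξ, ∏ O : Quotient (orbitPartition θ) with Quotient.mk Ψ O.out = B,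
        Matrix.trace (triModel N ξ ^ Nat.card (Orbit θ O)) ∂normalFamily =
      ∑ h : Fin n → Fin N, wick (levelCov N Ψ) (∏ i, entryPoly i (h i) (h (θ i))) := by
  have h1 := (isWick_levelCov N Ψ).prod_of_blocks (isWick_levelGaussian n N)
    (fun a => Quotient.mk Ψ a.1) (by
      intro a b
      simp only [levelCov, partitionMatrix, Quotient.eq]
      split_ifs <;> simp) Finset.univ
    (fun B => ∏ O : Quotient (orbitPartition θ) with Quotient.mk Ψ O.out = B, orbitPoly N θ O) (by
      intro B _ a ha
      obtain ⟨O, hO, haO⟩ := Finset.mem_biUnion.mp (vars_prod _ ha)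
      rw [← (Finset.mem_filter.mp hO).2, ← vars_orbitPoly haO, mk_out_eq hΨ])
  rw [Finset.prod_fiberwise, prod_orbitPoly, map_sum] at h1
  rw [h1]
  refine Finset.prod_congr rfl fun B _ => ?_
  rw [expectation_apply]
  simp only [map_prod, eval_orbitPoly]

theorem mem_motzkin_succ {N : ℕ} {θ : Equiv.Perm (Fin n)} {h : Fin n → Fin N} :
    (fun i => (h i : ℕ) + 1) ∈ motzkin N θ ↔
      ∀ i, (h (θ i) : ℕ) = h i ∨ (h (θ i) : ℕ) = h i + 1 ∨ (h i : ℕ) = h (θ i) + 1 := by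
  simp only [motzkin, Finset.mem_filter, Fintype.mem_piFinset, Finset.mem_Icc]
  constructor
  · intro hh i
    have := hh.2 i
    rw [abs_le] at this
    push_cast at this
    omega
  · intro hh
    refine ⟨fun i => ⟨by omega, (h i).isLt⟩, fun i => ?_⟩
    have := hh i
    rw [abs_le]
    push_cast
    omega

theorem wick_levelCov_prod_eq_zero {N : ℕ} {θ : Equiv.Perm (Fin n)} {h : Fin n → Fin N}
    (hh : (fun i => (h i : ℕ) + 1) ∉ motzkin N θ) (Ψ : Setoid (Fin n)) :
    wick (levelCov N Ψ) (∏ i, entryPoly i (h i) (h (θ i))) = 0 := by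
  rw [mem_motzkin_succ, not_forall] at hh
  obtain ⟨i, hi⟩ := hh
  simp only [not_or] at hi
  rw [Finset.prod_eq_zero (Finset.mem_univ i), map_zero]
  rw [entryPoly, if_neg hi.1, if_neg hi.2.1, if_neg hi.2.2]

/-- A path selects one level per `i`. The substitution `z_{ij} ↦ X (i, h i, j)` carries `f^h` to the
product of entries, descents contributing `1`, and pulls `levelCov` back to `pathCov`. -/
theorem wick_levelCov_prod {N : ℕ} {θ : Equiv.Perm (Fin n)} {h : Fin n → Fin N}
    (hh : (fun i => (h i : ℕ) + 1) ∈ motzkin N θ) (Ψ : Setoid (Fin n)) :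
    wick (levelCov N Ψ) (∏ i, entryPoly i (h i) (h (θ i))) =
      wick (pathCov N (fun i => (h i : ℕ) + 1) (partitionMatrix Ψ))
        (pathPolynomial N θ fun i => (h i : ℕ) + 1) := by
  rw [mem_motzkin_succ] at hh
  let A : Var n N → LevelVar n N → ℝ := fun a s => if (a.1, h a.1, a.2) = s then 1 else 0
  have hA : ∀ a, linearSubst A (X a) = X (a.1, h a.1, a.2) := by
    intro a
    rw [linearSubst_X]
    simp [A]
  have hpoly : linearSubst A (pathPolynomial N θ fun i => (h i : ℕ) + 1) =
      ∏ i, entryPoly i (h i) (h (θ i)) := by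
    simp only [pathPolynomial, map_mul, map_prod, map_sum, map_pow, hA, stepSet]
    rw [Finset.prod_filter, Finset.prod_filter, ← Finset.prod_mul_distrib]
    refine Finset.prod_congr rfl fun i _ => ?_
    have hi := hh i
    have hC : linearSubst A (C (1 / 2 : ℝ)) = C (1 / 2) := (linearSubst A).commutes _
    rw [hC, entryPoly]
    push_cast
    rcases hi with hi | hi | hi
    · rw [if_pos (by omega), if_neg (by omega), if_pos hi, mul_one]
    · rw [if_neg (by omega), if_pos (by omega), if_neg (by omega), if_pos hi, one_mul]
    · rw [if_neg (by omega), if_neg (by omega), if_neg (by omega), if_neg (by omega), if_pos hi,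
        one_mul]
  have h1 := (isWick_levelCov N Ψ).comp_linearSubst A
  have hcov : (fun a b => ∑ s, ∑ t, A a s * levelCov N Ψ s t * A b t) =
      pathCov N (fun i => (h i : ℕ) + 1) (partitionMatrix Ψ) := by
    funext a b
    simp only [A, ite_mul, one_mul, zero_mul, mul_ite, mul_one, mul_zero, Finset.sum_ite_eq,
      Finset.mem_univ, if_true]
    simp [levelCov, pathCov, Fin.ext_iff]
  rw [hcov] at h1
  have h2 : IsWick (pathCov N (fun i => (h i : ℕ) + 1) (partitionMatrix Ψ))
      (wick (pathCov N (fun i => (h i : ℕ) + 1) (partitionMatrix Ψ))) :=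
    isWick_wick fun a b => by
      simp only [pathCov, partitionMatrix_comm Ψ a.1 b.1, eq_comm]
  rw [← h1.unique h2, ← hpoly]
  rfl

theorem sum_wick_levelCov (N : ℕ) (θ : Equiv.Perm (Fin n)) (Ψ : Setoid (Fin n)) :
    ∑ h : Fin n → Fin N, wick (levelCov N Ψ) (∏ i, entryPoly i (h i) (h (θ i))) =
      ∑ h ∈ motzkin N θ,
        wick (pathCov N h (partitionMatrix Ψ)) (pathPolynomial N θ h) := by
  classical
  rw [← Finset.sum_filter_of_ne (p := fun h : Fin n → Fin N =>
    (fun i => (h i : ℕ) + 1) ∈ motzkin N θ) fun h _ hne => by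
      by_contra hh
      exact hne (wick_levelCov_prod_eq_zero hh Ψ)]
  refine Finset.sum_bij (fun h _ i => (h i : ℕ) + 1) ?_ ?_ ?_ ?_
  · intro h hh
    exact (Finset.mem_filter.mp hh).2
  · intro h _ h' _ heq
    funext i
    exact Fin.ext (Nat.succ_injective (congrFun heq i))
  · intro h hh
    have hr : ∀ i, 1 ≤ h i ∧ h i ≤ N := fun i =>
      Finset.mem_Icc.mp (Fintype.mem_piFinset.mp (Finset.mem_filter.mp hh).1 i)
    have heq : (fun i => h i - 1 + 1) = h := funext fun i => Nat.sub_add_cancel (hr i).1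
    refine ⟨fun i => ⟨h i - 1, by have := hr i; omega⟩, ?_, heq⟩
    simp only [Finset.mem_filter, Finset.mem_univ, true_and, heq, hh]
  · intro h hh
    exact wick_levelCov_prod (Finset.mem_filter.mp hh).2 Ψ

end PathExpansion

/-! ### Assembly: the cumulant as a Möbius sum over coarsenings and Motzkin paths, then as a sum
over trees. -/

open Classical in
theorem traceCumulant_eq {n N : ℕ} (hN : 0 < N) {Ω : Type*} [MeasurableSpace Ω] (P : Measure Ω)
    [IsProbabilityMeasure P] (Ξ : Ω → Matrix (Fin N) (Fin N) ℂ) (hΞ : IsStandardGUE Ξ P)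
    (lam : n.Partition) (θ : Equiv.Perm (Fin n)) (hθ : θ.partition.parts = lam.parts) :
    traceCumulant P Ξ lam = ∑ Ψ with orbitPartition θ ≤ Ψ, moebiusWeight Ψ *
      ∑ h ∈ motzkin N θ, wick (pathCov N h (partitionMatrix Ψ)) (pathPolynomial N θ h) := by
  obtain ⟨b, hb⟩ := exists_equiv_orbits hθ
  rw [traceCumulant, jointCumulant_eq_sum_coarsenings P _ (orbitPartition θ) b]
  refine Finset.sum_congr rfl fun Ψ hΨ => ?_
  rw [← sum_wick_levelCov, ← prod_integral_trace_eq_wick N (Finset.mem_filter.mp hΨ).2]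
  congr 1
  refine Finset.prod_congr rfl fun B _ => ?_
  rw [hΞ.integral_prod_trace hN]
  refine integral_congr_ae (ae_of_all _ fun ξ => ?_)
  refine Finset.prod_equiv b (by simp) fun i _ => ?_
  rw [hb]

end GUECumulant

open GUECumulant MeasureTheory

theorem mainTheorem4 {n N : ℕ} (hn : 0 < n) (hN : 0 < N)
    {Ω : Type*} [MeasurableSpace Ω] (P : Measure Ω) [IsProbabilityMeasure P]
    (Ξ : Ω → Matrix (Fin N) (Fin N) ℂ) (hΞ : IsStandardGUE Ξ P)
    (lam : n.Partition) (θ : Equiv.Perm (Fin n)) (hθ : θ.partition.parts = lam.parts) :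
    traceCumulant P Ξ lam =
        ∑ x ∈ trees (orbitPartition θ) ×ˢ motzkin N θ, expansionTerm N θ x.1 x.2 ∧
      ∀ Γ ∈ trees (orbitPartition θ), ∀ h ∈ motzkin N θ,
        ¬ ((∀ e ∈ Γ, ∀ i ∈ e, ∀ i' ∈ e, h i = h i') ∧
            (∀ e ∈ Γ, (∀ i ∈ e, i ∈ stepSet θ h 0) ∨ (∀ i ∈ e, i ∈ stepSet θ h 1)) ∧
            (∀ i ∈ stepSet θ h 0, (Γ.filter fun e => i ∈ e).card ≤ 1) ∧
            (∀ i : Fin n, (Γ.filter fun e => i ∈ e).card ≤ 2)) →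
          expansionTerm N θ Γ h = 0 := by
  refine ⟨?_, fun Γ _ h _ hcond => expansionTerm_eq_zero hcond⟩
  rw [traceCumulant_eq hN P Ξ hΞ lam θ hθ, Finset.sum_product, Finset.sum_comm]
  simp only [sum_trees_expansionTerm N hn, Finset.mul_sum]
  exact Finset.sum_comm
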